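/- A symmetric billiard configuration is a pair $(K,T)$ of $C^1$-smooth, strictly convex, centrally symmetric ($K=-K$, $T=-T$) compact convex bodies in $\mathbb R^2$; $n_K$, $n_T$ denote their outer unit normals and $h_K$, $h_T$ their support functions, $h_T(u)=\sup_{x\in T}\langle x,u\rangle$. A $(K,T)$-billiard trajectory is a sequence $(q_n,p_n)_{n\in\mathbb Z}$ in $\partial K\times\partial T$ such that, for every $n$, $q_{n+1}-q_n$ is a positive multiple of $-n_T(p_n)$ and $p_{n+1}-p_n$ is a positive multiple of $n_K(q_{n+1})$. The polygonal line $(q_n)$ is called a $T$-billiard trajectory in $K$, and $(p_n)$ its dual $K$-billiard trajectory in $T$. (Since $K$ and $T$ are centrally symmetric, the $K$-billiard trajectories in $T$ are the first components of the $(T,K)$-billiard trajectories.) An oriented line is positively tangent to a compact convex set $C$ if it meets $C$ and $C$ lies in the closed half-plane to its left; a line is tangent to $C$ if one of its two orientations is positively tangent. A convex $T$-caustic in $K$ is a non-empty compact convex set $C\subset \operatorname{int}K$ such that every $T$-billiard trajectory in $K$, once one of its links lies on a line tangent to $C$, has the same property after every reflection; $\mathfrak C(K,T)$ is the set of these. Caustics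 $C\in\mathfrak C(K,T)$ and $C'\in\mathfrak C(T,K)$ are dual if a $T$-billiard trajectory in $K$ is tangent to $C$ if and only if the dual $K$-billiard trajectory in $T$ is tangent to $C'$. The rotation number of $C\in\mathfrak C(K,T)$ is the Poincaré rotation number of the orientation preserving homeomorphism $q\mapsto q'$ of $\partial K\cong\mathbb R/\mathbb Z$ which sends $q$ to the second endpoint of the chord of $K$ that starts at $q$ and is positively tangent to $C$ (the billiard map on the invariant circle of $C$); it is computed with the lift $f$ satisfying $\theta<f(\theta)<\theta+1$. The perimeter $\operatorname{Per}_{h_T}(C)$ is the length of the boundary curve of $C$ measured with $h_T$. The Lazutkin parameter of $C\in\mathfrak C(K,T)$ is $L-\operatorname{Per}_{h_T}(C)$, where $L>\operatorname{Per}_{h_T}(C)$ is the string length for which $K=\{x\in\mathbb R^2:\operatorname{Per}_{h_T}(\operatorname{Conv}(\{x\}\cup C))\le L\}$. **Proposition.** Let $(K,T)$ be a symmetric billiard configuration and let $C\in\mathfrak C(K,T)$ and $C'\in\mathfrak C(T,K)$ be dual convex caustics. Then the rotation numbers of $C$ and $C'$ are well defined and equal. If, moreover, $C$ and $C'$ are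 $C^1$-smooth strictly convex bodies, then $\operatorname{Per}_{h_T}(C)=\operatorname{Per}_{h_K}(C')$, and the Lazutkin parameters of $C$ (for the $T$-billiard in $K$) and of $C'$ (for the $K$-billiard in $T$) are well defined and equal. -/

import Mathlib

open Set Filter Topology

noncomputable section

/-- The Euclidean plane. It serves both as the position plane and as the momentum plane. -/
abbrev Plane : Type := EuclideanSpace ℝ (Fin 2)

/-- The determinant of the matrix with columns `v`, `w`. -/
def det2 (v w : Plane) : ℝ := v 0 * w 1 - v 1 * w 0

/-- The boundary of `K` is a `C¹` curve and `K` lies locally on one side of it: near every boundary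
point, `K` is the sublevel set of a `C¹` function with non-vanishing derivative. -/
def HasC1Boundary (K : Set Plane) : Prop :=
  ∀ x ∈ frontier K, ∃ F : Plane → ℝ,
    ContDiffAt ℝ 1 F x ∧ fderiv ℝ F x ≠ 0 ∧ ∀ᶠ y in 𝓝 x, (y ∈ K ↔ F y ≤ 0)

/-- A `C¹`-smooth, strictly convex body (compact, convex, with non-empty interior). -/
structure IsSmoothStrictlyConvexBody (K : Set Plane) : Prop where
  isCompact : IsCompact K
  convex : Convex ℝ K
  interior_nonempty : (interior K).Nonempty
  strictConvex : StrictConvex ℝ K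
  c1 : HasC1Boundary K

/-- A symmetric billiard configuration: two `C¹`-smooth, strictly convex, centrally symmetric
planar convex bodies. -/
structure IsSymmetricConfiguration (K T : Set Plane) : Prop where
  body_left : IsSmoothStrictlyConvexBody K
  body_right : IsSmoothStrictlyConvexBody T
  symm_left : ∀ x ∈ K, -x ∈ K
  symm_right : ∀ x ∈ T, -x ∈ T

/-- The support function `h_T`. -/
def supportFn (T : Set Plane) (u : Plane) : ℝ :=
  sSup ((fun x : Plane => inner ℝ x u) '' T)

/-- `v` is a non-zero outer normal vector of `K` at the boundary point `x`. If `K` is smooth, this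
says that `v` is a positive multiple of the outer unit normal `n_K(x)`. -/
def IsOuterNormal (K : Set Plane) (x v : Plane) : Prop :=
  x ∈ frontier K ∧ v ≠ 0 ∧ ∀ y ∈ K, inner ℝ v (y - x) ≤ 0

/-- The sequence of bounces of a `(K,T)`-billiard trajectory. From `(q n, p n)` the point moves in
`K × ∂T` in the direction `-n_T(p n)` until it hits `∂K` at `q (n + 1)`; then it moves in `∂K × T`
in the direction `n_K(q (n + 1))` until it hits `∂T` at `p (n + 1)`. The polygonal line with
vertices `q n` is a `T`-billiard trajectory in `K`, the one with vertices `p n` is the dual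
`K`-billiard trajectory in `T`. -/
structure IsBilliardTrajectory (K T : Set Plane) (q p : ℤ → Plane) : Prop where
  q_mem : ∀ n, q n ∈ frontier K
  p_mem : ∀ n, p n ∈ frontier T
  q_move : ∀ n, IsOuterNormal T (p n) (q n - q (n + 1))
  p_move : ∀ n, IsOuterNormal K (q (n + 1)) (p (n + 1) - p n)

/-- The oriented line through `x` with direction `v` is positively tangent to `C`: it meets `C`,
and `C` lies in the closed half-plane to its left. -/
def IsPosTangent (C : Set Plane) (x v : Plane) : Prop :=
  (∃ t : ℝ, x + t • v ∈ C) ∧ ∀ y ∈ C, 0 ≤ det2 v (y - x)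

/-- The line through `x` with direction `v` is (positively or negatively) tangent to `C`. -/
def IsTangent (C : Set Plane) (x v : Plane) : Prop :=
  IsPosTangent C x v ∨ IsPosTangent C x (-v)

/-- All links of the polygonal line with vertices `q n` are tangent to `C`. -/
def IsTangentTrajectory (C : Set Plane) (q : ℤ → Plane) : Prop :=
  ∀ n, IsTangent C (q n) (q (n + 1) - q n)

/-- `C` is a convex `T`-caustic in the table `K`: a non-empty compact convex set inside the table
such that every `T`-billiard trajectory in `K`, once tangent to `C`, is again tangent to `C` after
each reflection. (Caustics with empty interior, such as the segment between the foci of an ellipse,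
are included.) -/
structure IsConvexCaustic (K T C : Set Plane) : Prop where
  isCompact : IsCompact C
  convex : Convex ℝ C
  nonempty : C.Nonempty
  subset_interior : C ⊆ interior K
  stays_tangent : ∀ q p : ℤ → Plane, IsBilliardTrajectory K T q p → ∀ n,
    IsTangent C (q n) (q (n + 1) - q n) → IsTangent C (q (n + 1)) (q (n + 1 + 1) - q (n + 1))

/-- Duality of a `T`-caustic `C` in `K` and a `K`-caustic `C'` in `T`: a `T`-billiard trajectory in
`K` is tangent to `C` if and only if the dual `K`-billiard trajectory in `T` is tangent to `C'`. -/
def AreDualCaustics (K T C C' : Set Plane) : Prop :=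
  ∀ q p : ℤ → Plane, IsBilliardTrajectory K T q p →
    (IsTangentTrajectory C q ↔ IsTangentTrajectory C' p)

/-- The ray from the origin through the non-zero point `x` makes the angle `2πθ` with the first
coordinate axis. For a centrally symmetric convex body `K`, this is an orientation preserving
identification of `∂K` with the circle `ℝ/ℤ`. -/
def AtAngle (θ : ℝ) (x : Plane) : Prop :=
  ∃ ρ : ℝ, 0 < ρ ∧ x = ρ • !₂[Real.cos (2 * Real.pi * θ), Real.sin (2 * Real.pi * θ)]

/-- `ω` is the rotation number of the `T`-caustic `C` in `K`. The invariant circle of `C` consists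
of the starting points, one over each `q ∈ ∂K`, of the trajectories leaving `q` along the line
positively tangent to `C`; the billiard map restricts to it as an orientation preserving circle
homeomorphism. Its lift `f` with `θ < f θ < θ + 1` is required here to exist, and `ω` is its
Poincaré rotation number `lim fⁿ(θ) / n`. -/
def IsRotationNumber (K T C : Set Plane) (ω : ℝ) : Prop :=
  ∃ f : CircleDeg1Lift,
    (∀ θ : ℝ, θ < f θ ∧ f θ < θ + 1 ∧
      ∃ q p : ℤ → Plane, IsBilliardTrajectory K T q p ∧ IsPosTangent C (q 0) (q 1 - q 0) ∧
        AtAngle θ (q 0) ∧ AtAngle (f θ) (q 1)) ∧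
    CircleDeg1Lift.translationNumber f = ω

/-- The points `x 0, …, x n` are the vertices, in counter-clockwise order, of a convex polygon
inscribed in `C` (possibly a degenerate one with one or two vertices). The indices are cyclic. -/
def IsInscribedPolygon (C : Set Plane) {n : ℕ} (x : Fin (n + 1) → Plane) : Prop :=
  (∀ i, x i ∈ frontier C) ∧
    ∀ i j, j ≠ i → j ≠ i + 1 → 0 < det2 (x (i + 1) - x i) (x j - x i)

/-- The `h_T`-perimeter of a planar compact convex set `C`: the `h_T`-length of the closed convex
curve bounding `C`, that is, the supremum of the `h_T`-lengths of the closed polygonal lines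
inscribed in it. (For a segment this is twice its length.) -/
def perimeter (T C : Set Plane) : ℝ :=
  sSup {l : ℝ | ∃ (n : ℕ) (x : Fin (n + 1) → Plane), IsInscribedPolygon C x ∧
    l = ∑ i, supportFn T (x (i + 1) - x i)}

/-- The result of the `h_T`-string construction over `C` with string length `L`. -/
def stringBody (T C : Set Plane) (L : ℝ) : Set Plane :=
  {x | perimeter T (convexHull ℝ (insert x C)) ≤ L}

/-- `l` is the Lazutkin parameter of the `T`-caustic `C` in `K`: the table `K` is the result of the
`h_T`-string construction over `C` with some string length `L > Per_{h_T}(C)`, and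
`l = L - Per_{h_T}(C)`. -/
def IsLazutkinParameter (K T C : Set Plane) (l : ℝ) : Prop :=
  ∃ L : ℝ, perimeter T C < L ∧ K = stringBody T C L ∧ l = L - perimeter T C

end

/-! Parametrize the boundaries of K and T by the angle, as `x` and `y`, with derivatives `v` and
`w`. A trajectory lifts to two increasing real sequences θ_n, β_n
(`IsBilliardTrajectory.exists_lift`). A link has the direction `rot (w β_n)`, so the tangent angles
of the θ_n and of the β_n interlace up to a quarter turn.

Rotation numbers. A caustic only preserves unoriented tangency, but the orientation persists as well
(`IsConvexCaustic.posTangent_next`), so a trajectory positively tangent to C is an orbit of the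
chord map of C. By interlacing, θ_n and β_n grow at the same rate. If the dual trajectory is
positively tangent to C', the two rotation numbers therefore agree. If it is negatively tangent, its
reversal is an orbit of the chord map of C', and the numbers add up to 1; neither exceeds 1/2
(`rotation_le_half`), so both equal 1/2.

Perimeters. The total variation of ⟨z, ·⟩ along the boundary of T is 4 h_T(z). Integrating this
Cauchy–Crofton identity shows that the h_T-perimeter of a body D is the integral of h_D(w) over one
period (`perimeter_eq`). Hence adding a point z to C lengthens the string by the integral of the
positive part of ⟨z, w⟩ - h_C(w), called `excess`. For z = x(θ_{n+1}) this positive part lives on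
[β_n, β_{n+1}] (`IsTangentOrbit.visible`), and the reflection law makes the excess stationary along
the boundary of K. So it is constant there, and the constant is the Lazutkin parameter.

Duality. Let F(θ, b) = ⟨x(θ), y(b)⟩ - ∫₀ᵇ h_C(w) + ∫₀^θ h_{C'}(-v) (`couplingDefect`). Tangency to C
makes ∂F/∂b vanish at (θ_{n+1}, β_n), and tangency of the dual trajectory to C' makes ∂F/∂θ vanish
there. Hence F has the same value at all these pairs (`couplingDefect_const`). A full turn of both
variables changes F by Per C' - Per C, so the perimeters agree. The two Lazutkin parameters are
F(θ_1, β_1) - F(θ_1, β_0) and F(θ_1, β_1) - F(θ_2, β_1), which agree because F(θ_1, β_0) = F(θ_2,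
β_1).

No differentiability of θ ↦ β is needed. Both constancy statements are envelope arguments: an
extremal property in b, combined with a vanishing derivative in θ, bounds increments by ε|Δθ| in
both directions. -/

/-! ### Plane linear algebra -/

/-- Rotation by a right angle. -/
noncomputable def rot (x : Plane) : Plane := !₂[-x 1, x 0]

/-- The unit vector at angle `2πθ`. -/
noncomputable def dir (θ : ℝ) : Plane := !₂[Real.cos (2 * Real.pi * θ), Real.sin (2 * Real.pi * θ)]

@[simp] theorem rot_zero (x : Plane) : rot x 0 = -x 1 := rfl
@[simp] theorem rot_one (x : Plane) : rot x 1 = x 0 := rfl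
@[simp] theorem dir_zero (θ : ℝ) : dir θ 0 = Real.cos (2 * Real.pi * θ) := rfl
@[simp] theorem dir_one (θ : ℝ) : dir θ 1 = Real.sin (2 * Real.pi * θ) := rfl

theorem inner_plane (x y : Plane) : inner ℝ x y = x 0 * y 0 + x 1 * y 1 := by
  simp [PiLp.inner_apply, Fin.sum_univ_two, mul_comm]

theorem plane_ext {x y : Plane} (h0 : x 0 = y 0) (h1 : x 1 = y 1) : x = y := by
  ext i; fin_cases i <;> assumption

theorem plane_ne_zero {x : Plane} (h : x ≠ 0) : 0 < x 0 ^ 2 + x 1 ^ 2 := by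
  by_contra h'
  apply h
  have h0 : x 0 = 0 := by nlinarith [sq_nonneg (x 0), sq_nonneg (x 1)]
  have h1 : x 1 = 0 := by nlinarith [sq_nonneg (x 0), sq_nonneg (x 1)]
  exact plane_ext (by simpa using h0) (by simpa using h1)

theorem det2_add_right (v x y : Plane) : det2 v (x + y) = det2 v x + det2 v y := by
  simp [det2]; ring
theorem det2_sub_right (v x y : Plane) : det2 v (x - y) = det2 v x - det2 v y := by
  simp [det2]; ring
theorem det2_sub_left (v x y : Plane) : det2 (x - y) v = det2 x v - det2 y v := by
  simp [det2]; ring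
theorem det2_smul_right (c : ℝ) (v x : Plane) : det2 v (c • x) = c * det2 v x := by
  simp [det2]; ring
theorem det2_smul_left (c : ℝ) (v x : Plane) : det2 (c • v) x = c * det2 v x := by
  simp [det2]; ring
theorem det2_neg_right (v x : Plane) : det2 v (-x) = -det2 v x := by
  simp [det2]; ring
theorem det2_neg_left (v x : Plane) : det2 (-v) x = -det2 v x := by
  simp [det2]; ring
theorem det2_self (v : Plane) : det2 v v = 0 := by simp [det2]; ring
theorem det2_swap (v w : Plane) : det2 v w = -det2 w v := by simp [det2]; ring
theorem det2_zero_right (v : Plane) : det2 v 0 = 0 := by simp [det2]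
theorem det2_rot_right (v w : Plane) : det2 v (rot w) = inner ℝ v w := by
  simp [det2, inner_plane]
theorem det2_rot_left (v w : Plane) : det2 (rot v) w = -inner ℝ v w := by
  simp [det2, inner_plane]; ring
theorem inner_rot_right (v w : Plane) : inner ℝ v (rot w) = -det2 v w := by
  simp [det2, inner_plane]; ring
theorem inner_rot_left (v w : Plane) : inner ℝ (rot v) w = det2 v w := by
  simp [det2, inner_plane]; ring

@[fun_prop] theorem Continuous.det2 {X : Type*} [TopologicalSpace X] {f g : X → Plane}
    (hf : Continuous f) (hg : Continuous g) : Continuous fun x => det2 (f x) (g x) := by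
  unfold _root_.det2; fun_prop

theorem rot_ne_zero {x : Plane} (h : x ≠ 0) : rot x ≠ 0 := by
  intro h'
  apply h
  have h0 := congrArg (fun z : Plane => z 0) h'
  have h1 := congrArg (fun z : Plane => z 1) h'
  exact plane_ext (by simpa using h1) (by simpa using h0)

theorem rot_rot (x : Plane) : rot (rot x) = -x := plane_ext (by simp) (by simp)
theorem rot_smul (c : ℝ) (x : Plane) : rot (c • x) = c • rot x := plane_ext (by simp) (by simp)
theorem rot_neg (x : Plane) : rot (-x) = -rot x := plane_ext (by simp) (by simp)

/-- Vectors with vanishing determinant are parallel. -/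
theorem exists_smul_of_det2_eq_zero {u x : Plane} (hu : u ≠ 0) (h : det2 u x = 0) :
    ∃ t : ℝ, x = t • u := by
  have h' := plane_ne_zero hu
  refine ⟨(u 0 * x 0 + u 1 * x 1) / (u 0 ^ 2 + u 1 ^ 2), ?_⟩
  unfold det2 at h
  apply plane_ext
  · simp only [PiLp.smul_apply, smul_eq_mul]
    rw [div_mul_eq_mul_div, eq_div_iff h'.ne']
    linear_combination -u 1 * h
  · simp only [PiLp.smul_apply, smul_eq_mul]
    rw [div_mul_eq_mul_div, eq_div_iff h'.ne']
    linear_combination u 0 * h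

/-! ### Angles -/

theorem atAngle_iff {θ : ℝ} {x : Plane} : AtAngle θ x ↔ ∃ ρ : ℝ, 0 < ρ ∧ x = ρ • dir θ := Iff.rfl

theorem dir_add_one (θ : ℝ) : dir (θ + 1) = dir θ := by
  apply plane_ext <;> simp [mul_add]

theorem dir_add_half (θ : ℝ) : dir (θ + 1 / 2) = -dir θ := by
  have : 2 * Real.pi * (θ + 1 / 2) = 2 * Real.pi * θ + Real.pi := by ring
  apply plane_ext <;> simp only [dir_zero, dir_one, this, PiLp.neg_apply] <;> simp

theorem dir_add_quarter (θ : ℝ) : dir (θ + 1 / 4) = rot (dir θ) := by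
  have : 2 * Real.pi * (θ + 1 / 4) = 2 * Real.pi * θ + Real.pi / 2 := by ring
  apply plane_ext <;> simp only [dir_zero, dir_one, this, rot_zero, rot_one] <;>
    simp [Real.cos_add_pi_div_two, Real.sin_add_pi_div_two]

theorem dir_ne_zero (θ : ℝ) : dir θ ≠ 0 := by
  intro h
  have h0 := congrArg (fun z : Plane => z 0) h
  have h1 := congrArg (fun z : Plane => z 1) h
  simp at h0 h1
  have := Real.sin_sq_add_cos_sq (2 * Real.pi * θ)
  rw [h0, h1] at this
  norm_num at this

theorem dir_add_int (θ : ℝ) (n : ℤ) : dir (θ + n) = dir θ := by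
  have : 2 * Real.pi * (θ + n) = 2 * Real.pi * θ + n * (2 * Real.pi) := by ring
  apply plane_ext <;> simp only [dir_zero, dir_one, this]
  · exact Real.cos_add_int_mul_two_pi _ _
  · exact Real.sin_add_int_mul_two_pi _ _

theorem AtAngle.ne_zero {θ : ℝ} {x : Plane} (h : AtAngle θ x) : x ≠ 0 := by
  obtain ⟨ρ, hρ, rfl⟩ := atAngle_iff.1 h
  exact smul_ne_zero hρ.ne' (dir_ne_zero θ)

theorem AtAngle.add_int {θ : ℝ} {x : Plane} (h : AtAngle θ x) (n : ℤ) : AtAngle (θ + n) x := by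
  rw [atAngle_iff] at *; rwa [dir_add_int]

theorem AtAngle.add_one {θ : ℝ} {x : Plane} (h : AtAngle θ x) : AtAngle (θ + 1) x := by
  rw [atAngle_iff] at *; rwa [dir_add_one]

theorem AtAngle.neg {θ : ℝ} {x : Plane} (h : AtAngle θ x) : AtAngle (θ + 1 / 2) (-x) := by
  rw [atAngle_iff] at *
  obtain ⟨ρ, hρ, rfl⟩ := h
  exact ⟨ρ, hρ, by rw [dir_add_half, smul_neg]⟩

theorem AtAngle.rot {θ : ℝ} {x : Plane} (h : AtAngle θ x) : AtAngle (θ + 1 / 4) (rot x) := by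
  rw [atAngle_iff] at *
  obtain ⟨ρ, hρ, rfl⟩ := h
  exact ⟨ρ, hρ, by rw [dir_add_quarter, rot_smul]⟩

theorem AtAngle.smul {θ : ℝ} {x : Plane} (h : AtAngle θ x) {c : ℝ} (hc : 0 < c) :
    AtAngle θ (c • x) := by
  rw [atAngle_iff] at *
  obtain ⟨ρ, hρ, rfl⟩ := h
  exact ⟨c * ρ, mul_pos hc hρ, by rw [smul_smul]⟩

theorem AtAngle.same_ray {θ : ℝ} {x y : Plane} (h : AtAngle θ x) (h' : AtAngle θ y) :
    ∃ c : ℝ, 0 < c ∧ y = c • x := by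
  obtain ⟨ρ, hρ, rfl⟩ := atAngle_iff.1 h
  obtain ⟨σ, hσ, rfl⟩ := atAngle_iff.1 h'
  exact ⟨σ / ρ, div_pos hσ hρ, by rw [smul_smul, div_mul_cancel₀ _ hρ.ne']⟩

theorem exists_atAngle {x : Plane} (h : x ≠ 0) : ∃ θ, AtAngle θ x := by
  set z : ℂ := ⟨x 0, x 1⟩ with hz
  have hz0 : z ≠ 0 := by
    intro h0
    apply h
    have h1 := congrArg Complex.re h0
    have h2 := congrArg Complex.im h0
    exact plane_ext (by simpa [hz] using h1) (by simpa [hz] using h2)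
  refine ⟨Complex.arg z / (2 * Real.pi), ‖z‖, norm_pos_iff.2 hz0, ?_⟩
  have h2 : 2 * Real.pi * (Complex.arg z / (2 * Real.pi)) = Complex.arg z := by
    field_simp
  rw [h2]
  apply plane_ext
  · simp [hz]
  · simp [hz]

theorem exists_atAngle_Ico {x : Plane} (h : x ≠ 0) (c : ℝ) :
    ∃ θ, c ≤ θ ∧ θ < c + 1 ∧ AtAngle θ x := by
  obtain ⟨a, ha⟩ := exists_atAngle h
  refine ⟨a + (-⌊a - c⌋ : ℤ), ?_, ?_, ha.add_int _⟩
  · push_cast; linarith [Int.floor_le (a - c)]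
  · push_cast; linarith [Int.lt_floor_add_one (a - c)]

theorem exists_atAngle_Ioc {x : Plane} (h : x ≠ 0) (c : ℝ) :
    ∃ θ, c < θ ∧ θ ≤ c + 1 ∧ AtAngle θ x := by
  obtain ⟨a, h1, h2, ha⟩ := exists_atAngle_Ico h c
  rcases h1.eq_or_lt with rfl | h1
  · exact ⟨c + 1, by linarith, le_rfl, ha.add_one⟩
  · exact ⟨a, h1, h2.le, ha⟩

theorem AtAngle.inner_det {a b : ℝ} {x y : Plane} (hx : AtAngle a x) (hy : AtAngle b y) :
    ∃ c : ℝ, 0 < c ∧ inner ℝ x y = c * Real.cos (2 * Real.pi * (b - a)) ∧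
      det2 x y = c * Real.sin (2 * Real.pi * (b - a)) := by
  obtain ⟨ρ, hρ, rfl⟩ := atAngle_iff.1 hx
  obtain ⟨σ, hσ, rfl⟩ := atAngle_iff.1 hy
  refine ⟨ρ * σ, mul_pos hρ hσ, ?_, ?_⟩
  · rw [mul_sub, Real.cos_sub, inner_plane]
    simp only [PiLp.smul_apply, smul_eq_mul, dir_zero, dir_one]; ring
  · rw [mul_sub, Real.sin_sub, det2]
    simp only [PiLp.smul_apply, smul_eq_mul, dir_zero, dir_one]; ring

theorem AtAngle.det2_pos {a b : ℝ} {x y : Plane} (hx : AtAngle a x) (hy : AtAngle b y)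
    (h1 : a < b) (h2 : b < a + 1 / 2) : 0 < det2 x y := by
  obtain ⟨c, hc, -, h⟩ := hx.inner_det hy
  rw [h]
  refine mul_pos hc (Real.sin_pos_of_pos_of_lt_pi ?_ ?_) <;> nlinarith [Real.pi_pos]

theorem AtAngle.det2_neg {a b : ℝ} {x y : Plane} (hx : AtAngle a x) (hy : AtAngle b y)
    (h1 : a + 1 / 2 < b) (h2 : b < a + 1) : det2 x y < 0 := by
  have := hy.det2_pos hx.add_one h2 (by linarith)
  rw [det2_swap]; linarith

theorem AtAngle.det2_nonneg {a b : ℝ} {x y : Plane} (hx : AtAngle a x) (hy : AtAngle b y)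
    (h1 : a ≤ b) (h2 : b ≤ a + 1 / 2) : 0 ≤ det2 x y := by
  obtain ⟨c, hc, -, h⟩ := hx.inner_det hy
  rw [h]
  refine mul_nonneg hc.le (Real.sin_nonneg_of_nonneg_of_le_pi ?_ ?_) <;> nlinarith [Real.pi_pos]

theorem AtAngle.det2_nonpos {a b : ℝ} {x y : Plane} (hx : AtAngle a x) (hy : AtAngle b y)
    (h1 : a + 1 / 2 ≤ b) (h2 : b ≤ a + 1) : det2 x y ≤ 0 := by
  have := hy.det2_nonneg hx.add_one h2 (by linarith)
  rw [det2_swap]; linarith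

theorem AtAngle.inner_nonpos {a b : ℝ} {x y : Plane} (hx : AtAngle a x) (hy : AtAngle b y)
    (h1 : a + 1 / 4 ≤ b) (h2 : b ≤ a + 3 / 4) : inner ℝ x y ≤ 0 := by
  rw [← det2_rot_right]
  exact hx.det2_nonpos hy.rot (by linarith) (by linarith)

theorem AtAngle.inner_nonneg {a b : ℝ} {x y : Plane} (hx : AtAngle a x) (hy : AtAngle b y)
    (h1 : a - 1 / 4 ≤ b) (h2 : b ≤ a + 1 / 4) : 0 ≤ inner ℝ x y := by
  rw [← det2_rot_right]
  exact hx.det2_nonneg hy.rot (by linarith) (by linarith)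

theorem AtAngle.exists_lift {a : ℝ} {x y : Plane} (hx : AtAngle a x) (h : 0 < det2 x y) :
    ∃ b, a < b ∧ b < a + 1 / 2 ∧ AtAngle b y := by
  have hy : y ≠ 0 := by rintro rfl; simp [det2] at h
  obtain ⟨b, h1, h2, hb⟩ := exists_atAngle_Ioc hy a
  refine ⟨b, h1, ?_, hb⟩
  by_contra h3
  exact absurd (hx.det2_nonpos hb (by linarith) h2) (by linarith)

theorem AtAngle.eq_add_int {a b : ℝ} {x : Plane} (ha : AtAngle a x) (hb : AtAngle b x) :
    ∃ n : ℤ, b = a + n := by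
  refine ⟨⌊b - a⌋, ?_⟩
  have h1 := Int.floor_le (b - a)
  have h2 := Int.lt_floor_add_one (b - a)
  set n := ⌊b - a⌋
  have ha' := ha.add_int n
  rcases (show a + n ≤ b by linarith).eq_or_lt with h3 | h3
  · exact h3.symm
  exfalso
  rcases lt_trichotomy b (a + n + 1 / 2) with h4 | h4 | h4
  · exact absurd (ha'.det2_pos hb h3 h4) (by rw [det2_self]; exact lt_irrefl _)
  · have h5 := ha'.neg
    rw [← h4] at h5
    obtain ⟨c, hc, h6⟩ := h5.same_ray hb
    have h7 : (1 + c) • x = 0 := by rw [add_smul, one_smul]; nth_rw 1 [h6]; simp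
    rcases smul_eq_zero.1 h7 with h8 | h8
    · linarith
    · exact ha.ne_zero h8
  · exact absurd (ha'.det2_neg hb h4 (by linarith)) (by rw [det2_self]; exact lt_irrefl _)

theorem AtAngle.eq_of_lt {a b : ℝ} {x : Plane} (ha : AtAngle a x) (hb : AtAngle b x)
    (h1 : a < b + 1) (h2 : b < a + 1) : a = b := by
  obtain ⟨n, rfl⟩ := ha.eq_add_int hb
  have h3 : (-1 : ℝ) < n := by linarith
  have h4 : (n : ℝ) < 1 := by linarith
  have h5 : n = 0 := by
    have h6 : (-1 : ℤ) < n := by exact_mod_cast h3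
    have h7 : n < (1 : ℤ) := by exact_mod_cast h4
    omega
  simp [h5]

/-- Three extreme points of a convex set containing the origin are positively oriented if they are
listed in the order of their angles. -/
theorem det2_pos_of_extreme_aux {D : Set Plane} (hD : Convex ℝ D) (h0 : (0 : Plane) ∈ D)
    {A B Z : Plane} (hA : A ∈ D) (hB : B ∈ D.extremePoints ℝ) (hZ : Z ∈ D)
    (h1 : 0 < det2 A B) (h2 : 0 < det2 B Z) : 0 < det2 (B - A) (Z - A) := by
  have key : det2 (B - A) (Z - A) = det2 A B + det2 B Z - det2 A Z := by
    simp [det2]; ring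
  by_contra hle
  rw [key] at hle
  have h3 : 0 < det2 A Z := by linarith
  have hB0 : B ≠ 0 := by rintro rfl; simp [det2] at h1
  -- By Cramer's rule B = sA + tZ, and the negated claim says s + t ≤ 1. So B would lie in the
  -- triangle with vertices 0, A, Z without being a vertex, against extremality.
  set s := det2 B Z / det2 A Z with hs
  set t := det2 A B / det2 A Z with ht
  have hs0 : 0 < s := div_pos h2 h3
  have ht0 : 0 < t := div_pos h1 h3
  have hst : s + t ≤ 1 := by rw [hs, ht, ← add_div, div_le_one h3]; linarith
  have hBe : B = s • A + t • Z := by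
    have : det2 A Z • B = det2 A Z • (s • A + t • Z) := by
      rw [smul_add, smul_smul, smul_smul, hs, ht, mul_div_cancel₀ _ h3.ne',
        mul_div_cancel₀ _ h3.ne']
      apply plane_ext <;> simp [det2] <;> ring
    exact smul_right_injective _ h3.ne' this
  rw [mem_extremePoints] at hB
  set Y := (s + t)⁻¹ • B with hY
  have hst0 : 0 < s + t := by linarith
  have hYD : Y ∈ D := by
    have : Y = (s / (s + t)) • A + (t / (s + t)) • Z := by
      rw [hY, hBe, smul_add, smul_smul, smul_smul, div_eq_inv_mul, div_eq_inv_mul]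
    rw [this]
    exact hD hA hZ (by positivity) (by positivity) (by rw [← add_div, div_self hst0.ne'])
  have hBY : B = (s + t) • Y := by rw [hY, smul_smul, mul_inv_cancel₀ hst0.ne', one_smul]
  rcases hst.eq_or_lt with h4 | h4
  · have := (hB.2 A hA Z hZ ⟨s, t, hs0, ht0, h4, hBe.symm⟩).1
    rw [this, det2_self] at h1
    exact lt_irrefl _ h1
  · have := (hB.2 0 h0 Y hYD ⟨1 - (s + t), s + t, by linarith, hst0, by ring, by
      rw [smul_zero, zero_add, ← hBY]⟩).1
    exact hB0 this.symm

/-- The three angular gaps are positive and add up to one turn, so at most one of them reaches a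
half turn. A cyclic relabelling, which preserves the determinant, makes the other two gaps the ones
used in the auxiliary lemma. -/
theorem det2_pos_of_extreme {D : Set Plane} (hD : Convex ℝ D) (h0 : (0 : Plane) ∈ D)
    {A B Z : Plane} (hA : A ∈ D.extremePoints ℝ) (hB : B ∈ D.extremePoints ℝ)
    (hZ : Z ∈ D.extremePoints ℝ) {a b c : ℝ} (haA : AtAngle a A) (hbB : AtAngle b B)
    (hcZ : AtAngle c Z) (hab : a < b) (hbc : b < c) (hca : c < a + 1) :
    0 < det2 (B - A) (Z - A) := by
  have cyc1 : det2 (B - A) (Z - A) = det2 (Z - B) (A - B) := by simp [det2]; ring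
  have cyc2 : det2 (B - A) (Z - A) = det2 (A - Z) (B - Z) := by simp [det2]; ring
  rcases lt_or_ge b (a + 1 / 2) with h1 | h1
  · rcases lt_or_ge c (b + 1 / 2) with h2 | h2
    · exact det2_pos_of_extreme_aux hD h0 hA.1 hB hZ.1 (haA.det2_pos hbB hab h1)
        (hbB.det2_pos hcZ hbc h2)
    · rw [cyc2]
      exact det2_pos_of_extreme_aux hD h0 hZ.1 hA hB.1
        (hcZ.det2_pos haA.add_one hca (by linarith)) (haA.det2_pos hbB hab h1)
  · rw [cyc1]
    exact det2_pos_of_extreme_aux hD h0 hB.1 hZ hA.1 (hbB.det2_pos hcZ hbc (by linarith))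
      (hcZ.det2_pos haA.add_one hca (by linarith))

/-! ### The `C¹` parametrization of the boundary by the angle -/

/-- `x` is the parametrization of the boundary of the centrally symmetric, smooth, strictly convex
body `K` by the angle, and `v` is its derivative. -/
structure IsBoundaryParam (K : Set Plane) (x v : ℝ → Plane) : Prop where
  isCompact : IsCompact K
  strictConvex : StrictConvex ℝ K
  symm : ∀ y ∈ K, -y ∈ K
  zero_mem : (0 : Plane) ∈ interior K
  hasDerivAt : ∀ θ, HasDerivAt x (v θ) θ
  continuous_deriv : Continuous v
  atAngle : ∀ θ, AtAngle θ (x θ)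
  mem_frontier : ∀ θ, x θ ∈ frontier K
  left : ∀ θ, ∀ y ∈ K, y ≠ x θ → 0 < det2 (v θ) (y - x θ)
  normal : ∀ θ n, IsOuterNormal K (x θ) n → ∃ c : ℝ, 0 < c ∧ n = -(c • rot (v θ))

theorem hasDerivAt_dir (θ : ℝ) : HasDerivAt dir ((2 * Real.pi) • rot (dir θ)) θ := by
  have h0 : HasDerivAt (fun θ : ℝ => 2 * Real.pi * θ) (2 * Real.pi) θ := by
    simpa using (hasDerivAt_id θ).const_mul (2 * Real.pi)
  have h1 := (h0.cos.smul_const (!₂[1, 0] : Plane)).add (h0.sin.smul_const (!₂[0, 1] : Plane))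
  have h2 : dir = (fun θ : ℝ => Real.cos (2 * Real.pi * θ) • (!₂[1, 0] : Plane)) +
      (fun θ : ℝ => Real.sin (2 * Real.pi * θ) • (!₂[0, 1] : Plane)) := by
    funext s
    apply plane_ext <;> simp
  have h3 : (2 * Real.pi) • rot (dir θ) =
      (-Real.sin (2 * Real.pi * θ) * (2 * Real.pi)) • (!₂[1, 0] : Plane) +
        (Real.cos (2 * Real.pi * θ) * (2 * Real.pi)) • (!₂[0, 1] : Plane) := by
    apply plane_ext <;> simp <;> ring
  rw [h2, ← h2, h3, h2]
  exact h1

theorem continuous_dir : Continuous dir :=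
  continuous_iff_continuousAt.2 fun θ => (hasDerivAt_dir θ).continuousAt

theorem zero_mem_interior_of_symm {K : Set Plane} (hK : Convex ℝ K) (hi : (interior K).Nonempty)
    (hs : ∀ x ∈ K, -x ∈ K) : (0 : Plane) ∈ interior K := by
  obtain ⟨y, hy⟩ := hi
  have := hK.combo_interior_self_mem_interior hy (hs y (interior_subset hy))
    (a := 1 / 2) (b := 1 / 2) (by norm_num) (by norm_num) (by norm_num)
  simpa using this

/-- The local defining function of the boundary of a convex set is a supporting functional. -/
theorem fderiv_support {K : Set Plane} (hK : Convex ℝ K) (hc : IsClosed K)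
    {x₀ : Plane} (hx : x₀ ∈ frontier K) {F : Plane → ℝ} {L : Plane →L[ℝ] ℝ}
    (hF : HasFDerivAt F L x₀) (hFK : ∀ᶠ y in 𝓝 x₀, (y ∈ K ↔ F y ≤ 0)) :
    F x₀ = 0 ∧ ∀ y ∈ K, L (y - x₀) ≤ 0 := by
  have hxK : x₀ ∈ K := hc.frontier_subset hx
  have hF0 : F x₀ = 0 := by
    refine le_antisymm (hFK.self_of_nhds.1 hxK) ?_
    by_contra! hlt
    have : K ∈ 𝓝 x₀ := by
      filter_upwards [hFK, hF.continuousAt.eventually_lt continuousAt_const hlt] with y h1 h2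
      exact h1.2 h2.le
    exact hx.2 (mem_interior_iff_mem_nhds.2 this)
  refine ⟨hF0, fun y hy => ?_⟩
  have hline : HasDerivAt (fun t : ℝ => x₀ + t • (y - x₀)) (y - x₀) 0 := by
    simpa using ((hasDerivAt_id (0 : ℝ)).smul_const (y - x₀)).const_add x₀
  have hline0 : x₀ + (0 : ℝ) • (y - x₀) = x₀ := by simp
  have hcomp : HasDerivAt (fun t : ℝ => F (x₀ + t • (y - x₀))) (L (y - x₀)) 0 :=
    HasFDerivAt.comp_hasDerivAt (0 : ℝ) (by rwa [hline0]) hline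
  have hev : ∀ᶠ t : ℝ in 𝓝[>] 0, F (x₀ + t • (y - x₀)) ≤ 0 := by
    have h1 : Tendsto (fun t : ℝ => x₀ + t • (y - x₀)) (𝓝[>] 0) (𝓝 x₀) := by
      have := hline.continuousAt.tendsto
      rw [hline0] at this
      exact this.mono_left nhdsWithin_le_nhds
    filter_upwards [h1.eventually hFK, Ioo_mem_nhdsGT (zero_lt_one' ℝ)] with t ht h01
    refine ht.1 ?_
    have := hK hxK hy (a := 1 - t) (b := t) (by linarith [h01.2]) h01.1.le (by ring)
    convert this using 1
    module
  have hs := hcomp.hasDerivWithinAt (s := Ioi 0)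
  rw [hasDerivWithinAt_iff_tendsto_slope' (by simp)] at hs
  refine le_of_tendsto hs ?_
  filter_upwards [hev, self_mem_nhdsWithin] with t ht h0
  rw [slope_def_field, hline0, hF0, sub_zero, sub_zero]
  exact div_nonpos_of_nonpos_of_nonneg ht (le_of_lt h0)

/-- The origin is interior, so a small positive multiple of any vector `z` with `0 < L z` lies in
`K`, where `L` is at most `L x₀`. -/
theorem support_pos {K : Set Plane} (h0 : (0 : Plane) ∈ interior K) {x₀ : Plane}
    {L : Plane →L[ℝ] ℝ} (hL : L ≠ 0) (hsup : ∀ y ∈ K, L (y - x₀) ≤ 0) : 0 < L x₀ := by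
  obtain ⟨z, hz⟩ : ∃ z, 0 < L z := by
    by_contra! hneg
    apply hL
    ext z
    have h1 := hneg z
    have h2 := hneg (-z)
    rw [map_neg] at h2
    simp; linarith
  have hcont : Tendsto (fun t : ℝ => t • z) (𝓝[>] 0) (𝓝 0) := by
    have : Continuous fun t : ℝ => t • z := by fun_prop
    simpa using (this.tendsto 0).mono_left nhdsWithin_le_nhds
  obtain ⟨t, ht, ht0⟩ := ((hcont.eventually (mem_interior_iff_mem_nhds.1 h0)).and
    self_mem_nhdsWithin).exists
  have := hsup _ ht
  rw [map_sub, map_smul, smul_eq_mul] at this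
  have ht0' : 0 < t := ht0
  nlinarith [mul_pos ht0' hz]

open Asymptotics in
/-- Differentiability of the radial function of a curve which is given in polar coordinates and
solves an implicit equation. -/
theorem hasDerivAt_radial {r : ℝ → ℝ} {θ₀ : ℝ} {F : Plane → ℝ} {L : Plane →L[ℝ] ℝ}
    (hF : HasFDerivAt F L (r θ₀ • dir θ₀)) (hr : ContinuousAt r θ₀)
    (hL : L (dir θ₀) ≠ 0) (hz : ∀ᶠ s in 𝓝 θ₀, F (r s • dir s) = 0) :
    HasDerivAt r (-(r θ₀ * L ((2 * Real.pi) • rot (dir θ₀))) / L (dir θ₀)) θ₀ := by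
  set u := (2 * Real.pi) • rot (dir θ₀)
  have hdir := hasDerivAt_dir θ₀
  have hxc : Tendsto (fun s => r s • dir s) (𝓝 θ₀) (𝓝 (r θ₀ • dir θ₀)) :=
    (hr.smul hdir.continuousAt).tendsto
  have h1 : (fun s => L (r s • dir s - r θ₀ • dir θ₀)) =o[𝓝 θ₀]
      fun s => r s • dir s - r θ₀ • dir θ₀ := by
    have := (hF.isLittleO.comp_tendsto hxc).neg_left
    refine this.congr' ?_ EventuallyEq.rfl
    filter_upwards [hz] with s hs
    simp [hs, hz.self_of_nhds]
  have hB : (fun s => dir s - dir θ₀) =O[𝓝 θ₀] fun s => s - θ₀ := hdir.isBigO_sub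
  have hdec : ∀ s, r s • dir s - r θ₀ • dir θ₀ =
      (r s - r θ₀) • dir s + r θ₀ • (dir s - dir θ₀) := fun s => by module
  have hLs : Tendsto (fun s => L (dir s)) (𝓝 θ₀) (𝓝 (L (dir θ₀))) :=
    (L.continuous.continuousAt.comp hdir.continuousAt).tendsto
  have hdir1 : (fun s => dir s) =O[𝓝 θ₀] fun _ => (1 : ℝ) :=
    hdir.continuousAt.tendsto.isBigO_one ℝ
  have hsm : (fun s => s - θ₀) =O[𝓝 θ₀] fun s => |r s - r θ₀| + |s - θ₀| :=
    IsBigO.of_bound 1 (Eventually.of_forall fun s => by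
      rw [Real.norm_eq_abs, Real.norm_eq_abs, one_mul]
      exact (le_add_of_nonneg_left (abs_nonneg _)).trans (le_abs_self _))
  have hrm : (fun s => r s - r θ₀) =O[𝓝 θ₀] fun s => |r s - r θ₀| + |s - θ₀| :=
    IsBigO.of_bound 1 (Eventually.of_forall fun s => by
      rw [Real.norm_eq_abs, Real.norm_eq_abs, one_mul]
      exact (le_add_of_nonneg_right (abs_nonneg _)).trans (le_abs_self _))
  have hxO : (fun s => r s • dir s - r θ₀ • dir θ₀) =O[𝓝 θ₀]
      fun s => |r s - r θ₀| + |s - θ₀| := by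
    have h2 : (fun s => (r s - r θ₀) • dir s) =O[𝓝 θ₀] fun s => |r s - r θ₀| + |s - θ₀| := by
      simpa using hrm.smul hdir1
    have h3 : (fun s => r θ₀ • (dir s - dir θ₀)) =O[𝓝 θ₀] fun s => |r s - r θ₀| + |s - θ₀| :=
      (((hB.trans hsm).const_smul_left (r θ₀)) :)
    refine (h2.add h3).congr_left fun s => (hdec s).symm
  have h4 : (fun s => (r s - r θ₀) * L (dir s) + r θ₀ * L (dir s - dir θ₀)) =o[𝓝 θ₀]
      fun s => |r s - r θ₀| + |s - θ₀| := by
    refine (h1.trans_isBigO hxO).congr_left fun s => ?_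
    rw [hdec, map_add, map_smul, map_smul, smul_eq_mul, smul_eq_mul]
  have hLB : (fun s => r θ₀ * L (dir s - dir θ₀)) =O[𝓝 θ₀] fun s => s - θ₀ :=
    ((L.isBigO_comp _ _).trans hB).const_mul_left _
  -- Bootstrapping: so far the error is only o(|Δr| + |Δθ|). Its Δr part is absorbed on the left
  -- because `L (dir s)` stays away from zero. This yields Δr = O(Δθ), after which all errors are
  -- o(Δθ).
  have hA : (fun s => r s - r θ₀) =O[𝓝 θ₀] fun s => s - θ₀ := by
    obtain ⟨C, hC⟩ := hLB.bound
    have hLpos : 0 < |L (dir θ₀)| := abs_pos.2 hL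
    have h5 := h4.bound (show 0 < |L (dir θ₀)| / 4 by positivity)
    have h6 : ∀ᶠ s in 𝓝 θ₀, |L (dir θ₀)| / 2 < |L (dir s)| :=
      hLs.abs.eventually (lt_mem_nhds (by linarith))
    refine IsBigO.of_bound ((C + |L (dir θ₀)| / 4) / (|L (dir θ₀)| / 4)) ?_
    filter_upwards [hC, h5, h6] with s hs1 hs2 hs3
    simp only [Real.norm_eq_abs] at *
    rw [abs_of_nonneg (add_nonneg (abs_nonneg (r s - r θ₀)) (abs_nonneg (s - θ₀)))] at hs2
    rw [div_mul_eq_mul_div, le_div_iff₀ (by positivity)]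
    have h7 : |(r s - r θ₀) * L (dir s)| ≤ |(r s - r θ₀) * L (dir s) +
        r θ₀ * L (dir s - dir θ₀)| + |r θ₀ * L (dir s - dir θ₀)| := by
      have := abs_sub ((r s - r θ₀) * L (dir s) + r θ₀ * L (dir s - dir θ₀))
        (r θ₀ * L (dir s - dir θ₀))
      simpa using this
    rw [abs_mul (r s - r θ₀)] at h7
    have h8 := mul_le_mul_of_nonneg_left hs3.le (abs_nonneg (r s - r θ₀))
    nlinarith
  have hN : (fun s => |r s - r θ₀| + |s - θ₀|) =O[𝓝 θ₀] fun s => s - θ₀ :=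
    hA.abs_left.add (isBigO_refl (fun s => s - θ₀) (𝓝 θ₀)).abs_left
  have h9 := h4.trans_isBigO hN
  have h10 : (fun s => (r s - r θ₀) * (L (dir s) - L (dir θ₀))) =o[𝓝 θ₀] fun s => s - θ₀ := by
    have h11 : (fun s => L (dir s) - L (dir θ₀)) =o[𝓝 θ₀] fun _ => (1 : ℝ) := by
      rw [isLittleO_one_iff]
      simpa using hLs.sub_const (L (dir θ₀))
    simpa using hA.mul_isLittleO h11
  have h12 : (fun s => r θ₀ * L (dir s - dir θ₀ - (s - θ₀) • u)) =o[𝓝 θ₀] fun s => s - θ₀ := by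
    have h13 : (fun s => dir s - dir θ₀ - (s - θ₀) • u) =o[𝓝 θ₀] fun s => s - θ₀ := hdir.isLittleO
    exact ((L.isBigO_comp _ _).trans_isLittleO h13).const_mul_left _
  rw [hasDerivAt_iff_isLittleO]
  have h14 := ((h9.sub h10).sub h12).const_mul_left (L (dir θ₀))⁻¹
  refine h14.congr_left fun s => ?_
  simp only [map_sub, map_smul, smul_eq_mul]
  field_simp
  ring

/-! ### The radial function of a smooth convex body. -/

section
variable {K : Set Plane}

/-- The radial parametrization of the boundary of `K`. -/
noncomputable def radial (K : Set Plane) (θ : ℝ) : ℝ := (gauge K (dir θ))⁻¹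

theorem radial_pos (hK : IsCompact K) (h0 : (0 : Plane) ∈ interior K) (θ : ℝ) :
    0 < radial K θ :=
  inv_pos.2 ((gauge_pos (absorbent_nhds_zero (mem_interior_iff_mem_nhds.1 h0))
    (NormedSpace.isVonNBounded_of_isBounded ℝ hK.isBounded)).2 (dir_ne_zero θ))
      
theorem continuous_radial (hK : IsCompact K) (hc : Convex ℝ K) (h0 : (0 : Plane) ∈ interior K) :
    Continuous (radial K) := by
  have h1 := continuous_gauge hc (mem_interior_iff_mem_nhds.1 h0)
  exact (h1.comp continuous_dir).inv₀ fun θ => (inv_pos.1 (radial_pos hK h0 θ)).ne'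

theorem radial_mem_frontier (hK : IsCompact K) (hc : Convex ℝ K) (h0 : (0 : Plane) ∈ interior K)
    (θ : ℝ) : radial K θ • dir θ ∈ frontier K := by
  rw [← gauge_eq_one_iff_mem_frontier hc (mem_interior_iff_mem_nhds.1 h0),
    gauge_smul_of_nonneg (radial_pos hK h0 θ).le, radial, smul_eq_mul]
  exact inv_mul_cancel₀ (inv_pos.1 (radial_pos hK h0 θ)).ne'

theorem radial_unique (hc : Convex ℝ K) (h0 : (0 : Plane) ∈ interior K)
    {θ ρ : ℝ} (hρ : 0 < ρ) (h : ρ • dir θ ∈ frontier K) : ρ = radial K θ := by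
  rw [← gauge_eq_one_iff_mem_frontier hc (mem_interior_iff_mem_nhds.1 h0),
    gauge_smul_of_nonneg hρ.le, smul_eq_mul] at h
  exact eq_inv_of_mul_eq_one_left h

/-- Near a boundary point, a local defining function vanishes on the boundary. -/
theorem eq_zero_of_mem_frontier (hK : IsCompact K) {x : Plane} {F : Plane → ℝ}
    (hx : x ∈ frontier K) (hF : ContinuousAt F x) (hFK : ∀ᶠ y in 𝓝 x, (y ∈ K ↔ F y ≤ 0)) :
    F x = 0 := by
  refine le_antisymm (hFK.self_of_nhds.1 (hK.isClosed.frontier_subset hx)) ?_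
  by_contra! hlt
  refine hx.2 (mem_interior_iff_mem_nhds.2 ?_)
  filter_upwards [hFK, hF.eventually_lt continuousAt_const hlt] with y h1 h2
  exact h1.2 h2.le

/-- The supporting functional is positive at the boundary point because the origin is interior;
hence the ray crosses the boundary transversally and implicit differentiation applies. -/
theorem hasDerivAt_radial_of_local (hK : IsCompact K) (hc : Convex ℝ K)
    (h0 : (0 : Plane) ∈ interior K) {θ : ℝ} {F : Plane → ℝ}
    (hF : ContDiffAt ℝ 1 F (radial K θ • dir θ)) (hL : fderiv ℝ F (radial K θ • dir θ) ≠ 0)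
    (hFK : ∀ᶠ y in 𝓝 (radial K θ • dir θ), (y ∈ K ↔ F y ≤ 0)) :
    fderiv ℝ F (radial K θ • dir θ) (dir θ) ≠ 0 ∧
    HasDerivAt (radial K)
      (-(radial K θ * fderiv ℝ F (radial K θ • dir θ) ((2 * Real.pi) • rot (dir θ))) /
        fderiv ℝ F (radial K θ • dir θ) (dir θ)) θ := by
  have hr := radial_pos hK h0 θ
  have hFd := hF.differentiableAt one_ne_zero
  have hsup := (fderiv_support hc hK.isClosed (radial_mem_frontier hK hc h0 θ)
    hFd.hasFDerivAt hFK).2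
  have hpos := support_pos h0 hL hsup
  rw [map_smul, smul_eq_mul] at hpos
  have hne : fderiv ℝ F (radial K θ • dir θ) (dir θ) ≠ 0 := (pos_of_mul_pos_right hpos hr.le).ne'
  refine ⟨hne, hasDerivAt_radial hFd.hasFDerivAt (continuous_radial hK hc h0).continuousAt hne ?_⟩
  have hxc : Tendsto (fun s => radial K s • dir s) (𝓝 θ) (𝓝 (radial K θ • dir θ)) :=
    ((continuous_radial hK hc h0).smul continuous_dir).tendsto θ
  filter_upwards [hxc.eventually hFK.eventually_nhds, hxc.eventually (hF.eventually (by simp))]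
    with s hs hs'
  exact eq_zero_of_mem_frontier hK (radial_mem_frontier hK hc h0 s) hs'.continuousAt hs

/-- One local defining function serves all nearby angles, so the explicit quotient for the
derivative is valid in a whole neighbourhood, where its continuity can be read off. -/
theorem exists_continuous_deriv_radial (hK : IsCompact K) (hc : Convex ℝ K)
    (h0 : (0 : Plane) ∈ interior K) (hC1 : HasC1Boundary K) :
    (∀ θ, HasDerivAt (radial K) (deriv (radial K) θ) θ) ∧ Continuous (deriv (radial K)) := by
  constructor
  · intro θ
    obtain ⟨F, h1, h2, h3⟩ := hC1 _ (radial_mem_frontier hK hc h0 θ)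
    exact (hasDerivAt_radial_of_local hK hc h0 h1 h2 h3).2.differentiableAt.hasDerivAt
  · rw [continuous_iff_continuousAt]
    intro θ
    obtain ⟨F, h1, h2, h3⟩ := hC1 _ (radial_mem_frontier hK hc h0 θ)
    have hx : Continuous fun s => radial K s • dir s :=
      (continuous_radial hK hc h0).smul continuous_dir
    have hxc := hx.tendsto θ
    have hf : ContinuousAt (fderiv ℝ F) (radial K θ • dir θ) :=
      (h1.fderiv_right (m := 0) (by norm_num)).continuousAt
    have hfx : ContinuousAt (fun s => fderiv ℝ F (radial K s • dir s)) θ :=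
      ContinuousAt.comp (g := fderiv ℝ F) hf hx.continuousAt
    have hrot : Continuous fun s => (2 * Real.pi) • rot (dir s) := by
      have h4 : (fun s => (2 * Real.pi) • rot (dir s)) = fun s => (2 * Real.pi) • dir (s + 1 / 4) := by
        funext s; rw [dir_add_quarter]
      rw [h4]
      exact (continuous_dir.comp (continuous_id.add continuous_const)).const_smul (2 * Real.pi)
    have hne := (hasDerivAt_radial_of_local hK hc h0 h1 h2 h3).1
    have hcont : ContinuousAt (fun s =>
        -(radial K s * fderiv ℝ F (radial K s • dir s) ((2 * Real.pi) • rot (dir s))) /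
        fderiv ℝ F (radial K s • dir s) (dir s)) θ := by
      refine ContinuousAt.div ?_ (hfx.clm_apply continuous_dir.continuousAt) hne
      exact ((continuous_radial hK hc h0).continuousAt.mul
        (hfx.clm_apply hrot.continuousAt)).neg
    refine hcont.congr ?_
    filter_upwards [hxc.eventually h3.eventually_nhds, hxc.eventually (h1.eventually (by simp)),
      hfx.eventually_ne h2] with s hs1 hs2 hs3
    exact (hasDerivAt_radial_of_local hK hc h0 hs2 hs3 hs1).2.deriv.symm

end

theorem exists_isBoundaryParam {K : Set Plane} (hK : IsSmoothStrictlyConvexBody K)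
    (hs : ∀ x ∈ K, -x ∈ K) : ∃ x v, IsBoundaryParam K x v := by
  have h0 := zero_mem_interior_of_symm hK.convex hK.interior_nonempty hs
  obtain ⟨hd, hdc⟩ := exists_continuous_deriv_radial hK.isCompact hK.convex h0 hK.c1
  set r := radial K with hr
  set x : ℝ → Plane := fun θ => r θ • dir θ with hx
  set v : ℝ → Plane := fun θ => r θ • ((2 * Real.pi) • rot (dir θ)) + deriv r θ • dir θ with hv
  have hrpos := fun θ => radial_pos hK.isCompact h0 θ
  have hxv : ∀ θ, HasDerivAt x (v θ) θ := fun θ => (hd θ).smul (hasDerivAt_dir θ)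
  have hfr : ∀ θ, x θ ∈ frontier K := fun θ => radial_mem_frontier hK.isCompact hK.convex h0 θ
  have hxK : ∀ θ, x θ ∈ K := fun θ => hK.isCompact.isClosed.frontier_subset (hfr θ)
  have hat : ∀ θ, AtAngle θ (x θ) := fun θ => ⟨r θ, hrpos θ, rfl⟩
  have hdet : ∀ θ, 0 < det2 (x θ) (v θ) := fun θ => by
    have h1 : det2 (x θ) (v θ) = r θ ^ 2 * (2 * Real.pi) * (dir θ 0 ^ 2 + dir θ 1 ^ 2) := by
      simp [hx, hv, det2]
      linear_combination r θ ^ 2 * (2 * Real.pi) * Real.cos_sq_add_sin_sq (2 * Real.pi * θ)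
    rw [h1]
    have := plane_ne_zero (dir_ne_zero θ)
    have := Real.pi_pos
    have := hrpos θ
    positivity
  have hv0 : ∀ θ, v θ ≠ 0 := fun θ h => by
    have := hdet θ
    rw [h, det2_zero_right] at this
    exact lt_irrefl _ this
  have hvc : Continuous v := by
    have hrot : Continuous fun s => rot (dir s) := by
      have h4 : (fun s => rot (dir s)) = fun s => dir (s + 1 / 4) := by
        funext s; rw [dir_add_quarter]
      rw [h4]
      exact continuous_dir.comp (continuous_id.add continuous_const)
    exact ((continuous_radial hK.isCompact hK.convex h0).smul
      (hrot.const_smul (2 * Real.pi))).add (hdc.smul continuous_dir)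
  clear_value x v
  -- a supporting functional at `x θ` vanishes on `v θ`
  have htan : ∀ θ (L : Plane →L[ℝ] ℝ), L ≠ 0 → (∀ y ∈ K, L (y - x θ) ≤ 0) →
      ∃ c : ℝ, 0 < c ∧ ∀ z, L z = -(c * det2 (v θ) z) := by
    intro θ L hL hsup
    have hmax : IsLocalMax (fun s => L (x s)) θ := Eventually.of_forall fun s => by
      have := hsup _ (hxK s)
      rw [map_sub] at this
      linarith
    have hder : HasDerivAt (fun s => L (x s)) (L (v θ)) θ := L.hasFDerivAt.comp_hasDerivAt θ (hxv θ)
    have h1 : L (v θ) = 0 := hmax.hasDerivAt_eq_zero hder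
    have h2 := support_pos h0 hL hsup
    have h3 := hdet θ
    refine ⟨L (x θ) / det2 (x θ) (v θ), div_pos h2 h3, fun z => ?_⟩
    have h4 : det2 (x θ) (v θ) • z = (-det2 (v θ) z) • x θ + det2 (x θ) z • v θ := by
      apply plane_ext <;> simp [det2] <;> ring
    have h5 := congrArg L h4
    rw [map_smul, map_add, map_smul, map_smul, h1, smul_eq_mul, smul_eq_mul, smul_zero,
      add_zero] at h5
    field_simp
    linarith
  refine ⟨x, v, hK.isCompact, hK.strictConvex, hs, h0, hxv, hvc, hat, hfr, ?_, ?_⟩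
  · intro θ y hy hne
    obtain ⟨F, h1, h2, h3⟩ := hK.c1 _ (hfr θ)
    have hsup := (fderiv_support hK.convex hK.isCompact.isClosed (hfr θ)
      (h1.differentiableAt one_ne_zero).hasFDerivAt h3).2
    obtain ⟨c, hc, hL⟩ := htan θ _ h2 hsup
    have hnn : ∀ z ∈ K, 0 ≤ det2 (v θ) (z - x θ) := fun z hz => by
      have := hsup z hz
      rw [hL] at this
      by_contra! hlt
      nlinarith
    -- If `y` were on the tangent line, the midpoint of `y` and `x θ` would be interior by strict
    -- convexity, and a small push across the tangent would remain in `K`.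
    refine (hnn y hy).lt_of_ne fun heq => ?_
    have hmid := hK.strictConvex hy (hxK θ) hne (a := 1 / 2) (b := 1 / 2) (by norm_num)
      (by norm_num) (by norm_num)
    set m := (1 / 2 : ℝ) • y + (1 / 2 : ℝ) • x θ with hm
    have hcont : Tendsto (fun t : ℝ => m - t • rot (v θ)) (𝓝[>] 0) (𝓝 m) := by
      have : Continuous fun t : ℝ => m - t • rot (v θ) := by fun_prop
      simpa using (this.tendsto 0).mono_left nhdsWithin_le_nhds
    obtain ⟨t, ht, ht0⟩ := ((hcont.eventually (mem_interior_iff_mem_nhds.1 hmid)).and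
      self_mem_nhdsWithin).exists
    have h5 := hnn _ ht
    have h6 : det2 (v θ) (m - t • rot (v θ) - x θ) =
        (1 / 2) * det2 (v θ) (y - x θ) - t * (v θ 0 ^ 2 + v θ 1 ^ 2) := by
      simp [hm, det2]; ring
    rw [h6, ← heq] at h5
    have ht0' : 0 < t := ht0
    nlinarith [mul_pos ht0' (plane_ne_zero (hv0 θ))]
  · rintro θ n ⟨-, hn0, hn⟩
    have hL : innerSL ℝ n ≠ 0 := fun h => hn0 (by
      have := congrArg (fun L : Plane →L[ℝ] ℝ => L n) h
      simpa using this)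
    obtain ⟨c, hc, h⟩ := htan θ (innerSL ℝ n) hL (by simpa using hn)
    refine ⟨c, hc, ?_⟩
    have e0 := h (!₂[1, 0])
    have e1 := h (!₂[0, 1])
    simp [innerSL_apply_apply, inner_plane, det2] at e0 e1
    apply plane_ext <;> simp <;> linarith

/-- The angle of the tangent vector `v θ` at the boundary point at angle `θ`, chosen in the
interval `(θ, θ + 1/2)`. -/
noncomputable def tangentAngle (v : ℝ → Plane) (θ : ℝ) : ℝ :=
  Classical.epsilon fun t => θ < t ∧ t < θ + 1 / 2 ∧ AtAngle t (v θ)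

theorem eq_of_mem_frontier_of_atAngle {K : Set Plane} (hc : Convex ℝ K)
    (h0 : (0 : Plane) ∈ interior K) {y z : Plane} {θ : ℝ} (hy : y ∈ frontier K)
    (hz : z ∈ frontier K) (hyθ : AtAngle θ y) (hzθ : AtAngle θ z) : y = z := by
  obtain ⟨ρ, hρ, rfl⟩ := atAngle_iff.1 hyθ
  obtain ⟨σ, hσ, rfl⟩ := atAngle_iff.1 hzθ
  rw [radial_unique hc h0 hρ hy, radial_unique hc h0 hσ hz]

theorem StrictConvex.mem_extremePoints_of_frontier {K : Set Plane} (hK : StrictConvex ℝ K)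
    (hc : IsClosed K) {x : Plane} (hx : x ∈ frontier K) : x ∈ K.extremePoints ℝ := by
  rw [mem_extremePoints]
  refine ⟨hc.frontier_subset hx, fun y hy z hz hxyz => ?_⟩
  rcases eq_or_ne y z with rfl | hne
  · rw [openSegment_same] at hxyz
    exact ⟨hxyz.symm, hxyz.symm⟩
  · exact absurd (hK.openSegment_subset hy hz hne hxyz) hx.2

theorem neg_mem_frontier {K : Set Plane} (hs : ∀ x ∈ K, -x ∈ K) {x : Plane}
    (hx : x ∈ frontier K) : -x ∈ frontier K := by
  have h1 : (Homeomorph.neg Plane) ⁻¹' K = K := by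
    ext y
    exact ⟨fun h => by simpa using hs _ h, fun h => hs _ h⟩
  have h2 := (Homeomorph.neg Plane).preimage_frontier K
  rw [h1] at h2
  rw [← h2] at hx
  exact hx

theorem hasDerivAt_inner_const_left {f : ℝ → Plane} {f' : Plane} {s : ℝ} (hf : HasDerivAt f f' s)
    (d : Plane) : HasDerivAt (fun t => inner ℝ d (f t)) (inner ℝ d f') s :=
  (innerSL ℝ d).hasFDerivAt.comp_hasDerivAt s hf

theorem hasDerivAt_det2_const_left {f : ℝ → Plane} {f' : Plane} {s : ℝ} (hf : HasDerivAt f f' s)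
    (d : Plane) : HasDerivAt (fun t => det2 d (f t)) (det2 d f') s := by
  simp only [← inner_rot_left]
  exact hasDerivAt_inner_const_left hf (rot d)

/-! ### Periodicity, tangent angles and chords of a parametrized boundary. -/

namespace IsBoundaryParam

variable {K : Set Plane} {x v : ℝ → Plane}

theorem convex (h : IsBoundaryParam K x v) : Convex ℝ K := h.strictConvex.convex

theorem mem (h : IsBoundaryParam K x v) (θ : ℝ) : x θ ∈ K :=
  h.isCompact.isClosed.frontier_subset (h.mem_frontier θ)

theorem zero_mem' (h : IsBoundaryParam K x v) : (0 : Plane) ∈ K := interior_subset h.zero_mem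

theorem continuous (h : IsBoundaryParam K x v) : Continuous x :=
  continuous_iff_continuousAt.2 fun θ => (h.hasDerivAt θ).continuousAt

theorem x_ne_zero (h : IsBoundaryParam K x v) (θ : ℝ) : x θ ≠ 0 := (h.atAngle θ).ne_zero

theorem eq_of_atAngle (h : IsBoundaryParam K x v) {y : Plane} {θ : ℝ} (hy : y ∈ frontier K)
    (hyθ : AtAngle θ y) : x θ = y :=
  eq_of_mem_frontier_of_atAngle h.convex h.zero_mem (h.mem_frontier θ) hy (h.atAngle θ) hyθ

theorem x_add_int (h : IsBoundaryParam K x v) (θ : ℝ) (n : ℤ) : x (θ + n) = x θ :=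
  h.eq_of_atAngle (h.mem_frontier θ) ((h.atAngle θ).add_int n)

theorem x_add_one (h : IsBoundaryParam K x v) (θ : ℝ) : x (θ + 1) = x θ :=
  h.eq_of_atAngle (h.mem_frontier θ) (h.atAngle θ).add_one

theorem x_add_half (h : IsBoundaryParam K x v) (θ : ℝ) : x (θ + 1 / 2) = -x θ :=
  h.eq_of_atAngle (neg_mem_frontier h.symm (h.mem_frontier θ)) (h.atAngle θ).neg

theorem v_add_int (h : IsBoundaryParam K x v) (θ : ℝ) (n : ℤ) : v (θ + n) = v θ := by
  have h1 : HasDerivAt (fun s => x (s + n)) (v (θ + n)) θ :=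
    (h.hasDerivAt (θ + n)).comp_add_const θ n
  simp only [h.x_add_int] at h1
  exact h1.unique (h.hasDerivAt θ)

theorem v_add_one (h : IsBoundaryParam K x v) (θ : ℝ) : v (θ + 1) = v θ := by
  simpa using h.v_add_int θ 1

theorem v_add_half (h : IsBoundaryParam K x v) (θ : ℝ) : v (θ + 1 / 2) = -v θ := by
  have h1 : HasDerivAt (fun s => x (s + 1 / 2)) (v (θ + 1 / 2)) θ :=
    (h.hasDerivAt (θ + 1 / 2)).comp_add_const θ (1 / 2)
  simp only [h.x_add_half] at h1
  exact h1.unique (h.hasDerivAt θ).neg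

theorem exists_param (h : IsBoundaryParam K x v) {y : Plane} (hy : y ∈ frontier K) :
    ∃ θ, x θ = y := by
  have hy0 : y ≠ 0 := by rintro rfl; exact hy.2 h.zero_mem
  obtain ⟨θ, hθ⟩ := exists_atAngle hy0
  exact ⟨θ, h.eq_of_atAngle hy hθ⟩

theorem eq_add_int (h : IsBoundaryParam K x v) {a b : ℝ} (hab : x a = x b) :
    ∃ n : ℤ, b = a + n :=
  (h.atAngle a).eq_add_int (hab ▸ h.atAngle b)

theorem x_ne (h : IsBoundaryParam K x v) {a b : ℝ} (h1 : a < b) (h2 : b < a + 1) :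
    x b ≠ x a := fun hab => by
  have := (h.atAngle a).eq_of_lt (hab ▸ h.atAngle b) (by linarith) (by linarith)
  linarith

theorem exists_param_Ioc (h : IsBoundaryParam K x v) {y : Plane} (hy : y ∈ frontier K) (c : ℝ) :
    ∃ θ, c < θ ∧ θ ≤ c + 1 ∧ x θ = y := by
  have hy0 : y ≠ 0 := by rintro rfl; exact hy.2 h.zero_mem
  obtain ⟨θ, h1, h2, hθ⟩ := exists_atAngle_Ioc hy0 c
  exact ⟨θ, h1, h2, h.eq_of_atAngle hy hθ⟩

theorem exists_param_Ioo (h : IsBoundaryParam K x v) {y : Plane} (hy : y ∈ frontier K) {c : ℝ}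
    (hne : y ≠ x c) : ∃ θ, c < θ ∧ θ < c + 1 ∧ x θ = y := by
  obtain ⟨θ, h1, h2, rfl⟩ := h.exists_param_Ioc hy c
  refine ⟨θ, h1, lt_of_le_of_ne h2 ?_, rfl⟩
  rintro rfl
  exact hne (h.x_add_one c)

theorem det2_left_pos (h : IsBoundaryParam K x v) {a b : ℝ} (hab : x b ≠ x a) :
    0 < det2 (v a) (x b - x a) := h.left a _ (h.mem b) hab

theorem det2_left_nonneg (h : IsBoundaryParam K x v) (a : ℝ) {y : Plane} (hy : y ∈ K) :
    0 ≤ det2 (v a) (y - x a) := by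
  rcases eq_or_ne y (x a) with rfl | hne
  · simp [det2]
  · exact (h.left a y hy hne).le

theorem det2_x_v (h : IsBoundaryParam K x v) (θ : ℝ) : 0 < det2 (x θ) (v θ) := by
  have := h.left θ 0 h.zero_mem' (h.x_ne_zero θ).symm
  rw [zero_sub, det2_neg_right, det2_swap, neg_neg] at this
  exact this

theorem v_ne_zero (h : IsBoundaryParam K x v) (θ : ℝ) : v θ ≠ 0 := fun h0 => by
  have := h.det2_x_v θ
  rw [h0, det2_zero_right] at this
  exact lt_irrefl _ this

theorem isOuterNormal (h : IsBoundaryParam K x v) (θ : ℝ) {c : ℝ} (hc : 0 < c) :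
    IsOuterNormal K (x θ) (-(c • rot (v θ))) := by
  refine ⟨h.mem_frontier θ, neg_ne_zero.2 (smul_ne_zero hc.ne' (rot_ne_zero (h.v_ne_zero θ))),
    fun y hy => ?_⟩
  rw [inner_neg_left, real_inner_smul_left, inner_rot_left]
  have := mul_nonneg hc.le (h.det2_left_nonneg θ hy)
  linarith

theorem tangentAngle_spec (h : IsBoundaryParam K x v) (θ : ℝ) :
    θ < tangentAngle v θ ∧ tangentAngle v θ < θ + 1 / 2 ∧ AtAngle (tangentAngle v θ) (v θ) :=
  Classical.epsilon_spec ((h.atAngle θ).exists_lift (h.det2_x_v θ))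

theorem tangentAngle_unique (h : IsBoundaryParam K x v) {θ t : ℝ} (h1 : θ < t + 1 / 2)
    (h2 : t < θ + 1) (h3 : AtAngle t (v θ)) : tangentAngle v θ = t := by
  obtain ⟨h4, h5, h6⟩ := h.tangentAngle_spec θ
  exact h6.eq_of_lt h3 (by linarith) (by linarith)

theorem tangentAngle_add_int (h : IsBoundaryParam K x v) (θ : ℝ) (n : ℤ) :
    tangentAngle v (θ + n) = tangentAngle v θ + n := by
  obtain ⟨h4, h5, h6⟩ := h.tangentAngle_spec θ
  exact h.tangentAngle_unique (by linarith) (by linarith)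
    (by rw [h.v_add_int]; exact h6.add_int n)

theorem tangentAngle_add_one (h : IsBoundaryParam K x v) (θ : ℝ) :
    tangentAngle v (θ + 1) = tangentAngle v θ + 1 := by
  simpa using h.tangentAngle_add_int θ 1

theorem tangentAngle_add_half (h : IsBoundaryParam K x v) (θ : ℝ) :
    tangentAngle v (θ + 1 / 2) = tangentAngle v θ + 1 / 2 := by
  obtain ⟨h4, h5, h6⟩ := h.tangentAngle_spec θ
  exact h.tangentAngle_unique (by linarith) (by linarith)
    (by rw [h.v_add_half]; exact h6.neg)

/-- The direction of a chord lies between the directions of the tangents at its end points. -/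
theorem exists_chord_angle_aux (h : IsBoundaryParam K x v) {a b : ℝ} (h1 : a < b)
    (h2 : b < a + 1 / 2) : ∃ δ, AtAngle δ (x b - x a) ∧ tangentAngle v a < δ ∧
      δ < tangentAngle v b := by
  obtain ⟨ha1, ha2, ha3⟩ := h.tangentAngle_spec a
  obtain ⟨hb1, hb2, hb3⟩ := h.tangentAngle_spec b
  have hne := h.x_ne h1 (by linarith)
  have hda := h.det2_left_pos hne
  have hdb : 0 < det2 (x b - x a) (v b) := by
    have := h.det2_left_pos hne.symm
    rwa [← neg_sub, det2_neg_right, det2_swap, neg_neg] at this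
  have hxb : 0 < det2 (x b) (x b - x a) := by
    rw [det2_sub_right, det2_self, det2_swap]
    linarith [(h.atAngle a).det2_pos (h.atAngle b) h1 h2]
  have hxa : 0 < det2 (x b - x a) (-x a) := by
    rw [det2_neg_right, det2_sub_left, det2_self, det2_swap]
    linarith [(h.atAngle a).det2_pos (h.atAngle b) h1 h2]
  obtain ⟨δ, hδ1, hδ2, hδ⟩ := (h.atAngle b).exists_lift hxb
  have hδ3 : δ < a + 1 / 2 := by
    by_contra! hle
    rcases hle.eq_or_lt with heq | hlt
    · have := hδ.det2_nonpos (heq ▸ (h.atAngle a).neg.add_one) (by linarith) (by linarith)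
      linarith
    · have := (h.atAngle a).neg.det2_pos hδ hlt (by linarith)
      rw [det2_swap] at this
      linarith
  refine ⟨δ, hδ, ?_, ?_⟩
  · by_contra! hle
    have := hδ.det2_nonneg ha3 hle (by linarith)
    rw [det2_swap] at this
    linarith
  · by_contra! hle
    have := hb3.det2_nonneg hδ hle (by linarith)
    rw [det2_swap] at this
    linarith

theorem strictMono_tangentAngle (h : IsBoundaryParam K x v) : StrictMono (tangentAngle v) := by
  intro a b hab
  rcases lt_or_ge b (a + 1 / 2) with h1 | h1
  · obtain ⟨δ, -, h2, h3⟩ := h.exists_chord_angle_aux hab h1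
    exact h2.trans h3
  · linarith [(h.tangentAngle_spec a).2.1, (h.tangentAngle_spec b).1]

/-- `K` lies to the left of each of its tangents: the chord points to the left of `v a`, and `v b`
points to the left of the chord. Monotonicity of the tangent angle makes one lift fit both
conditions. -/
theorem exists_chord_angle (h : IsBoundaryParam K x v) {a b : ℝ} (h1 : a < b)
    (h2 : b < a + 1) : ∃ δ, AtAngle δ (x b - x a) ∧ tangentAngle v a < δ ∧
      δ < tangentAngle v a + 1 / 2 ∧ tangentAngle v b - 1 / 2 < δ ∧ δ < tangentAngle v b := by
  obtain ⟨ha1, ha2, ha3⟩ := h.tangentAngle_spec a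
  obtain ⟨hb1, hb2, hb3⟩ := h.tangentAngle_spec b
  have hne := h.x_ne h1 h2
  obtain ⟨δ, hδ1, hδ2, hδ⟩ := ha3.exists_lift (h.det2_left_pos hne)
  have hdb : 0 < det2 (x b - x a) (v b) := by
    have := h.det2_left_pos hne.symm
    rwa [← neg_sub, det2_neg_right, det2_swap, neg_neg] at this
  have hm1 := h.strictMono_tangentAngle h1
  have hm2 := h.strictMono_tangentAngle h2
  rw [h.tangentAngle_add_one] at hm2
  refine ⟨δ, hδ, hδ1, hδ2, ?_, ?_⟩
  · by_contra! hle
    linarith [hδ.det2_nonpos hb3 (by linarith) (by linarith)]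
  · by_contra! hle
    have := hb3.det2_nonneg hδ hle (by linarith)
    rw [det2_swap] at this
    linarith

/-- Every direction is the direction of a tangent. -/
theorem exists_tangentAngle_eq (h : IsBoundaryParam K x v) (t : ℝ) : ∃ θ, tangentAngle v θ = t := by
  set φ : ℝ → ℝ := fun θ => det2 (dir t) (x θ) with hφ
  have hc : Continuous φ := continuous_const.det2 h.continuous
  obtain ⟨θ, -, hθ⟩ := isCompact_Icc.exists_isMinOn (nonempty_Icc.2 (zero_le_one' ℝ)) hc.continuousOn
  have hmin : ∀ s, φ θ ≤ φ s := fun s => by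
    have h1 : s + (-⌊s⌋ : ℤ) ∈ Icc (0 : ℝ) 1 := by
      push_cast
      exact ⟨by linarith [Int.floor_le s], by linarith [Int.lt_floor_add_one s]⟩
    have := hθ h1
    simp only [mem_ofPred_eq, hφ, h.x_add_int] at this
    exact this
  have hd : HasDerivAt φ (det2 (dir t) (v θ)) θ := hasDerivAt_det2_const_left (h.hasDerivAt θ) _
  have hz : det2 (dir t) (v θ) = 0 :=
    IsLocalMin.hasDerivAt_eq_zero (Eventually.of_forall hmin) hd
  obtain ⟨k, hk⟩ := exists_smul_of_det2_eq_zero (dir_ne_zero t) hz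
  -- Stationarity only makes `v θ` parallel to `dir t`. Comparing the minimum with the antipodal
  -- point fixes the sign of the factor.
  have h1 := hmin (θ + 1 / 2)
  simp only [hφ, h.x_add_half, det2_neg_right] at h1
  have h2 := h.det2_x_v θ
  rw [hk, det2_smul_right, det2_swap] at h2
  have hk0 : 0 < k := by
    by_contra! hk0
    nlinarith
  have h3 : AtAngle t (v θ) := ⟨k, hk0, hk⟩
  obtain ⟨n, hn⟩ := (h.tangentAngle_spec θ).2.2.eq_add_int h3
  exact ⟨θ + n, by rw [h.tangentAngle_add_int, hn]⟩

theorem mem_extremePoints (h : IsBoundaryParam K x v) (θ : ℝ) : x θ ∈ K.extremePoints ℝ :=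
  h.strictConvex.mem_extremePoints_of_frontier h.isCompact.isClosed (h.mem_frontier θ)

theorem det2_pos (h : IsBoundaryParam K x v) {a b c : ℝ} (hab : a < b) (hbc : b < c)
    (hca : c < a + 1) : 0 < det2 (x b - x a) (x c - x a) :=
  det2_pos_of_extreme h.convex h.zero_mem' (h.mem_extremePoints a) (h.mem_extremePoints b)
    (h.mem_extremePoints c) (h.atAngle a) (h.atAngle b) (h.atAngle c) hab hbc hca

/-- Two chords with the same starting point and the same direction agree. -/
theorem eq_of_smul (h : IsBoundaryParam K x v) {a b c : ℝ} (hb : a < b) (hb' : b < a + 1)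
    (hc : a < c) (hc' : c < a + 1) {s : ℝ} (hs : x c - x a = s • (x b - x a)) : b = c := by
  rcases lt_trichotomy b c with hlt | heq | hlt
  · have := h.det2_pos hb hlt hc'
    rw [hs, det2_smul_right, det2_self, mul_zero] at this
    exact absurd this (lt_irrefl _)
  · exact heq
  · have := h.det2_pos hc hlt hb'
    rw [hs, det2_smul_left, det2_self, mul_zero] at this
    exact absurd this (lt_irrefl _)

theorem eq_of_smul' (h : IsBoundaryParam K x v) {q y z : Plane} (hq : q ∈ frontier K)
    (hy : y ∈ frontier K) (hz : z ∈ frontier K) (hyq : y ≠ q) (hzq : z ≠ q) {s : ℝ}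
    (hs : z - q = s • (y - q)) : y = z := by
  obtain ⟨a, rfl⟩ := h.exists_param hq
  obtain ⟨b, h1, h2, rfl⟩ := h.exists_param_Ioo hy hyq
  obtain ⟨c, h3, h4, rfl⟩ := h.exists_param_Ioo hz hzq
  rw [h.eq_of_smul h1 h2 h3 h4 hs]

/-- The second end point of the chord that starts in a direction pointing inside. -/
theorem exists_chord (h : IsBoundaryParam K x v) {θ : ℝ} {d : Plane} (hd : 0 < det2 (v θ) d) :
    ∃ s t : ℝ, θ < s ∧ s < θ + 1 ∧ 0 < t ∧ x s - x θ = t • d := by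
  set φ : ℝ → ℝ := fun s => det2 d (x s - x θ) with hφ
  have hc : Continuous φ := continuous_const.det2 (h.continuous.sub continuous_const)
  have hder : ∀ a, v a = v θ → HasDerivAt φ (-det2 (v θ) d) a := fun a ha => by
    rw [← det2_swap, ← ha]
    exact hasDerivAt_det2_const_left ((h.hasDerivAt a).sub_const (x θ)) d
  have hz1 : φ θ = 0 := by simp [hφ, det2]
  have hz2 : φ (θ + 1) = 0 := by simp [hφ, det2, h.x_add_one]
  have hneg : -det2 (v θ) d < 0 := by linarith
  -- φ vanishes at θ and at θ + 1 with the same negative derivative. So it is negative just after θ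
  -- and positive just before θ + 1, and a zero in between is the other end of the chord.
  have e1 : ∀ᶠ s in 𝓝[>] θ, φ s < 0 := by
    have := (hasDerivAt_iff_tendsto_slope.1 (hder θ rfl)).mono_left
      (nhdsWithin_mono θ (fun s (hs : θ < s) => hs.ne'))
    filter_upwards [this.eventually (gt_mem_nhds hneg), self_mem_nhdsWithin] with s hs hs'
    rw [slope_def_field, hz1, sub_zero] at hs
    have hs'' : θ < s := hs'
    exact (div_neg_iff.1 hs).elim (fun hh => absurd hh.2 (by linarith)) (fun hh => hh.1)
  have e2 : ∀ᶠ s in 𝓝[<] (θ + 1), 0 < φ s := by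
    have := (hasDerivAt_iff_tendsto_slope.1 (hder (θ + 1) (h.v_add_one θ))).mono_left
      (nhdsWithin_mono (θ + 1) (fun s (hs : s < θ + 1) => hs.ne))
    filter_upwards [this.eventually (gt_mem_nhds hneg), self_mem_nhdsWithin] with s hs hs'
    rw [slope_def_field, hz2, sub_zero] at hs
    have hs'' : s < θ + 1 := hs'
    exact (div_neg_iff.1 hs).elim (fun hh => hh.1) (fun hh => absurd hh.2 (by linarith))
  obtain ⟨s₁, hs1, hs1'⟩ := (e1.and (Ioo_mem_nhdsGT (show θ < θ + 1 / 2 by linarith))).exists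
  obtain ⟨s₂, hs2, hs2'⟩ := (e2.and (Ioo_mem_nhdsLT (show θ + 1 / 2 < θ + 1 by linarith))).exists
  obtain ⟨s, hs, hs0⟩ := intermediate_value_Icc (by linarith [hs1'.2, hs2'.1]) hc.continuousOn
    (show (0 : ℝ) ∈ Icc (φ s₁) (φ s₂) from ⟨hs1.le, hs2.le⟩)
  have hsθ : θ < s := by linarith [hs.1, hs1'.1]
  have hsθ' : s < θ + 1 := by linarith [hs.2, hs2'.2]
  have hd0 : d ≠ 0 := by rintro rfl; simp [det2] at hd
  obtain ⟨t, ht⟩ := exists_smul_of_det2_eq_zero hd0 hs0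
  refine ⟨s, t, hsθ, hsθ', ?_, ht⟩
  have := h.det2_left_pos (h.x_ne hsθ hsθ')
  rw [ht, det2_smul_right] at this
  exact pos_of_mul_pos_left this hd.le

end IsBoundaryParam

/-! ### Billiard trajectories -/

theorem IsOuterNormal.neg {K : Set Plane} (hs : ∀ x ∈ K, -x ∈ K) {x n : Plane}
    (h : IsOuterNormal K x n) : IsOuterNormal K (-x) (-n) := by
  refine ⟨neg_mem_frontier hs h.1, neg_ne_zero.2 h.2.1, fun z hz => ?_⟩
  have := h.2.2 _ (hs z hz)
  have e : z - -x = -(-z - x) := by abel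
  rw [e, inner_neg_neg]
  exact this

/-- Two distinct boundary points with equally directed tangents would each lie strictly to the left
of the tangent at the other. -/
theorem IsBoundaryParam.eq_of_v_smul {K : Set Plane} {x v : ℝ → Plane}
    (h : IsBoundaryParam K x v) {a b k : ℝ} (hk : 0 < k) (hv : v b = k • v a) : x a = x b := by
  by_contra hne
  have h1 := h.det2_left_pos (Ne.symm hne)
  have h2 := h.det2_left_pos hne
  rw [hv, det2_smul_left, ← neg_sub (x b), det2_neg_right] at h2
  nlinarith

namespace IsBilliardTrajectory

variable {K T : Set Plane} {x v y w : ℝ → Plane} {q p q' p' : ℤ → Plane}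

theorem q_ne (h : IsBilliardTrajectory K T q p) (n : ℤ) : q (n + 1) ≠ q n := fun h' =>
  (h.q_move n).2.1 (by rw [h', sub_self])

theorem p_ne (h : IsBilliardTrajectory K T q p) (n : ℤ) : p (n + 1) ≠ p n := fun h' =>
  (h.p_move n).2.1 (by rw [h', sub_self])

theorem q_step (hT : IsBoundaryParam T y w) (h : IsBilliardTrajectory K T q p) (n : ℤ) {β : ℝ}
    (hp : y β = p n) : ∃ c : ℝ, 0 < c ∧ q (n + 1) - q n = c • rot (w β) := by
  obtain ⟨c, hc, h1⟩ := hT.normal β _ (hp ▸ h.q_move n)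
  exact ⟨c, hc, by rw [← neg_sub, h1, neg_neg]⟩

theorem p_step (hK : IsBoundaryParam K x v) (h : IsBilliardTrajectory K T q p) (n : ℤ) {θ : ℝ}
    (hq : x θ = q (n + 1)) : ∃ c : ℝ, 0 < c ∧ p (n + 1) - p n = -(c • rot (v θ)) :=
  hK.normal θ _ (hq ▸ h.p_move n)

theorem shift (h : IsBilliardTrajectory K T q p) (k : ℤ) :
    IsBilliardTrajectory K T (fun n => q (n + k)) (fun n => p (n + k)) := by
  refine ⟨fun n => h.q_mem _, fun n => h.p_mem _, fun n => ?_, fun n => ?_⟩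
  · have := h.q_move (n + k)
    rwa [add_right_comm] at this
  · have := h.p_move (n + k)
    rwa [add_right_comm] at this

theorem neg (hK : ∀ x ∈ K, -x ∈ K) (hT : ∀ x ∈ T, -x ∈ T) (h : IsBilliardTrajectory K T q p) :
    IsBilliardTrajectory K T (fun n => -q n) (fun n => -p n) := by
  refine ⟨fun n => neg_mem_frontier hK (h.q_mem _), fun n => neg_mem_frontier hT (h.p_mem _),
    fun n => ?_, fun n => ?_⟩
  · have := (h.q_move n).neg hT
    rwa [neg_sub, ← neg_sub_neg] at this
  · have := (h.p_move n).neg hK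
    rwa [neg_sub, ← neg_sub_neg] at this

/-- Time reversal changes the sign of the link directions, and by the symmetry of `T` this is the
passage from `p` to `-p`. The link from `q (-n)` back to `q (-n - 1)` is the one that carried the
momentum `p (-n - 1)`, whence the index shift. -/
theorem reverse (hT : ∀ x ∈ T, -x ∈ T) (h : IsBilliardTrajectory K T q p) :
    IsBilliardTrajectory K T (fun n => q (-n)) (fun n => -p (-n - 1)) := by
  refine ⟨fun n => h.q_mem _, fun n => neg_mem_frontier hT (h.p_mem _), fun n => ?_, fun n => ?_⟩
  · have := (h.q_move (-n - 1)).neg hT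
    rw [neg_sub, sub_add_cancel] at this
    rwa [neg_add']
  · have := h.p_move (-n - 1 - 1)
    rw [sub_add_cancel] at this
    rw [neg_add', neg_sub_neg]
    exact this

/-- Momenta move along `+n_K` whereas positions move along `-n_T`; the symmetry of `K` absorbs this
sign in the point `-q (n + 1)`. -/
theorem dual (hK : ∀ x ∈ K, -x ∈ K) (h : IsBilliardTrajectory K T q p) :
    IsBilliardTrajectory T K p (fun n => -q (n + 1)) := by
  refine ⟨fun n => h.p_mem _, fun n => neg_mem_frontier hK (h.q_mem _), fun n => ?_, fun n => ?_⟩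
  · have := (h.p_move n).neg hK
    rwa [neg_sub] at this
  · have := h.q_move (n + 1)
    rwa [neg_sub_neg]

/-- A trajectory is determined by one of its states. -/
theorem ext_of_state (hK : IsBoundaryParam K x v) (hT : IsBoundaryParam T y w)
    (h : IsBilliardTrajectory K T q p) (h' : IsBilliardTrajectory K T q' p') (hq : q 0 = q' 0)
    (hp : p 0 = p' 0) (n : ℤ) : q n = q' n ∧ p n = p' n := by
  induction n using Int.induction_on with
  | zero => exact ⟨hq, hp⟩
  | succ n ih =>
    obtain ⟨ih1, ih2⟩ := ih
    have e1 : q (n + 1) = q' (n + 1) := by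
      obtain ⟨β, hβ⟩ := hT.exists_param (h.p_mem n)
      obtain ⟨c, hc, h1⟩ := h.q_step hT n hβ
      obtain ⟨c', hc', h2⟩ := h'.q_step hT n (hβ.trans ih2)
      refine hK.eq_of_smul' (h.q_mem n) (h.q_mem _) (h'.q_mem _) (h.q_ne n)
        (ih1 ▸ h'.q_ne n) (s := c' / c) ?_
      rw [h1, smul_smul, div_mul_cancel₀ _ hc.ne', ← h2, ih1]
    refine ⟨e1, ?_⟩
    obtain ⟨θ, hθ⟩ := hK.exists_param (h.q_mem (n + 1))
    obtain ⟨c, hc, h1⟩ := h.p_step hK n hθ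
    obtain ⟨c', hc', h2⟩ := h'.p_step hK n (hθ.trans e1)
    refine hT.eq_of_smul' (h.p_mem n) (h.p_mem _) (h'.p_mem _) (h.p_ne n)
      (ih2 ▸ h'.p_ne n) (s := c' / c) ?_
    rw [h1, smul_neg, smul_smul, div_mul_cancel₀ _ hc.ne', ← h2, ih2]
  | pred n ih =>
    obtain ⟨ih1, ih2⟩ := ih
    have hn : (-(n : ℤ) - 1) + 1 = -n := by ring
    have hqm := h.q_mem (-n - 1)
    have e2 : p (-n - 1) = p' (-n - 1) := by
      obtain ⟨θ, hθ⟩ := hK.exists_param (h.q_mem (-n))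
      obtain ⟨c, hc, h1⟩ := h.p_step hK (-n - 1) (hn ▸ hθ)
      obtain ⟨c', hc', h2⟩ := h'.p_step hK (-n - 1) (hn ▸ hθ.trans ih1)
      have n1 := h.p_ne (-n - 1)
      have n2 := h'.p_ne (-n - 1)
      rw [hn] at h1 h2 n1 n2
      refine hT.eq_of_smul' (h.p_mem (-n)) (h.p_mem _) (h'.p_mem _) n1.symm
        (ih2 ▸ n2.symm) (s := c' / c) ?_
      rw [← neg_sub (p (-n)) (p (-n - 1)), h1, neg_neg, smul_smul, div_mul_cancel₀ _ hc.ne', ih2,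
        ← neg_sub (p' (-n)), h2, neg_neg]
    refine ⟨?_, e2⟩
    obtain ⟨β, hβ⟩ := hT.exists_param (h.p_mem (-n - 1))
    obtain ⟨c, hc, h1⟩ := h.q_step hT (-n - 1) hβ
    obtain ⟨c', hc', h2⟩ := h'.q_step hT (-n - 1) (hβ.trans e2)
    have n1 := h.q_ne (-n - 1)
    have n2 := h'.q_ne (-n - 1)
    rw [hn] at h1 h2 n1 n2
    refine hK.eq_of_smul' (h.q_mem (-n)) (h.q_mem _) (h'.q_mem _) n1.symm
      (ih1 ▸ n2.symm) (s := c' / c) ?_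
    rw [← neg_sub (q (-n)) (q (-n - 1)), h1, smul_neg, smul_smul, div_mul_cancel₀ _ hc.ne', ih1,
      ← neg_sub (q' (-n)), h2]

/-- A trajectory is determined by one of its links. -/
theorem ext_of_link (hK : IsBoundaryParam K x v) (hT : IsBoundaryParam T y w)
    (h : IsBilliardTrajectory K T q p) (h' : IsBilliardTrajectory K T q' p') (h0 : q 0 = q' 0)
    (h1 : q 1 = q' 1) (n : ℤ) : q n = q' n ∧ p n = p' n := by
  refine h.ext_of_state hK hT h' h0 ?_ n
  obtain ⟨β, hβ⟩ := hT.exists_param (h.p_mem 0)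
  obtain ⟨β', hβ'⟩ := hT.exists_param (h'.p_mem 0)
  obtain ⟨c, hc, e1⟩ := h.q_step hT 0 hβ
  obtain ⟨c', hc', e2⟩ := h'.q_step hT 0 hβ'
  rw [zero_add, h0, h1] at e1
  rw [zero_add, e1] at e2
  rw [← hβ, ← hβ']
  refine hT.eq_of_v_smul (k := c / c') (div_pos hc hc') ?_
  have e3 := congrArg rot e2
  rw [rot_smul, rot_smul, rot_rot, rot_rot, smul_neg, smul_neg, neg_inj] at e3
  rw [div_eq_inv_mul, mul_smul, e3, smul_smul, inv_mul_cancel₀ hc'.ne', one_smul]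

end IsBilliardTrajectory

/-! ### Existence of billiard trajectories. -/

section existence

variable {K T : Set Plane} {x v y w : ℝ → Plane}

/-- Positivity of ⟨v θ, w β⟩ says that the link direction `rot (w β)` enters `K` at `x θ`. At the
far end of the chord the product is negative, so that `-rot (v θ')` enters `T` at `y β`; after the
chord of `T` it is positive again. Thus the condition reproduces itself and the motion can be
continued forever. -/
theorem exists_next_state (hK : IsBoundaryParam K x v) (hT : IsBoundaryParam T y w) {θ β : ℝ}
    (h : 0 < inner ℝ (v θ) (w β)) : ∃ θ' β', 0 < inner ℝ (v θ') (w β') ∧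
      IsOuterNormal T (y β) (x θ - x θ') ∧ IsOuterNormal K (x θ') (y β' - y β) := by
  obtain ⟨θ', t, h1, h2, ht, h3⟩ := hK.exists_chord (θ := θ) (d := rot (w β))
    (by rwa [det2_rot_right])
  have h4 := hK.det2_left_pos (hK.x_ne h1 h2).symm
  rw [← neg_sub, h3, det2_neg_right, det2_smul_right, det2_rot_right] at h4
  obtain ⟨β', t', h5, h6, ht', h7⟩ := hT.exists_chord (θ := β) (d := -rot (v θ'))
    (by
      rw [det2_neg_right, det2_rot_right, real_inner_comm]
      by_contra! h8
      nlinarith)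
  have h8 := hT.det2_left_pos (hT.x_ne h5 h6).symm
  rw [← neg_sub, h7, smul_neg, neg_neg, det2_smul_right, det2_rot_right, real_inner_comm] at h8
  refine ⟨θ', β', pos_of_mul_pos_right h8 ht'.le, ?_, ?_⟩
  · rw [← neg_sub, h3]
    exact hT.isOuterNormal β ht
  · rw [h7, smul_neg]
    exact hK.isOuterNormal θ' ht'

theorem exists_prev_state (hK : IsBoundaryParam K x v) (hT : IsBoundaryParam T y w) {θ' β' : ℝ}
    (h : 0 < inner ℝ (v θ') (w β')) : ∃ θ β, 0 < inner ℝ (v θ) (w β) ∧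
      IsOuterNormal T (y β) (x θ - x θ') ∧ IsOuterNormal K (x θ') (y β' - y β) := by
  obtain ⟨β, t, h1, h2, ht, h3⟩ := hT.exists_chord (θ := β') (d := rot (v θ'))
    (by rwa [det2_rot_right, real_inner_comm])
  have h4 := hT.det2_left_pos (hT.x_ne h1 h2).symm
  rw [← neg_sub, h3, det2_neg_right, det2_smul_right, det2_rot_right, real_inner_comm] at h4
  obtain ⟨θ, t', h5, h6, ht', h7⟩ := hK.exists_chord (θ := θ') (d := -rot (w β))
    (by
      rw [det2_neg_right, det2_rot_right]
      by_contra! h8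
      nlinarith)
  have h8 := hK.det2_left_pos (hK.x_ne h5 h6).symm
  rw [← neg_sub, h7, smul_neg, neg_neg, det2_smul_right, det2_rot_right] at h8
  refine ⟨θ, β, pos_of_mul_pos_right h8 ht'.le, ?_, ?_⟩
  · rw [h7, smul_neg]
    exact hT.isOuterNormal β ht'
  · rw [← neg_sub, h3]
    exact hK.isOuterNormal θ' ht

theorem exists_trajectory (hK : IsBoundaryParam K x v) (hT : IsBoundaryParam T y w) {θ β : ℝ}
    (h : 0 < inner ℝ (v θ) (w β)) :
    ∃ q p, IsBilliardTrajectory K T q p ∧ q 0 = x θ ∧ p 0 = y β := by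
  let R : ℝ × ℝ → ℝ × ℝ → Prop := fun s s' =>
    IsOuterNormal T (y s.2) (x s.1 - x s'.1) ∧ IsOuterNormal K (x s'.1) (y s'.2 - y s.2)
  let S := {s : ℝ × ℝ // 0 < inner ℝ (v s.1) (w s.2)}
  have hnext : ∀ s : S, ∃ s' : S, R s s' := fun s => by
    obtain ⟨θ', β', h1, h2⟩ := exists_next_state hK hT s.2
    exact ⟨⟨(θ', β'), h1⟩, h2⟩
  have hprev : ∀ s' : S, ∃ s : S, R s s' := fun s => by
    obtain ⟨θ', β', h1, h2⟩ := exists_prev_state hK hT s.2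
    exact ⟨⟨(θ', β'), h1⟩, h2⟩
  choose f hf using hnext
  choose g hg using hprev
  let z : S := ⟨(θ, β), h⟩
  let o : ℤ → S := fun n => match n with
    | Int.ofNat n => f^[n] z
    | Int.negSucc n => g^[n + 1] z
  have ho : ∀ n, R (o n) (o (n + 1)) := by
    intro n
    rcases n with n | n
    · have e : o (Int.ofNat n + 1) = f (o (Int.ofNat n)) := Function.iterate_succ_apply' f n z
      rw [e]
      exact hf _
    · have e : o (Int.negSucc n) = g (o (Int.negSucc n + 1)) := by
        rcases n with n | n
        · rfl
        · exact Function.iterate_succ_apply' g (n + 1) z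
      rw [e]
      exact hg _
  exact ⟨fun n => x (o n).1.1, fun n => y (o n).1.2, ⟨fun n => hK.mem_frontier _,
    fun n => hT.mem_frontier _, fun n => (ho n).1, fun n => (ho n).2⟩, rfl, rfl⟩

/-- Every chord is a link of a trajectory. -/
theorem exists_trajectory_of_chord (hK : IsBoundaryParam K x v) (hT : IsBoundaryParam T y w)
    {a b : Plane} (ha : a ∈ frontier K) (hb : b ∈ frontier K) (hab : b ≠ a) :
    ∃ q p, IsBilliardTrajectory K T q p ∧ q 0 = a ∧ q 1 = b := by
  obtain ⟨θ, rfl⟩ := hK.exists_param ha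
  obtain ⟨t, ht⟩ := exists_atAngle (sub_ne_zero.2 hab)
  obtain ⟨β, hβ⟩ := hT.exists_tangentAngle_eq (t - 1 / 4)
  have h1 := (hT.tangentAngle_spec β).2.2.rot
  rw [hβ, sub_add_cancel] at h1
  obtain ⟨c, hc, h2⟩ := h1.same_ray ht
  have h3 := hK.left θ b (hK.isCompact.isClosed.frontier_subset hb) hab
  rw [h2, det2_smul_right, det2_rot_right] at h3
  obtain ⟨q, p, hqp, h0, hp⟩ := exists_trajectory hK hT (pos_of_mul_pos_right h3 hc.le)
  refine ⟨q, p, hqp, h0, ?_⟩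
  obtain ⟨c', hc', h4⟩ := hqp.q_step hT 0 hp.symm
  rw [zero_add, h0] at h4
  refine hK.eq_of_smul' ha (hqp.q_mem 1) hb (h0 ▸ hqp.q_ne 0) hab (s := c / c') ?_
  rw [h4, h2, smul_smul, div_mul_cancel₀ _ hc'.ne']

end existence

/-! ### Lifts of sequences of boundary points -/

/-- Supplies the whole turns to be added to the angles of a two-sided sequence when the correction
of each single step is prescribed. -/
theorem exists_int_primitive (c : ℤ → ℤ) : ∃ k : ℤ → ℤ, k 0 = 0 ∧ ∀ n, k (n + 1) = k n + c n := by
  refine ⟨fun n => match n with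
    | Int.ofNat n => ∑ i ∈ Finset.range n, c i
    | Int.negSucc n => -∑ i ∈ Finset.range (n + 1), c (-(i : ℤ) - 1), by
      change ∑ i ∈ Finset.range 0, c i = 0; simp, fun n => ?_⟩
  rcases n with n | n
  · exact Finset.sum_range_succ (fun i : ℕ => c i) n
  · rcases n with n | n
    · change ∑ i ∈ Finset.range 0, c i = -∑ i ∈ Finset.range (0 + 1), c (-(i : ℤ) - 1) + c (-1)
      simp
    · change -∑ i ∈ Finset.range (n + 1), c (-(i : ℤ) - 1) =
        -∑ i ∈ Finset.range (n + 1 + 1), c (-(i : ℤ) - 1) + c (Int.negSucc (n + 1))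
      rw [Finset.sum_range_succ _ (n + 1)]
      have : Int.negSucc (n + 1) = -((n + 1 : ℕ) : ℤ) - 1 := by omega
      rw [this]
      ring

/-- Subtracting integer parts brings every increment into [0, 1), and 0 is excluded because
consecutive points differ. -/
theorem IsBoundaryParam.exists_lift_seq {K : Set Plane} {x v : ℝ → Plane}
    (hK : IsBoundaryParam K x v) {q : ℤ → Plane} (hq : ∀ n, q n ∈ frontier K)
    (hne : ∀ n, q (n + 1) ≠ q n) {θ₀ : ℝ} (h0 : x θ₀ = q 0) :
    ∃ θ : ℤ → ℝ, θ 0 = θ₀ ∧ ∀ n, x (θ n) = q n ∧ θ n < θ (n + 1) ∧ θ (n + 1) < θ n + 1 := by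
  choose t' ht' using fun n => hK.exists_param (hq n)
  set t : ℤ → ℝ := fun n => if n = 0 then θ₀ else t' n with htdef
  have ht : ∀ n, x (t n) = q n := fun n => by
    by_cases hn : n = 0
    · simp [htdef, hn, h0]
    · simp [htdef, hn, ht']
  obtain ⟨k, hk0, hk⟩ := exists_int_primitive fun n => -⌊t (n + 1) - t n⌋
  refine ⟨fun n => t n + k n, by simp [hk0, htdef], fun n => ⟨by rw [hK.x_add_int, ht], ?_, ?_⟩⟩
  · simp only [hk]
    push_cast
    have h1 := Int.floor_le (t (n + 1) - t n)
    rcases h1.eq_or_lt with h2 | h2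
    · exfalso
      apply hne n
      rw [← ht, ← ht, ← hK.x_add_int (t n) ⌊t (n + 1) - t n⌋, h2]
      congr 1
      ring
    · linarith
  · simp only [hk]
    push_cast
    have h1 := Int.lt_floor_add_one (t (n + 1) - t n)
    linarith

/-- The lifts of the two polygonal lines of a trajectory are chosen such that the direction of a
link lies between the directions of the tangents at its end points. -/
theorem IsBilliardTrajectory.exists_lift {K T : Set Plane} {x v y w : ℝ → Plane} {q p : ℤ → Plane}
    (hK : IsBoundaryParam K x v) (hT : IsBoundaryParam T y w)
    (h : IsBilliardTrajectory K T q p) {θ₀ : ℝ} (h0 : x θ₀ = q 0) :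
    ∃ θ β : ℤ → ℝ, θ 0 = θ₀ ∧ (∀ n, x (θ n) = q n ∧ θ n < θ (n + 1) ∧ θ (n + 1) < θ n + 1) ∧
      (∀ n, y (β n) = p n ∧ β n < β (n + 1) ∧ β (n + 1) < β n + 1) ∧
      ∀ n, tangentAngle v (θ n) < tangentAngle w (β n) + 1 / 4 ∧
        tangentAngle w (β n) + 1 / 4 < tangentAngle v (θ n) + 1 / 2 ∧
        tangentAngle v (θ (n + 1)) - 1 / 2 < tangentAngle w (β n) + 1 / 4 ∧
        tangentAngle w (β n) + 1 / 4 < tangentAngle v (θ (n + 1)) := by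
  obtain ⟨θ, hθ0, hθ⟩ := hK.exists_lift_seq h.q_mem h.q_ne h0
  choose δ hδ using fun n => hK.exists_chord_angle (hθ n).2.1 (hθ n).2.2
  -- The link has the direction `rot (w (β n))`, a quarter turn ahead of `w (β n)`.
  choose β hβ using fun n => hT.exists_tangentAngle_eq (δ n - 1 / 4)
  have hβ' : ∀ n, tangentAngle w (β n) + 1 / 4 = δ n := fun n => by rw [hβ]; ring
  refine ⟨θ, β, hθ0, hθ, fun n => ⟨?_, ?_, ?_⟩, fun n => ?_⟩
  · obtain ⟨b, hb⟩ := hT.exists_param (h.p_mem n)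
    obtain ⟨c, hc, e⟩ := h.q_step hT n hb
    have h1 := (hδ n).1
    rw [(hθ n).1, (hθ (n + 1)).1, e] at h1
    have h2 := (hT.tangentAngle_spec (β n)).2.2.rot
    rw [hβ'] at h2
    obtain ⟨d, hd, e2⟩ := h2.same_ray h1
    rw [← hb]
    refine hT.eq_of_v_smul (k := d / c) (div_pos hd hc) ?_
    have e3 := congrArg rot e2
    rw [rot_smul, rot_smul, rot_rot, rot_rot, smul_neg, smul_neg, neg_inj] at e3
    rw [div_eq_inv_mul, mul_smul, ← e3, smul_smul, inv_mul_cancel₀ hc.ne', one_smul]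
  · rw [← hT.strictMono_tangentAngle.lt_iff_lt]
    linarith [hβ' n, hβ' (n + 1), hδ n, hδ (n + 1)]
  · rw [← hT.strictMono_tangentAngle.lt_iff_lt, hT.tangentAngle_add_one]
    linarith [hβ' n, hβ' (n + 1), hδ n, hδ (n + 1)]
  · rw [hβ']
    exact (hδ n).2

/-! ### Tangent lines of a convex set -/

theorem IsPosTangent.smul {C : Set Plane} {z d : Plane} (h : IsPosTangent C z d) {c : ℝ}
    (hc : 0 < c) : IsPosTangent C z (c • d) := by
  obtain ⟨⟨t, ht⟩, h2⟩ := h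
  refine ⟨⟨t / c, by rwa [smul_smul, div_mul_cancel₀ _ hc.ne']⟩, fun y hy => ?_⟩
  rw [det2_smul_left]
  exact mul_nonneg hc.le (h2 y hy)

theorem IsPosTangent.translate {C : Set Plane} {z d : Plane} (h : IsPosTangent C z d) (s : ℝ) :
    IsPosTangent C (z + s • d) d := by
  obtain ⟨⟨t, ht⟩, h2⟩ := h
  refine ⟨⟨t - s, by convert ht using 1; module⟩, fun y hy => ?_⟩
  have := h2 y hy
  have e : y - (z + s • d) = (y - z) - s • d := by abel
  rwa [e, det2_sub_right, det2_smul_right, det2_self, mul_zero, sub_zero]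

/-- A positively tangent line can be described from its other end. -/
theorem IsPosTangent.flip {C : Set Plane} {a b : Plane} {σ : ℝ} (hσ : σ ≠ 0)
    (h : IsPosTangent C a (σ • (b - a))) : IsPosTangent C b (-σ • (a - b)) := by
  have h1 := h.translate σ⁻¹
  rw [smul_smul, inv_mul_cancel₀ hσ, one_smul, add_sub_cancel] at h1
  rwa [neg_smul, ← smul_neg, neg_sub]

/-- The two tangent directions at an outside point. -/
theorem exists_isPosTangent {C : Set Plane} (hC : IsCompact C) (hc : Convex ℝ C)
    (hne : C.Nonempty) {z : Plane} (hz : z ∉ C) :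
    (∃ d : Plane, ∃ t : ℝ, 0 < t ∧ IsPosTangent C z d ∧ z + t • d ∈ C) ∧
    ∃ d : Plane, ∃ t : ℝ, 0 < t ∧ IsPosTangent C z (-d) ∧ z + t • d ∈ C := by
  obtain ⟨f, u, hfz, hfC⟩ := geometric_hahn_banach_point_closed hc hC.isClosed hz
  set n := (InnerProductSpace.toDual ℝ Plane).symm f with hn
  have hfn : ∀ y, f y = inner ℝ n y := fun y => (InnerProductSpace.toDual_symm_apply).symm
  have hpos : ∀ y ∈ C, 0 < det2 (-rot n) (y - z) := fun y hy => by
    rw [det2_neg_left, det2_rot_left, neg_neg, ← hfn, map_sub]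
    linarith [hfC y hy]
  obtain ⟨y₀, hy₀⟩ := hne
  have hd0 : -rot n ≠ 0 := fun h0 => by
    have := hpos y₀ hy₀
    rw [h0] at this
    simp [det2] at this
  obtain ⟨s₀, hs₀⟩ := exists_atAngle hd0
  obtain ⟨ρ, hρ, hρ'⟩ := atAngle_iff.1 hs₀
  -- The separating line supplies a direction s₀ with all of `C` strictly to the left, so m is
  -- positive at s₀ and negative at s₀ ± 1/2. The zeros of m on the two sides of s₀ are the two
  -- tangent directions.
  set m : ℝ → ℝ := fun s => sInf ((fun y => det2 (dir s) (y - z)) '' C) with hm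
  have hmc : Continuous m := by
    refine hC.continuous_sInf (f := fun s y => det2 (dir s) (y - z)) ?_
    exact (continuous_dir.comp continuous_fst).det2 (continuous_snd.sub continuous_const)
  have hatt : ∀ s, ∃ y ∈ C, m s = det2 (dir s) (y - z) ∧
      ∀ y' ∈ C, det2 (dir s) (y - z) ≤ det2 (dir s) (y' - z) := fun s => by
    have hcont : Continuous fun y => det2 (dir s) (y - z) :=
      continuous_const.det2 (continuous_id.sub continuous_const)
    obtain ⟨y, hy, hmin⟩ := hC.exists_sInf_image_eq_and_le ⟨y₀, hy₀⟩ hcont.continuousOn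
    exact ⟨y, hy, hmin⟩
  have hpos' : ∀ y ∈ C, 0 < det2 (dir s₀) (y - z) := fun y hy => by
    have := hpos y hy
    rw [hρ', det2_smul_left] at this
    exact pos_of_mul_pos_right this hρ.le
  have hm0 : 0 < m s₀ := by
    obtain ⟨y, hy, h1, -⟩ := hatt s₀
    rw [h1]
    exact hpos' y hy
  have hm1 : ∀ s, dir s = -dir s₀ → m s < 0 := fun s hs => by
    obtain ⟨y, hy, h1, -⟩ := hatt s
    rw [h1, hs, det2_neg_left]
    linarith [hpos' y hy]
  have hzero : ∀ s, m s = 0 → IsPosTangent C z (dir s) ∧ ∃ t : ℝ, z + t • dir s ∈ C := by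
    intro s hs
    obtain ⟨y, hy, h1, h2⟩ := hatt s
    rw [hs] at h1
    obtain ⟨t, ht⟩ := exists_smul_of_det2_eq_zero (dir_ne_zero s) h1.symm
    have h3 : z + t • dir s ∈ C := by rw [← ht]; simpa using hy
    exact ⟨⟨⟨t, h3⟩, fun y' hy' => h1.trans_le (h2 y' hy')⟩, t, h3⟩
  have hdet : ∀ s (t : ℝ), z + t • dir s ∈ C → 0 < t * det2 (dir s₀) (dir s) := fun s t ht => by
    have := hpos' _ ht
    rwa [add_sub_cancel_left, det2_smul_right] at this
  have hself : ∀ s, AtAngle s (dir s) := fun s => ⟨1, one_pos, (one_smul _ _).symm⟩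
  constructor
  · obtain ⟨s, hs, hs0⟩ := intermediate_value_Icc' (show s₀ ≤ s₀ + 1 / 2 by linarith)
      hmc.continuousOn (show (0 : ℝ) ∈ Icc _ _ from ⟨(hm1 _ (dir_add_half s₀)).le, hm0.le⟩)
    obtain ⟨h1, t, ht⟩ := hzero s hs0
    refine ⟨dir s, t, ?_, h1, ht⟩
    have h2 := hdet s t ht
    have h3 := (hself s₀).det2_nonneg (hself s) hs.1 hs.2
    by_contra! h4
    nlinarith
  · have hb : dir (s₀ - 1 / 2) = -dir s₀ := by
      have := dir_add_half (s₀ - 1 / 2)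
      rw [sub_add_cancel] at this
      rw [this, neg_neg]
    obtain ⟨s, hs, hs0⟩ := intermediate_value_Icc (show s₀ - 1 / 2 ≤ s₀ by linarith)
      hmc.continuousOn (show (0 : ℝ) ∈ Icc _ _ from ⟨(hm1 _ hb).le, hm0.le⟩)
    obtain ⟨h1, t, ht⟩ := hzero s hs0
    refine ⟨-dir s, -t, ?_, by rwa [neg_neg], by rwa [neg_smul_neg]⟩
    have h2 := hdet s t ht
    have h3 := (hself s).det2_nonneg (hself s₀) hs.2 (by linarith [hs.1])
    rw [det2_swap] at h3
    by_contra! h4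
    nlinarith

/-- An interior point on the line of a chord lies on the chord. -/
theorem chord_contact {K : Set Plane} (hc : Convex ℝ K) {a b : Plane} (ha : a ∈ frontier K)
    (hb : b ∈ frontier K) {t : ℝ} (h : a + t • (b - a) ∈ interior K) : 0 < t ∧ t < 1 := by
  constructor
  · by_contra! hle
    refine ha.2 ?_
    have h1 : 0 < 1 - t := by linarith
    have := hc.combo_interior_closure_mem_interior h hb.1 (a := 1 / (1 - t)) (b := -t / (1 - t))
      (by positivity) (div_nonneg (by linarith) h1.le) (by rw [← add_div]; field_simp; ring)
    convert this using 1
    match_scalars <;> (field_simp; ring)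
  · by_contra! hle
    refine hb.2 ?_
    have h1 : 0 < t := by linarith
    have := hc.combo_interior_closure_mem_interior h ha.1 (a := 1 / t) (b := (t - 1) / t)
      (by positivity) (div_nonneg (by linarith) h1.le) (by rw [← add_div]; field_simp; ring)
    convert this using 1
    match_scalars
    · field_simp
    · field_simp
      ring

/-! ### Tangent chords and the chord map. -/

section

variable {K T C : Set Plane} {x v y w : ℝ → Plane}

theorem tangent_chord_contact (hK : IsBoundaryParam K x v) (hCK : C ⊆ interior K) {a b : Plane}
    (ha : a ∈ frontier K) (hb : b ∈ frontier K) {σ : ℝ}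
    (h : IsPosTangent C a (σ • (b - a))) : ∃ t : ℝ, 0 < t ∧ t < 1 ∧ a + t • (b - a) ∈ C := by
  obtain ⟨⟨t, ht⟩, -⟩ := h
  rw [smul_smul] at ht
  obtain ⟨h1, h2⟩ := chord_contact hK.convex ha hb (hCK ht)
  exact ⟨_, h1, h2, ht⟩

/-- The contact point of each chord lies on the prescribed side of the other one, which forces both
signs on the determinant of the two chords; it vanishes and they are parallel. -/
theorem tangent_chord_unique (hK : IsBoundaryParam K x v) (hCK : C ⊆ interior K) {a b b' : Plane}
    (ha : a ∈ frontier K) (hb : b ∈ frontier K) (hb' : b' ∈ frontier K) (hab : b ≠ a)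
    (hab' : b' ≠ a) {σ : ℝ} (hσ : σ ≠ 0) (h : IsPosTangent C a (σ • (b - a)))
    (h' : IsPosTangent C a (σ • (b' - a))) : b = b' := by
  obtain ⟨t, ht, -, h1⟩ := tangent_chord_contact hK hCK ha hb h
  obtain ⟨t', ht', -, h1'⟩ := tangent_chord_contact hK hCK ha hb' h'
  have h2 := h.2 _ h1'
  have h2' := h'.2 _ h1
  rw [add_sub_cancel_left, det2_smul_left, det2_smul_right] at h2 h2'
  rw [det2_swap] at h2'
  have h3 : det2 (b - a) (b' - a) = 0 := by
    have h4 : 0 ≤ σ * det2 (b - a) (b' - a) := by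
      by_contra! hlt
      nlinarith
    have h5 : σ * det2 (b - a) (b' - a) ≤ 0 := by
      by_contra! hlt
      nlinarith
    exact (mul_eq_zero.1 (le_antisymm h5 h4)).resolve_left hσ
  obtain ⟨s, hs⟩ := exists_smul_of_det2_eq_zero (sub_ne_zero.2 hab) h3
  exact hK.eq_of_smul' ha hb hb' hab hab' hs

theorem exists_tangent_chord (hK : IsBoundaryParam K x v) (hC : IsCompact C) (hc : Convex ℝ C)
    (hne : C.Nonempty) (hCK : C ⊆ interior K) (θ : ℝ) {σ : ℝ} (hσ : σ = 1 ∨ σ = -1) :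
    ∃ s, θ < s ∧ s < θ + 1 ∧ IsPosTangent C (x θ) (σ • (x s - x θ)) := by
  have hz : x θ ∉ C := fun h => (hK.mem_frontier θ).2 (hCK h)
  have key : ∃ d : Plane, ∃ t : ℝ, 0 < t ∧ IsPosTangent C (x θ) (σ • d) ∧ x θ + t • d ∈ C := by
    obtain ⟨h1, h2⟩ := exists_isPosTangent hC hc hne hz
    rcases hσ with rfl | rfl
    · simpa only [one_smul] using h1
    · simpa only [neg_smul, one_smul] using h2
  obtain ⟨d, t, ht, h1, h2⟩ := key
  have h3 : 0 < det2 (v θ) d := by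
    have := hK.left θ _ (interior_subset (hCK h2)) (fun h => hz (h ▸ h2))
    rw [add_sub_cancel_left, det2_smul_right] at this
    exact pos_of_mul_pos_right this ht.le
  obtain ⟨s, r, h4, h5, hr, h6⟩ := hK.exists_chord h3
  refine ⟨s, h4, h5, ?_⟩
  rw [h6, smul_comm]
  exact h1.smul hr

/-- The map on the circle of directions which sends a boundary point to the second end point of the
chord that is positively tangent to `C`. -/
theorem exists_chord_map (hK : IsBoundaryParam K x v) (hC : IsCompact C) (hc : Convex ℝ C)
    (hne : C.Nonempty) (hCK : C ⊆ interior K) :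
    ∃ f : CircleDeg1Lift, ∀ θ, θ < f θ ∧ f θ < θ + 1 ∧
      IsPosTangent C (x θ) (x (f θ) - x θ) := by
  choose f h1 h2 h3 using fun θ => exists_tangent_chord hK hC hc hne hCK θ (Or.inl rfl)
  simp only [one_smul] at h3
  refine ⟨⟨⟨f, ?_⟩, ?_⟩, fun θ => ⟨h1 θ, h2 θ, h3 θ⟩⟩
  · intro θ θ' hθ
    by_contra! hlt
    rcases hθ.eq_or_lt with rfl | hθ
    · exact lt_irrefl _ hlt
    -- If the order were inverted, both ends of the chord from θ' would lie strictly to the right of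
    -- the chord from θ. So would its contact point, which belongs to `C`.
    obtain ⟨t, ht0, ht1, ht⟩ := tangent_chord_contact hK hCK (hK.mem_frontier θ')
      (hK.mem_frontier (f θ')) (σ := 1) (by rw [one_smul]; exact h3 θ')
    have e1 := (h3 θ).2 _ ht
    have e2 := hK.det2_pos hθ ((h1 θ').trans hlt) (h2 θ)
    have e3 := hK.det2_pos (hθ.trans (h1 θ')) hlt (h2 θ)
    rw [det2_swap] at e2 e3
    have e4 : x θ' + t • (x (f θ') - x θ') - x θ = (1 - t) • (x θ' - x θ) +
      t • (x (f θ') - x θ) := by module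
    rw [e4, det2_add_right, det2_smul_right, det2_smul_right] at e1
    nlinarith [mul_pos ht0 (show 0 < -det2 (x (f θ) - x θ) (x (f θ') - x θ) by linarith),
      mul_pos (sub_pos.2 ht1) (show 0 < -det2 (x (f θ) - x θ) (x θ' - x θ) by linarith)]
  · intro θ
    change f (θ + 1) = f θ + 1
    have n1 := hK.x_ne (h1 (θ + 1)) (h2 (θ + 1))
    have t1 := h3 (θ + 1)
    rw [hK.x_add_one θ] at n1 t1
    have e := tangent_chord_unique hK hCK (hK.mem_frontier θ) (hK.mem_frontier (f (θ + 1)))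
      (hK.mem_frontier (f θ)) n1 (hK.x_ne (h1 _) (h2 _)) one_ne_zero
      (by rwa [one_smul]) (by rw [one_smul]; exact h3 _)
    have a1 := hK.atAngle (f (θ + 1))
    have a2 := (hK.atAngle (f θ)).add_one
    rw [e] at a1
    exact a1.eq_of_lt a2 (by linarith [h1 θ, h2 (θ + 1)]) (by linarith [h2 θ, h1 (θ + 1)])

theorem chord_map_unique (hK : IsBoundaryParam K x v) (hCK : C ⊆ interior K) {θ s s' : ℝ}
    (h1 : θ < s) (h2 : s < θ + 1) (h3 : IsPosTangent C (x θ) (x s - x θ)) (h1' : θ < s')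
    (h2' : s' < θ + 1) (h3' : IsPosTangent C (x θ) (x s' - x θ)) : s = s' := by
  have e := tangent_chord_unique hK hCK (hK.mem_frontier θ) (hK.mem_frontier s)
    (hK.mem_frontier s') (hK.x_ne h1 h2) (hK.x_ne h1' h2') one_ne_zero
    (by rwa [one_smul]) (by rwa [one_smul])
  have a1 := hK.atAngle s
  rw [e] at a1
  exact a1.eq_of_lt (hK.atAngle s') (by linarith) (by linarith)

/-- Through each boundary point there is only one positively tangent chord, so the lift in the
definition can only be the chord map; conversely, each of its chords is a link of a trajectory. -/
theorem isRotationNumber_iff (hK : IsBoundaryParam K x v) (hT : IsBoundaryParam T y w)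
    (hCK : C ⊆ interior K) {f : CircleDeg1Lift}
    (hf : ∀ θ, θ < f θ ∧ f θ < θ + 1 ∧ IsPosTangent C (x θ) (x (f θ) - x θ)) (ω : ℝ) :
    IsRotationNumber K T C ω ↔ ω = f.translationNumber := by
  constructor
  · rintro ⟨g, hg, rfl⟩
    congr 1
    refine CircleDeg1Lift.ext fun θ => ?_
    obtain ⟨h1, h2, q, p, hqp, h3, h4, h5⟩ := hg θ
    refine chord_map_unique hK hCK h1 h2 ?_ (hf θ).1 (hf θ).2.1 (hf θ).2.2
    rwa [hK.eq_of_atAngle (hqp.q_mem 0) h4, hK.eq_of_atAngle (hqp.q_mem 1) h5]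
  · rintro rfl
    refine ⟨f, fun θ => ⟨(hf θ).1, (hf θ).2.1, ?_⟩, rfl⟩
    obtain ⟨q, p, hqp, h0, h1⟩ := exists_trajectory_of_chord hK hT (hK.mem_frontier θ)
      (hK.mem_frontier (f θ)) (hK.x_ne (hf θ).1 (hf θ).2.1)
    exact ⟨q, p, hqp, by rw [h0, h1]; exact (hf θ).2.2, h0 ▸ hK.atAngle θ, h1 ▸ hK.atAngle _⟩

end

/-! ### The invariant curve of a caustic -/

/-- If the orientation switched at `q 1`, the outgoing link would lie on the tangent already used by
the incoming one, so `q 2 = q 0`. Let `x s` be the end of the tangent chord at `q 1` with the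
desired orientation, and suppose it is not `q 0`. The trajectory coming from `x s` must also leave
`q 1` along a tangent. If it returns to `x s`, both trajectories hit `q 1` with the same momentum,
hence along the same chord. If it goes to `q 0`, it is the reversal of the first one, which gives `x
s = q 2 = q 0`. Both cases are contradictory. -/
theorem IsConvexCaustic.posTangent_next {K T C : Set Plane} {x v y w : ℝ → Plane}
    {q p : ℤ → Plane} (hK : IsBoundaryParam K x v) (hT : IsBoundaryParam T y w)
    (hC : IsConvexCaustic K T C) (h : IsBilliardTrajectory K T q p) {σ : ℝ}
    (hσ : σ = 1 ∨ σ = -1) (h0 : IsPosTangent C (q 0) (σ • (q 1 - q 0))) :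
    IsPosTangent C (q 1) (σ • (q 2 - q 1)) := by
  have hσ0 : σ ≠ 0 := by rcases hσ with rfl | rfl <;> norm_num
  have hσn : -σ ≠ 0 := neg_ne_zero.2 hσ0
  have htan : ∀ d : Plane, ∀ z : Plane, IsTangent C z d ↔
      (IsPosTangent C z (σ • d) ∨ IsPosTangent C z (-σ • d)) := fun d z => by
    rcases hσ with rfl | rfl
    · simp [IsTangent]
    · simp [IsTangent, or_comm]
  have ne01 : q 1 ≠ q 0 := h.q_ne 0
  have ne12 : q 2 ≠ q 1 := h.q_ne 1
  have hback := h0.flip hσ0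
  have hnext := hC.stays_tangent q p h 0 ((htan _ _).2 (Or.inl h0))
  rw [htan] at hnext
  simp only [zero_add, one_add_one_eq_two] at hnext
  rcases hnext with hnext | hnext
  · exact hnext
  have e20 : q 2 = q 0 := tangent_chord_unique hK hC.subset_interior (h.q_mem 1) (h.q_mem 2)
    (h.q_mem 0) ne12 ne01.symm hσn hnext hback
  obtain ⟨θ, hθ⟩ := hK.exists_param (h.q_mem 1)
  obtain ⟨s, hs1, hs2, hs⟩ := exists_tangent_chord hK hC.isCompact hC.convex hC.nonempty
    hC.subset_interior θ hσ
  rw [hθ] at hs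
  have nes : x s ≠ q 1 := hθ ▸ hK.x_ne hs1 hs2
  by_cases hs0 : x s = q 0
  · rwa [e20, ← hs0]
  exfalso
  obtain ⟨r, z, hrz, hr0, hr1⟩ := exists_trajectory_of_chord hK hT (hK.mem_frontier s)
    (h.q_mem 1) nes.symm
  have hr := hC.stays_tangent r z hrz 0 ((htan _ _).2 (Or.inr (by
    rw [zero_add, hr0, hr1]; exact hs.flip hσ0)))
  rw [htan] at hr
  simp only [zero_add, one_add_one_eq_two, hr1] at hr
  have ner : r 2 ≠ q 1 := hr1 ▸ hrz.q_ne 1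
  rcases hr with hr | hr
  · -- the second trajectory bounces back as well
    have er : r 2 = x s := tangent_chord_unique hK hC.subset_interior (h.q_mem 1) (hrz.q_mem 2)
      (hK.mem_frontier s) ner nes hσ0 hr hs
    -- An immediate return means `p 1 = -p 0`; as `p 1 - p 0` is normal to `K` at the bounce, `p 0`
    -- is a positive multiple of `rot (v θ)`, and this ray meets the boundary of `T` only once.
    have bounce : ∀ {q p : ℤ → Plane}, IsBilliardTrajectory K T q p → q 1 = x θ → q 2 = q 0 →
        ∃ β c : ℝ, 0 < c ∧ y β = p 0 ∧ p 0 = c • rot (v θ) := by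
      intro q p h h1 h2
      obtain ⟨β, hβ⟩ := hT.exists_param (h.p_mem 0)
      obtain ⟨β', hβ'⟩ := hT.exists_param (h.p_mem 1)
      obtain ⟨c, hc, e⟩ := h.q_step hT 0 hβ
      obtain ⟨c', hc', e'⟩ := h.q_step hT 1 hβ'
      obtain ⟨d, hd, e''⟩ := h.p_step hK 0 (θ := θ) h1.symm
      simp only [zero_add, one_add_one_eq_two] at e e' e''
      have hp : p 1 = -p 0 := by
        rw [← hβ, ← hβ', ← hT.x_add_half]
        refine hT.eq_of_v_smul (k := c / c') (div_pos hc hc') ?_ |>.symm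
        rw [h2, ← neg_sub, e] at e'
        have e3 := congrArg rot e'
        rw [rot_neg, rot_smul, rot_smul, rot_rot, rot_rot, smul_neg, smul_neg, neg_neg] at e3
        have e4 : w β' = c'⁻¹ • (c' • w β') := by
          rw [smul_smul, inv_mul_cancel₀ hc'.ne', one_smul]
        rw [hT.v_add_half, e4, ← neg_neg (c' • w β'), ← e3, div_eq_inv_mul, mul_smul]
        simp
      refine ⟨β, d / 2, by positivity, hβ, ?_⟩
      rw [hp] at e''
      apply smul_right_injective Plane (two_ne_zero' ℝ)
      simp only [smul_smul]
      rw [mul_div_cancel₀ _ two_ne_zero, ← neg_neg (d • _), ← e'', two_smul]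
      abel
    obtain ⟨β, c, hc, hβ, e⟩ := bounce h hθ.symm e20
    obtain ⟨β', c', hc', hβ', e'⟩ := bounce hrz (by rw [hr1, hθ]) (by rw [er, hr0])
    have hpz : p 0 = z 0 := by
      obtain ⟨a, ha⟩ := exists_atAngle (rot_ne_zero (hK.v_ne_zero θ))
      refine eq_of_mem_frontier_of_atAngle hT.convex hT.zero_mem (h.p_mem 0) (hrz.p_mem 0)
        (θ := a) ?_ ?_
      · rw [e]; exact ha.smul hc
      · rw [e']; exact ha.smul hc'
    obtain ⟨d, hd, f1⟩ := h.q_step hT 0 hβ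
    obtain ⟨d', hd', f2⟩ := hrz.q_step hT 0 (hβ.trans hpz)
    rw [zero_add, hr0, hr1] at f2
    rw [zero_add] at f1
    refine hs0 (hK.eq_of_smul' (h.q_mem 1) (hK.mem_frontier s) (h.q_mem 0) nes ne01.symm
      (s := d / d') ?_)
    rw [← neg_sub (q 1) (q 0), ← neg_sub (q 1) (x s), f1, f2, smul_neg, smul_smul,
      div_mul_cancel₀ _ hd'.ne']
  · -- the second trajectory is the reversal of the first one
    have er : r 2 = q 0 := tangent_chord_unique hK hC.subset_interior (h.q_mem 1) (hrz.q_mem 2)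
      (h.q_mem 0) ner ne01.symm hσn hr hback
    have hrev := (hrz.reverse hT.symm).shift (-2)
    have := (h.ext_of_link hK hT hrev (by simpa using er.symm) (by simpa using hr1.symm) 2).1
    simp only [add_neg_cancel, neg_zero] at this
    rw [hr0, e20] at this
    exact hs0 this.symm

theorem IsConvexCaustic.posTangent_prev {K T C : Set Plane} {x v y w : ℝ → Plane}
    {q p : ℤ → Plane} (hK : IsBoundaryParam K x v) (hT : IsBoundaryParam T y w)
    (hC : IsConvexCaustic K T C) (h : IsBilliardTrajectory K T q p) {σ : ℝ}
    (hσ : σ = 1 ∨ σ = -1) (h0 : IsPosTangent C (q 1) (σ • (q 2 - q 1))) :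
    IsPosTangent C (q 0) (σ • (q 1 - q 0)) := by
  have hσ0 : σ ≠ 0 := by rcases hσ with rfl | rfl <;> norm_num
  have hσ' : -σ = 1 ∨ -σ = -1 := by rcases hσ with rfl | rfl <;> simp
  have hrev := (h.reverse hT.symm).shift (-2)
  have h1 := hC.posTangent_next hK hT hrev hσ' (by simpa using h0.flip hσ0)
  have h2 : IsPosTangent C (q 1) (-σ • (q 0 - q 1)) := by simpa using h1
  simpa using h2.flip (neg_ne_zero.2 hσ0)

/-- If one link of a trajectory is positively (negatively) tangent to a caustic, then so are all
links. -/
theorem IsConvexCaustic.posTangent_all {K T C : Set Plane} {x v y w : ℝ → Plane}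
    {q p : ℤ → Plane} (hK : IsBoundaryParam K x v) (hT : IsBoundaryParam T y w)
    (hC : IsConvexCaustic K T C) (h : IsBilliardTrajectory K T q p) {σ : ℝ}
    (hσ : σ = 1 ∨ σ = -1) (h0 : IsPosTangent C (q 0) (σ • (q 1 - q 0))) (n : ℤ) :
    IsPosTangent C (q n) (σ • (q (n + 1) - q n)) := by
  induction n using Int.induction_on with
  | zero => simpa using h0
  | succ n ih =>
    have := hC.posTangent_next hK hT (h.shift n) hσ (by simpa [add_comm] using ih)
    rwa [add_comm (1 : ℤ), add_comm (2 : ℤ), show (n : ℤ) + 2 = n + 1 + 1 by ring] at this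
  | pred n ih =>
    have := hC.posTangent_prev hK hT (h.shift (-n - 1)) hσ (by
      have e1 : (1 : ℤ) + (-n - 1) = -n := by ring
      have e2 : (2 : ℤ) + (-n - 1) = -n + 1 := by ring
      rw [e1, e2]
      exact ih)
    rwa [add_comm (1 : ℤ), zero_add] at this

/-! ### Rotation numbers -/

/-- The displacement of a degree-one lift varies by at most 1 with the base point, and the
displacement of the n-th iterate at 0 is within 1 of n times the translation number. Negative n are
reached by starting the orbit at θ n. -/
theorem CircleDeg1Lift.abs_orbit_sub_le (f : CircleDeg1Lift) {θ : ℤ → ℝ}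
    (hθ : ∀ n, θ (n + 1) = f (θ n)) (n : ℤ) :
    |θ n - θ 0 - n * f.translationNumber| ≤ 2 := by
  have h1 : ∀ (g : CircleDeg1Lift) (s : ℝ), |g s - s - g 0| ≤ 1 := fun g s => by
    rw [← g.map_fract_sub_fract_eq]
    have a1 := g.monotone (Int.fract_nonneg s)
    have a2 := g.monotone (Int.fract_lt_one s).le
    have a3 := g.map_add_one 0
    rw [zero_add] at a3
    have a4 := Int.fract_nonneg s
    have a5 := Int.fract_lt_one s
    rw [abs_le]
    constructor <;> linarith
  have h2 : ∀ (k : ℕ) (s : ℝ), |(f ^ k) s - s - k * f.translationNumber| ≤ 2 := fun k s => by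
    have a1 := h1 (f ^ k) s
    have a2 := f.dist_pow_map_zero_mul_translationNumber_le k
    rw [Real.dist_eq] at a2
    rw [abs_le] at *
    constructor <;> linarith
  have h3 : ∀ (k : ℕ) (m : ℤ), θ (m + k) = (f ^ k) (θ m) := fun k m => by
    induction k with
    | zero => simp
    | succ k ih =>
      rw [pow_succ', CircleDeg1Lift.mul_apply, ← ih, ← hθ]
      congr 1
      push_cast
      ring
  rcases n.eq_nat_or_neg with ⟨k, rfl | rfl⟩
  · have := h2 k (θ 0)
    rwa [← h3, zero_add] at this
  · have := h2 k (θ (-k))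
    rw [← h3, neg_add_cancel, abs_le] at this
    push_cast
    rw [abs_le]
    constructor <;> linarith

theorem eq_zero_of_abs_nat_mul_le {d B : ℝ} (h : ∀ n : ℕ, |n * d| ≤ B) : d = 0 := by
  by_contra hd
  have hd' := abs_pos.2 hd
  obtain ⟨n, hn⟩ := exists_nat_gt (B / |d|)
  have := h n
  rw [abs_mul, Nat.abs_cast] at this
  rw [div_lt_iff₀ hd'] at hn
  linarith

/-- If the lifts of two sequences of points on the circle run through the same points in
opposite order, then the sum of their rotation numbers is one. -/
theorem add_eq_one_of_reverse {a b : ℤ → ℝ} {ω ω' B B' d : ℝ} {c : ℤ}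
    (ha : ∀ n, a n < a (n + 1) ∧ a (n + 1) < a n + 1)
    (hb : ∀ n, b n < b (n + 1) ∧ b (n + 1) < b n + 1)
    (hab : ∀ n, ∃ k : ℤ, a n = b (c - n) + d + k) (hω : ∀ n : ℤ, |a n - a 0 - n * ω| ≤ B)
    (hω' : ∀ n : ℤ, |b n - b 0 - n * ω'| ≤ B') : ω + ω' = 1 := by
  -- `a n - b (c - n) - d` is an integer, and one step changes it by the sum of two increments from
  -- (0, 1), hence by exactly 1.
  have hstep : ∀ n, a (n + 1) - b (c - (n + 1)) = a n - b (c - n) + 1 := fun n => by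
    obtain ⟨k, hk⟩ := hab n
    obtain ⟨l, hl⟩ := hab (n + 1)
    have h1 := ha n
    have h2 := hb (c - (n + 1))
    rw [show c - (n + 1) + 1 = c - n by ring] at h2
    have h3 : (0 : ℝ) < l - k := by linarith
    have h4 : (l - k : ℝ) < 2 := by linarith
    have h5 : l - k = 1 := by
      have h6 : (0 : ℤ) < l - k := by exact_mod_cast h3
      have h7 : l - k < (2 : ℤ) := by exact_mod_cast h4
      omega
    have h8 : (l : ℝ) - k = 1 := by exact_mod_cast h5
    linarith
  have hsum : ∀ n : ℕ, a n - b (c - n) = a 0 - b c + n := fun n => by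
    induction n with
    | zero => simp
    | succ n ih =>
      push_cast
      rw [hstep, ih]
      ring
  have := eq_zero_of_abs_nat_mul_le (d := ω + ω' - 1)
    (B := B + B' + |b 0 - b c + c * ω'|) fun n => by
      have h1 := hω n
      have h2 := hω' (c - n)
      have h3 := hsum n
      push_cast at h1 h2
      have h4 := neg_abs_le (b 0 - b c + c * ω')
      have h5 := le_abs_self (b 0 - b c + c * ω')
      rw [abs_le] at *
      constructor <;> nlinarith
  linarith

section

variable {K T C : Set Plane} {x v y w : ℝ → Plane}

theorem lift_eq_chord_map (hK : IsBoundaryParam K x v) (hCK : C ⊆ interior K) {f : CircleDeg1Lift}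
    (hf : ∀ θ, θ < f θ ∧ f θ < θ + 1 ∧ IsPosTangent C (x θ) (x (f θ) - x θ)) {q : ℤ → Plane}
    {θ : ℤ → ℝ} (hθ : ∀ n, x (θ n) = q n ∧ θ n < θ (n + 1) ∧ θ (n + 1) < θ n + 1)
    (hq : ∀ n, IsPosTangent C (q n) (q (n + 1) - q n)) (n : ℤ) : θ (n + 1) = f (θ n) := by
  refine chord_map_unique hK hCK (hθ n).2.1 (hθ n).2.2 ?_ (hf _).1 (hf _).2.1 (hf _).2.2
  rw [(hθ n).1, (hθ (n + 1)).1]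
  exact hq n

/-- If the caustic does not contain the centre, then there is a tangent trajectory one link of which
is a diameter. -/
theorem exists_diameter_of_zero_notMem (hK : IsBoundaryParam K x v) (hT : IsBoundaryParam T y w)
    (hC : IsConvexCaustic K T C) (h0 : (0 : Plane) ∉ C) :
    ∃ q p, IsBilliardTrajectory K T q p ∧ q 1 = -q 0 ∧ IsPosTangent C (q 0) (q 1 - q 0) := by
  obtain ⟨d, t, ht, hd, hdC⟩ := (exists_isPosTangent hC.isCompact hC.convex hC.nonempty h0).1
  have hd0 : d ≠ 0 := by
    rintro rfl
    rw [smul_zero, add_zero] at hdC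
    exact h0 hdC
  obtain ⟨s, hs⟩ := exists_atAngle hd0
  obtain ⟨c, hc, hxs⟩ := hs.same_ray (hK.atAngle s)
  have h1 : IsPosTangent C (-x s) (x s - -x s) := by
    have := (hd.smul (show 0 < 2 * c by positivity)).translate (-1 / 2)
    have e1 : (0 : Plane) + (-1 / 2 : ℝ) • (2 * c) • d = -x s := by rw [hxs]; module
    have e2 : (2 * c) • d = x s - -x s := by rw [hxs]; module
    rwa [e1, e2] at this
  obtain ⟨q, p, hqp, hq0, hq1⟩ := exists_trajectory_of_chord hK hT
    (neg_mem_frontier hK.symm (hK.mem_frontier s)) (hK.mem_frontier s) (by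
      rw [← hK.x_add_half]
      have := hK.x_ne (a := s) (b := s + 1 / 2) (by linarith) (by linarith)
      exact this.symm)
  exact ⟨q, p, hqp, by rw [hq0, hq1, neg_neg], by rwa [hq0, hq1]⟩

/-- With the centre in `C`, a positively tangent chord keeps the centre on its left and advances by
at most half a turn. Otherwise there is a tangent trajectory containing a diameter; its symmetry
makes it its own reversal, so twice the rotation number is 1. -/
theorem rotation_le_half (hK : IsBoundaryParam K x v) (hT : IsBoundaryParam T y w)
    (hC : IsConvexCaustic K T C) {f : CircleDeg1Lift}
    (hf : ∀ θ, θ < f θ ∧ f θ < θ + 1 ∧ IsPosTangent C (x θ) (x (f θ) - x θ)) :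
    f.translationNumber ≤ 1 / 2 := by
  by_cases h0 : (0 : Plane) ∈ C
  · refine f.translationNumber_le_of_le_add fun θ => ?_
    by_contra! hlt
    have h1 := (hf θ).2.2.2 _ h0
    have h2 := (hK.atAngle θ).det2_neg (hK.atAngle (f θ)) hlt (hf θ).2.1
    rw [zero_sub, det2_neg_right, det2_sub_left, det2_self, sub_zero, det2_swap, neg_neg] at h1
    linarith
  · obtain ⟨q, p, hqp, hq, h1⟩ := exists_diameter_of_zero_notMem hK hT hC h0
    have htan := hC.posTangent_all hK hT hqp (σ := 1) (Or.inl rfl)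
      (by rwa [one_smul])
    simp only [one_smul] at htan
    obtain ⟨θ₀, hθ₀⟩ := hK.exists_param (hqp.q_mem 0)
    obtain ⟨θ, β, -, hθ, -, -⟩ := hqp.exists_lift hK hT hθ₀
    have horb := lift_eq_chord_map hK hC.subset_interior hf hθ htan
    have hgrow := f.abs_orbit_sub_le horb
    -- Reversal, central symmetry and a shift send `q` to the sequence `-q (1 - n)`, which shares
    -- the diameter link with `q` and therefore coincides with it.
    have hrev := ((hqp.reverse hT.symm).neg hK.symm hT.symm).shift (-1)
    have hsym := hqp.ext_of_link hK hT hrev (by simp [hq]) (by simp [hq])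
    have := add_eq_one_of_reverse (a := θ) (b := θ) (c := 1) (d := 1 / 2)
      (fun n => (hθ n).2) (fun n => (hθ n).2) (fun n => by
        refine hK.eq_add_int ?_
        rw [hK.x_add_half, (hθ _).1, (hθ _).1, (hsym n).1]
        simp only [neg_add_rev, neg_neg]
        rw [sub_eq_add_neg]) hgrow hgrow
    linarith

end

theorem rotationNumber_eq {K T C C' : Set Plane} {x v y w : ℝ → Plane}
    (hK : IsBoundaryParam K x v) (hT : IsBoundaryParam T y w)
    (hC : IsConvexCaustic K T C) (hC' : IsConvexCaustic T K C')
    (hdual : AreDualCaustics K T C C') {f g : CircleDeg1Lift}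
    (hf : ∀ θ, θ < f θ ∧ f θ < θ + 1 ∧ IsPosTangent C (x θ) (x (f θ) - x θ))
    (hg : ∀ θ, θ < g θ ∧ g θ < θ + 1 ∧ IsPosTangent C' (y θ) (y (g θ) - y θ)) :
    f.translationNumber = g.translationNumber := by
  obtain ⟨q, p, hqp, hq0, hq1⟩ := exists_trajectory_of_chord hK hT (hK.mem_frontier 0)
    (hK.mem_frontier (f 0)) (hK.x_ne (hf 0).1 (hf 0).2.1)
  have htan := hC.posTangent_all hK hT hqp (σ := 1) (Or.inl rfl)
    (by rw [one_smul, hq0, hq1]; exact (hf 0).2.2)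
  simp only [one_smul] at htan
  obtain ⟨θ, β, -, hθ, hβ, hθβ⟩ := hqp.exists_lift hK hT hq0.symm
  have hgrow := f.abs_orbit_sub_le (lift_eq_chord_map hK hC.subset_interior hf hθ htan)
  -- By interlacing, `β m` and `θ m` differ by at most 2; used at n and at 0, and added to the bound
  -- 2 for the orbit θ, this gives 6.
  have hgrow' : ∀ n : ℤ, |β n - β 0 - n * f.translationNumber| ≤ 6 := fun n => by
    have h1 : ∀ m, |β m - θ m| ≤ 2 := fun m => by
      have a1 := hK.tangentAngle_spec (θ m)
      have a2 := hT.tangentAngle_spec (β m)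
      have a3 := hθβ m
      rw [abs_le]
      constructor <;> linarith
    have h2 := h1 n
    have h3 := h1 0
    have h4 := hgrow n
    rw [abs_le] at *
    constructor <;> linarith
  have htan' := (hdual q p hqp).1 fun n => Or.inl (htan n)
  have hpq := hqp.dual hK.symm
  rcases htan' 0 with h0 | h0
  · have hp := hC'.posTangent_all hT hK hpq (σ := 1) (Or.inl rfl) (by simpa using h0)
    simp only [one_smul] at hp
    have h1 := g.abs_orbit_sub_le (lift_eq_chord_map hT hC'.subset_interior hg hβ hp)
    have := eq_zero_of_abs_nat_mul_le (d := f.translationNumber - g.translationNumber) (B := 8)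
      fun n => by
        have a1 := h1 n
        have a2 := hgrow' n
        push_cast at a1 a2
        rw [abs_le] at *
        constructor <;> linarith
    linarith
  -- Negative tangency: the reversed dual trajectory is positively tangent to `C'`, so the rotation
  -- numbers add up to 1. Both are at most 1/2, hence equal.
  · have hp := hC'.posTangent_all hT hK hpq (σ := -1) (Or.inr rfl) (by simpa using h0)
    have hrev := hpq.reverse hK.symm
    obtain ⟨γ₀, hγ₀⟩ := hT.exists_param (hrev.q_mem 0)
    obtain ⟨γ, -, -, hγ, -, -⟩ := hrev.exists_lift hT hK hγ₀
    have h1 := g.abs_orbit_sub_le (lift_eq_chord_map hT hC'.subset_interior hg hγ fun n => by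
      have := (hp (-(n + 1))).flip (by norm_num)
      rw [neg_neg, one_smul, show -(n + 1) + 1 = -n by ring] at this
      exact this)
    have h2 := add_eq_one_of_reverse (a := β) (b := γ) (c := 0) (d := 0)
      (fun n => (hβ n).2) (fun n => (hγ n).2) (fun n => by
        rw [add_zero]
        refine hT.eq_add_int ?_
        rw [(hβ _).1, (hγ _).1]
        congr 1
        ring) hgrow' h1
    have h3 := rotation_le_half hK hT hC hf
    have h4 := rotation_le_half hT hK hC' hg
    linarith

/-! ### Support functions -/

section
variable {C : Set Plane}

theorem bddAbove_inner_image (hC : IsCompact C) (u : Plane) :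
    BddAbove ((fun x : Plane => inner ℝ x u) '' C) :=
  (hC.image (by fun_prop)).bddAbove

theorem inner_le_supportFn (hC : IsCompact C) {z : Plane} (hz : z ∈ C) (u : Plane) :
    inner ℝ z u ≤ supportFn C u :=
  le_csSup (bddAbove_inner_image hC u) (mem_image_of_mem _ hz)

theorem supportFn_le (hne : C.Nonempty) {u : Plane} {b : ℝ} (h : ∀ z ∈ C, inner ℝ z u ≤ b) :
    supportFn C u ≤ b :=
  csSup_le (hne.image _) (by rintro _ ⟨z, hz, rfl⟩; exact h z hz)

theorem exists_supportFn_eq (hC : IsCompact C) (hne : C.Nonempty) (u : Plane) :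
    ∃ z ∈ C, inner ℝ z u = supportFn C u := by
  obtain ⟨z, hz, h⟩ := hC.exists_sSup_image_eq hne
    (f := fun x : Plane => inner ℝ x u) (by fun_prop)
  exact ⟨z, hz, h.symm⟩

theorem continuous_supportFn (hC : IsCompact C) : Continuous (supportFn C) :=
  hC.continuous_sSup (f := fun u x : Plane => inner ℝ x u) (by
    change Continuous fun z : Plane × Plane => inner ℝ z.2 z.1
    fun_prop)

theorem supportFn_zero (hne : C.Nonempty) : supportFn C 0 = 0 := by
  simp [supportFn, hne.image_const]

theorem supportFn_mono (hC : IsCompact C) {D : Set Plane} (hne : D.Nonempty) (h : D ⊆ C)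
    (u : Plane) : supportFn D u ≤ supportFn C u :=
  supportFn_le hne fun _ hz => inner_le_supportFn hC (h hz) u

/-- In every direction the support function is attained at an extreme point. -/
theorem exists_extreme_supportFn_eq (hC : IsCompact C) (hne : C.Nonempty) (u : Plane) :
    ∃ z ∈ C.extremePoints ℝ, inner ℝ z u = supportFn C u := by
  set F := {z ∈ C | inner ℝ z u = supportFn C u} with hF
  have hFc : IsCompact F := by
    refine hC.inter_right ?_
    exact isClosed_eq (by fun_prop) continuous_const
  obtain ⟨z₀, hz₀, hz₀'⟩ := exists_supportFn_eq hC hne u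
  obtain ⟨z, hz⟩ := hFc.extremePoints_nonempty ⟨z₀, hz₀, hz₀'⟩
  refine ⟨z, ?_, hz.1.2⟩
  have hex : IsExtreme ℝ C F := by
    refine ⟨fun a ha => ha.1, fun a ha b hb c hc habc => ⟨ha, ?_⟩⟩
    obtain ⟨s, t, hs, ht, hst, rfl⟩ := habc
    have h1 := hc.2
    rw [inner_add_left, real_inner_smul_left, real_inner_smul_left] at h1
    have h2 := inner_le_supportFn hC ha u
    have h3 := inner_le_supportFn hC hb u
    refine le_antisymm h2 ?_
    have h4 : supportFn C u = s * supportFn C u + t * supportFn C u := by rw [← add_mul, hst, one_mul]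
    by_contra! h5
    nlinarith
  exact hex.extremePoints_subset_extremePoints hz

end

/-! ### The Cauchy–Crofton formula -/

/-- The mixed perimeter of the bodies `D` and `T`, where `w` is the derivative of a
parametrization of the boundary of `T`. -/
noncomputable def mixedPerimeter (D : Set Plane) (w : ℝ → Plane) : ℝ :=
  ∫ β in (0 : ℝ)..1, supportFn D (w β)

section
variable {T : Set Plane} {y w : ℝ → Plane}

theorem integral_inner_deriv (hT : IsBoundaryParam T y w) (z : Plane) (a b : ℝ) :
    ∫ β in a..b, inner ℝ z (w β) = inner ℝ z (y b) - inner ℝ z (y a) :=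
  intervalIntegral.integral_eq_sub_of_hasDerivAt
    (fun β _ => hasDerivAt_inner_const_left (hT.hasDerivAt β) z)
    ((continuous_const.inner hT.continuous_deriv).intervalIntegrable _ _)

theorem integral_periodic (hT : IsBoundaryParam T y w) (F : Plane → ℝ) (a : ℝ) :
    ∫ β in (0 : ℝ)..1, F (w β) = ∫ β in a..a + 1, F (w β) := by
  have hp : Function.Periodic (fun β => F (w β)) 1 := fun β => by
    simp only [hT.v_add_one]
  have := hp.intervalIntegral_add_eq 0 a
  rwa [zero_add] at this

theorem integral_comp_neg (hT : IsBoundaryParam T y w) (F : Plane → ℝ) :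
    ∫ β in (0 : ℝ)..1, F (-w β) = ∫ β in (0 : ℝ)..1, F (w β) := by
  simp only [← hT.v_add_half]
  rw [intervalIntegral.integral_comp_add_right (fun β => F (w β)), zero_add, add_comm,
    ← integral_periodic hT]

/-- Along the boundary of `T` the function ⟨z, ·⟩ falls from its maximum `h_T(z)` at `y b` to the
opposite minimum at `y (b + 1/2)` and rises back. Its total variation, the integral of |⟨z, w⟩|, is
therefore 4 `h_T(z)`. -/
theorem supportFn_eq_integral_abs (hT : IsBoundaryParam T y w) (z : Plane) :
    supportFn T z = (1 / 4) * ∫ β in (0 : ℝ)..1, |inner ℝ z (w β)| := by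
  rcases eq_or_ne z 0 with rfl | hz
  · simp [supportFn_zero ⟨0, hT.zero_mem'⟩]
  obtain ⟨s, hs⟩ := exists_atAngle hz
  obtain ⟨b, hb⟩ := hT.exists_tangentAngle_eq (s + 1 / 4)
  have hwb := (hT.tangentAngle_spec b).2.2
  rw [hb] at hwb
  obtain ⟨c, hc, hwc⟩ := hs.rot.same_ray hwb
  have hsup : supportFn T z = inner ℝ z (y b) := by
    refine le_antisymm (supportFn_le ⟨0, hT.zero_mem'⟩ fun u hu => ?_) ?_
    · have := hT.det2_left_nonneg b hu
      rw [hwc, det2_smul_left, det2_rot_left, inner_sub_right] at this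
      rw [real_inner_comm]
      by_contra! hlt
      nlinarith
    · rw [real_inner_comm]
      exact inner_le_supportFn hT.isCompact (hT.mem b) z
  have hcont : Continuous fun β => |inner ℝ z (w β)| :=
    (continuous_const.inner hT.continuous_deriv).abs
  have h1 : ∫ β in b..b + 1 / 2, |inner ℝ z (w β)| = 2 * inner ℝ z (y b) := by
    have : ∫ β in b..b + 1 / 2, |inner ℝ z (w β)| = ∫ β in b..b + 1 / 2, -inner ℝ z (w β) := by
      refine intervalIntegral.integral_congr fun β hβ => ?_
      rw [uIcc_of_le (by linarith)] at hβ
      have m1 := hT.strictMono_tangentAngle.monotone hβ.1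
      have m2 := hT.strictMono_tangentAngle.monotone hβ.2
      rw [hT.tangentAngle_add_half] at m2
      exact abs_of_nonpos (hs.inner_nonpos (hT.tangentAngle_spec β).2.2 (by linarith)
        (by linarith))
    rw [this, intervalIntegral.integral_neg, integral_inner_deriv hT, hT.x_add_half,
      inner_neg_right]
    ring
  have h2 : ∫ β in b + 1 / 2..b + 1, |inner ℝ z (w β)| = 2 * inner ℝ z (y b) := by
    have : ∫ β in b + 1 / 2..b + 1, |inner ℝ z (w β)| =
        ∫ β in b + 1 / 2..b + 1, inner ℝ z (w β) := by
      refine intervalIntegral.integral_congr fun β hβ => ?_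
      rw [uIcc_of_le (by linarith)] at hβ
      have m1 := hT.strictMono_tangentAngle.monotone hβ.1
      have m2 := hT.strictMono_tangentAngle.monotone hβ.2
      rw [hT.tangentAngle_add_half] at m1
      rw [hT.tangentAngle_add_one] at m2
      exact abs_of_nonneg (hs.add_one.inner_nonneg (hT.tangentAngle_spec β).2.2 (by linarith)
        (by linarith))
    rw [this, integral_inner_deriv hT, hT.x_add_half, hT.x_add_one, inner_neg_right]
    ring
  rw [integral_periodic hT (fun u => |inner ℝ z u|) b,
    ← intervalIntegral.integral_add_adjacent_intervals (b := b + 1 / 2)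
      (hcont.intervalIntegrable _ _) (hcont.intervalIntegrable _ _), h1, h2, hsup]
  ring

end

/-! ### Cyclic sequences -/

/-- A closed walk through two values covers the distance between them once in each direction. -/
theorem two_mul_abs_sub_le_sum_cyclic {n : ℕ} (a : Fin (n + 1) → ℝ) (k l : Fin (n + 1)) :
    2 * |a k - a l| ≤ ∑ i, |a (i + 1) - a i| := by
  wlog hlk : l ≤ k generalizing k l
  · rw [abs_sub_comm]
    exact this l k (le_of_not_ge hlk)
  set c : ℕ → ℝ := fun m => a (Fin.ofNat (n + 1) m) with hc
  have hck : ∀ i : Fin (n + 1), c i = a i := fun i => by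
    simp [hc]
  have hstep : ∀ i : Fin (n + 1), c ((i : ℕ) + 1) = a (i + 1) := fun i => by
    simp only [hc]
    congr 1
    ext
    simp [Fin.val_add]
  have hsum : ∑ i, |a (i + 1) - a i| = ∑ i ∈ Finset.range (n + 1), dist (c i) (c (i + 1)) := by
    rw [Finset.sum_range]
    refine Finset.sum_congr rfl fun i _ => ?_
    rw [hstep, hck, Real.dist_eq, abs_sub_comm]
  have h0 : c (n + 1) = c 0 := by
    simp only [hc]
    congr 1
    ext
    simp
  have hl : (l : ℕ) ≤ k := hlk
  have hk : (k : ℕ) ≤ n + 1 := k.2.le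
  have h1 := dist_le_Ico_sum_dist c hl
  have h2 := dist_le_Ico_sum_dist c hk
  have h3 := dist_le_Ico_sum_dist c (Nat.zero_le l)
  have e1 := Finset.sum_Ico_consecutive (fun i => dist (c i) (c (i + 1))) (Nat.zero_le (l : ℕ)) hl
  have e2 := Finset.sum_Ico_consecutive (fun i => dist (c i) (c (i + 1))) (Nat.zero_le (k : ℕ)) hk
  rw [hsum, Finset.range_eq_Ico, ← e2, ← e1]
  rw [h0] at h2
  have h4 := dist_triangle (c k) (c 0) (c l)
  rw [hck, hck] at *
  rw [dist_comm] at h1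
  rw [Real.dist_eq (a k) (a l)] at h1 h4
  linarith

/-- In a closed walk the total rise equals the total fall. The rising steps sweep disjoint intervals
inside [A, B], so the rise is at most B - A by comparing lengths. -/
theorem sum_abs_cyclic_le {n : ℕ} (a : Fin (n + 1) → ℝ) {A B : ℝ}
    (hA : ∀ i, A ≤ a i) (hB : ∀ i, a i ≤ B)
    (hdisj : ∀ i j, i ≠ j → Disjoint (Ioo (a i) (a (i + 1))) (Ioo (a j) (a (j + 1)))) :
    ∑ i, |a (i + 1) - a i| ≤ 2 * (B - A) := by
  have h0 : ∑ i, (a (i + 1) - a i) = 0 := by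
    rw [Finset.sum_sub_distrib, sub_eq_zero]
    exact Equiv.sum_comp (Equiv.addRight (1 : Fin (n + 1))) a
  have h1 : ∑ i, |a (i + 1) - a i| = 2 * ∑ i, max (a (i + 1) - a i) 0 := by
    have : ∀ i, |a (i + 1) - a i| = 2 * max (a (i + 1) - a i) 0 - (a (i + 1) - a i) := fun i => by
      rcases le_total 0 (a (i + 1) - a i) with h | h
      · rw [abs_of_nonneg h, max_eq_left h]; ring
      · rw [abs_of_nonpos h, max_eq_right h]; ring
    rw [Finset.sum_congr rfl fun i _ => this i, Finset.sum_sub_distrib, h0, sub_zero,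
      Finset.mul_sum]
  have hAB : A ≤ B := (hA 0).trans (hB 0)
  have h2 : ∑ i, ENNReal.ofReal (a (i + 1) - a i) ≤ ENNReal.ofReal (B - A) := by
    have := MeasureTheory.measure_biUnion_finset (μ := MeasureTheory.volume)
      (s := Finset.univ) (f := fun i => Ioo (a i) (a (i + 1)))
      (fun i _ j _ hij => hdisj i j hij) (fun i _ => measurableSet_Ioo)
    simp only [Real.volume_Ioo] at this
    rw [← this, ← Real.volume_Icc]
    refine MeasureTheory.measure_mono ?_
    refine iUnion₂_subset fun i _ t ht => ⟨(hA i).trans ht.1.le, ht.2.le.trans (hB _)⟩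
  rw [h1]
  refine mul_le_mul_of_nonneg_left ?_ zero_le_two
  rw [← ENNReal.ofReal_le_ofReal_iff (by linarith),
    ENNReal.ofReal_sum_of_nonneg fun i _ => le_max_right _ _]
  refine le_trans (le_of_eq (Finset.sum_congr rfl fun i _ => ?_)) h2
  rcases le_total 0 (a (i + 1) - a i) with h | h
  · rw [max_eq_left h]
  · rw [max_eq_right h, ENNReal.ofReal_zero, ENNReal.ofReal_of_nonpos h]

/-! ### Inscribed polygons -/

/-- A convex polygon crosses each level line of ⟨u, ·⟩ upwards at most once. The polygon lies to the
left of each edge, so of two ascending edges each would cross the level line on the left of the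
other. -/
theorem IsInscribedPolygon.disjoint {D : Set Plane} {n : ℕ} {x : Fin (n + 1) → Plane}
    (hx : IsInscribedPolygon D x) (u : Plane) {i j : Fin (n + 1)} (hij : i ≠ j) :
    Disjoint (Ioo (inner ℝ u (x i)) (inner ℝ u (x (i + 1))))
      (Ioo (inner ℝ u (x j)) (inner ℝ u (x (j + 1)))) := by
  rw [Set.disjoint_left]
  -- an edge that ascends through the level `t` lies to one side of the other one
  have key : ∀ i j, i ≠ j → ∀ t, t ∈ Ioo (inner ℝ u (x i)) (inner ℝ u (x (i + 1))) →
      t ∈ Ioo (inner ℝ u (x j)) (inner ℝ u (x (j + 1))) → ∀ r s : ℝ, 0 < s → s < 1 →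
      inner ℝ u (x i + r • (x (i + 1) - x i)) = t → inner ℝ u (x j + s • (x (j + 1) - x j)) = t →
      0 < det2 u ((x j + s • (x (j + 1) - x j)) - (x i + r • (x (i + 1) - x i))) := by
    intro i j hij t hti htj r s hs0 hs1 hr hs
    have hnn : ∀ k, 0 ≤ det2 (x (i + 1) - x i) (x k - x i) := fun k => by
      by_cases h1 : k = i
      · rw [h1, sub_self, det2_zero_right]
      by_cases h2 : k = i + 1
      · rw [h2, det2_self]
      exact (hx.2 i k h1 h2).le
    have hpos : 0 < det2 (x (i + 1) - x i) (x j + s • (x (j + 1) - x j) - x i) := by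
      have e : x j + s • (x (j + 1) - x j) - x i = (1 - s) • (x j - x i) +
        s • (x (j + 1) - x i) := by module
      rw [e, det2_add_right, det2_smul_right, det2_smul_right]
      have h1s : 0 < 1 - s := by linarith
      by_cases h1 : j = i + 1
      -- Two-gon case: the edge `j` would be the edge `i` run backwards, and they cannot both
      -- ascend.
      · have h2 : j + 1 ≠ i := by
          intro h2
          rw [h2, h1] at htj
          exact lt_asymm (htj.1.trans htj.2) (hti.1.trans hti.2)
        have h3 : j + 1 ≠ i + 1 := fun h3 => hij (add_right_cancel h3).symm
        have := mul_pos hs0 (hx.2 i (j + 1) h2 h3)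
        nlinarith [hnn j]
      · have := mul_pos h1s (hx.2 i j hij.symm h1)
        nlinarith [hnn (j + 1)]
    set e := x (i + 1) - x i with he
    set z := x j + s • (x (j + 1) - x j) - (x i + r • e) with hz
    have hzd : 0 < det2 e z := by
      have : z = x j + s • (x (j + 1) - x j) - x i - r • e := by rw [hz]; abel
      rwa [this, det2_sub_right, det2_smul_right, det2_self, mul_zero, sub_zero]
    have hzu : inner ℝ u z = 0 := by rw [hz, inner_sub_right, hs, hr, sub_self]
    have heu : 0 < inner ℝ u e := by
      rw [he, inner_sub_right]
      linarith [hti.1.trans hti.2]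
    have id : det2 e z * (u 0 ^ 2 + u 1 ^ 2) =
        inner ℝ u e * det2 u z - det2 u e * inner ℝ u z := by
      simp only [det2, inner_plane]; ring
    rw [hzu, mul_zero, sub_zero] at id
    have hu0 : u ≠ 0 := by
      rintro rfl
      simp at heu
    have := mul_pos hzd (plane_ne_zero hu0)
    rw [id] at this
    exact pos_of_mul_pos_right this heu.le
  intro t hti htj
  have hpar : ∀ i, t ∈ Ioo (inner ℝ u (x i)) (inner ℝ u (x (i + 1))) → ∃ r : ℝ, 0 < r ∧ r < 1 ∧
      inner ℝ u (x i + r • (x (i + 1) - x i)) = t := fun i hti => by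
    have hd : 0 < inner ℝ u (x (i + 1)) - inner ℝ u (x i) := by linarith [hti.1, hti.2]
    refine ⟨(t - inner ℝ u (x i)) / (inner ℝ u (x (i + 1)) - inner ℝ u (x i)),
      div_pos (by linarith [hti.1]) hd, by rw [div_lt_one hd]; linarith [hti.2], ?_⟩
    rw [inner_add_right, real_inner_smul_right, inner_sub_right, div_mul_cancel₀ _ hd.ne']
    ring
  obtain ⟨r, hr0, hr1, hr⟩ := hpar i hti
  obtain ⟨s, hs0, hs1, hs⟩ := hpar j htj
  have h1 := key i j hij t hti htj r s hs0 hs1 hr hs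
  have h2 := key j i hij.symm t htj hti s r hr0 hr1 hs hr
  rw [← neg_sub, det2_neg_right] at h2
  linarith

section
variable {T D : Set Plane} {y w : ℝ → Plane}

theorem continuous_supportFn_comp (hT : IsBoundaryParam T y w) (hD : IsCompact D) :
    Continuous fun β => supportFn D (w β) :=
  (continuous_supportFn hD).comp hT.continuous_deriv

theorem sum_supportFn_eq (hT : IsBoundaryParam T y w) {n : ℕ} (x : Fin (n + 1) → Plane) :
    ∑ i, supportFn T (x (i + 1) - x i) =
      (1 / 4) * ∫ β in (0 : ℝ)..1, ∑ i, |inner ℝ (w β) (x (i + 1)) - inner ℝ (w β) (x i)| := by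
  rw [intervalIntegral.integral_finsetSum, Finset.mul_sum]
  · refine Finset.sum_congr rfl fun i _ => ?_
    rw [supportFn_eq_integral_abs hT]
    simp only [← inner_sub_right, real_inner_comm]
  · intro i _
    refine Continuous.intervalIntegrable ?_ _ _
    exact ((hT.continuous_deriv.inner continuous_const).sub
      (hT.continuous_deriv.inner continuous_const)).abs

theorem integral_width (hT : IsBoundaryParam T y w) (hD : IsCompact D) :
    ∫ β in (0 : ℝ)..1, (supportFn D (w β) + supportFn D (-w β)) = 2 * mixedPerimeter D w := by
  have h : Continuous fun β => supportFn D (-w β) :=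
    (continuous_supportFn hD).comp hT.continuous_deriv.neg
  rw [intervalIntegral.integral_add ((continuous_supportFn_comp hT hD).intervalIntegrable _ _)
    (h.intervalIntegrable _ _),
    integral_comp_neg hT (supportFn D), mixedPerimeter]
  ring

/-- The length is a quarter of the integral of the variation of ⟨w, ·⟩ around the polygon, which is
at most twice the width of `D`; and the width integrates to twice the mixed perimeter. -/
theorem IsInscribedPolygon.length_le (hT : IsBoundaryParam T y w) (hD : IsCompact D) {n : ℕ}
    {x : Fin (n + 1) → Plane} (hx : IsInscribedPolygon D x) :
    ∑ i, supportFn T (x (i + 1) - x i) ≤ mixedPerimeter D w := by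
  have hw := hT.continuous_deriv
  have h1 : ∫ β in (0 : ℝ)..1, ∑ i, |inner ℝ (w β) (x (i + 1)) - inner ℝ (w β) (x i)| ≤
      ∫ β in (0 : ℝ)..1, 2 * (supportFn D (w β) + supportFn D (-w β)) := by
    refine intervalIntegral.integral_mono_on zero_le_one ?_ ?_ fun β _ => ?_
    · refine Continuous.intervalIntegrable ?_ _ _
      fun_prop
    · refine Continuous.intervalIntegrable ?_ _ _
      exact ((continuous_supportFn_comp hT hD).add
        ((continuous_supportFn hD).comp hT.continuous_deriv.neg)).const_mul 2
    · have := sum_abs_cyclic_le (fun i => inner ℝ (w β) (x i)) (A := -supportFn D (-w β))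
        (B := supportFn D (w β)) (fun i => by
          have := inner_le_supportFn hD (hD.isClosed.frontier_subset (hx.1 i)) (-w β)
          rw [inner_neg_right, real_inner_comm] at this
          linarith) (fun i => by
          rw [real_inner_comm]
          exact inner_le_supportFn hD (hD.isClosed.frontier_subset (hx.1 i)) (w β))
        (fun i j hij => hx.disjoint (w β) hij)
      simpa only [sub_neg_eq_add] using this
  rw [intervalIntegral.integral_const_mul, integral_width hT hD] at h1
  rw [sum_supportFn_eq hT]
  linarith

end

/-- A finite set of extreme points of a planar convex body can be listed as the vertices of an
inscribed polygon. -/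
theorem exists_isInscribedPolygon {D : Set Plane} (hD : Convex ℝ D) {o : Plane}
    (ho : o ∈ interior D) {F : Set Plane} (hF : F.Finite) (hne : F.Nonempty)
    (hFD : F ⊆ D.extremePoints ℝ) :
    ∃ (n : ℕ) (x : Fin (n + 1) → Plane), IsInscribedPolygon D x ∧ F = range x := by
  have hoD : o ∈ D := interior_subset ho
  have hfr : ∀ f ∈ D.extremePoints ℝ, f ∈ frontier D := fun f hf =>
    ⟨subset_closure hf.1, fun h => (disjoint_interior_extremePoints D).notMem_of_mem_left h hf⟩
  have hfo : ∀ f ∈ D.extremePoints ℝ, f - o ≠ 0 := fun f hf h => by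
    rw [sub_eq_zero.1 h] at hf
    exact (hfr o hf).2 ho
  -- the body translated to the origin
  set D' := {z : Plane | z + o ∈ D} with hD'
  have hD'c : Convex ℝ D' := by
    intro a ha b hb s t hs ht hst
    have := hD ha hb hs ht hst
    simp only [hD', mem_ofPred_eq]
    convert this using 1
    rw [smul_add, smul_add, add_add_add_comm, ← add_smul, hst, one_smul]
  have hD'0 : (0 : Plane) ∈ D' := by simpa [hD'] using hoD
  have hext : ∀ f ∈ D.extremePoints ℝ, f - o ∈ D'.extremePoints ℝ := fun f hf => by
    rw [mem_extremePoints] at hf ⊢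
    refine ⟨by simpa [hD'] using hf.1, fun a ha b hb hab => ?_⟩
    obtain ⟨s, t, hs, ht, hst, e⟩ := hab
    have := hf.2 (a + o) ha (b + o) hb ⟨s, t, hs, ht, hst, by
      rw [smul_add, smul_add, add_add_add_comm, ← add_smul, hst, one_smul, e, sub_add_cancel]⟩
    exact ⟨eq_sub_of_add_eq this.1, eq_sub_of_add_eq this.2⟩
  choose! ang h0 h1 hang using fun f hf => exists_atAngle_Ico (hfo f hf) 0
  simp only [zero_add] at h1
  -- Of two distinct extreme points on one ray from the interior point `o`, the nearer would be
  -- inside the segment from `o` to the farther.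
  have hinj : ∀ f ∈ D.extremePoints ℝ, ∀ g ∈ D.extremePoints ℝ, ang f = ang g → f = g := by
    have key : ∀ f ∈ D.extremePoints ℝ, ∀ g ∈ D.extremePoints ℝ, ∀ c : ℝ, 0 < c →
        g - o = c • (f - o) → 1 ≤ c := fun f hf g hg c hc hgc => by
      by_contra! hlt
      have := ((mem_extremePoints.1 hg).2 o hoD f hf.1 ⟨1 - c, c, by linarith, hc, by ring, by
        rw [← sub_add_cancel g o, hgc]; module⟩).1
      exact hfo g hg (by rw [this, sub_self])
    intro f hf g hg hfg
    obtain ⟨c, hc, e⟩ := (hang f hf).same_ray (hfg ▸ hang g hg)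
    have c1 := key f hf g hg c hc e
    have c2 := key g hg f hf c⁻¹ (inv_pos.2 hc) (by
      rw [e, smul_smul, inv_mul_cancel₀ hc.ne', one_smul])
    have c3 : c = 1 := le_antisymm ((one_le_inv₀ hc).1 c2) c1
    rw [c3, one_smul, sub_left_inj] at e
    exact e.symm
  -- sort by the angle
  set S : Finset ℝ := hF.toFinset.image ang with hS
  have hSne : S.Nonempty := by
    obtain ⟨f, hf⟩ := hne
    exact ⟨ang f, Finset.mem_image_of_mem _ (hF.mem_toFinset.2 hf)⟩
  obtain ⟨n, hn⟩ : ∃ n, S.card = n + 1 := ⟨S.card - 1, by have := hSne.card_pos; omega⟩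
  set t := S.orderEmbOfFin hn with ht
  have hx : ∀ i, ∃ f ∈ F, ang f = t i := fun i => by
    have := S.orderEmbOfFin_mem hn i
    obtain ⟨f, hf, e⟩ := Finset.mem_image.1 this
    exact ⟨f, hF.mem_toFinset.1 hf, e⟩
  choose x hxF hxt using hx
  have hxe : ∀ i, x i ∈ D.extremePoints ℝ := fun i => hFD (hxF i)
  have hxa : ∀ i, AtAngle (t i) (x i - o) := fun i => hxt i ▸ hang _ (hxe i)
  have ht0 : ∀ i, 0 ≤ t i := fun i => hxt i ▸ h0 _ (hxe i)
  have ht1 : ∀ i, t i < 1 := fun i => hxt i ▸ h1 _ (hxe i)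
  have htm : StrictMono t := t.strictMono
  have hdet : ∀ i j k (a b c : ℝ), AtAngle a (x i - o) → AtAngle b (x j - o) →
      AtAngle c (x k - o) → a < b → b < c → c < a + 1 → 0 < det2 (x j - x i) (x k - x i) := by
    intro i j k a b c ha hb hc hab hbc hca
    have := det2_pos_of_extreme hD'c hD'0 (hext _ (hxe i)) (hext _ (hxe j)) (hext _ (hxe k))
      ha hb hc hab hbc hca
    rwa [sub_sub_sub_cancel_right, sub_sub_sub_cancel_right] at this
  refine ⟨n, x, ⟨fun i => hfr _ (hxe i), fun i j hji hji' => ?_⟩, ?_⟩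
  -- The closing edge returns to vertex 0 through the angle 1. Vertices listed before the starting
  -- vertex of an edge get their angle raised by one turn.
  · rcases eq_or_ne i (Fin.last n) with rfl | hi
    · rw [Fin.last_add_one] at hji' ⊢
      have hj : j < Fin.last n := lt_of_le_of_ne (Fin.le_last j) hji
      have hj0 : 0 < j := Fin.pos_iff_ne_zero.2 hji'
      exact hdet _ _ _ _ _ _ (hxa _) (hxa 0).add_one (hxa j).add_one
        (by linarith [ht1 (Fin.last n), ht0 0]) (by linarith [htm hj0]) (by linarith [htm hj])
    · have hi' : i < i + 1 := by
        rw [Fin.lt_add_one_iff]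
        exact lt_of_le_of_ne (Fin.le_last i) hi
      rcases lt_or_gt_of_ne hji with hlt | hlt
      · exact hdet _ _ _ _ _ _ (hxa _) (hxa _) (hxa j).add_one (htm hi')
          (by linarith [ht1 (i + 1), ht0 j]) (by linarith [htm hlt])
      · have hlt' : i + 1 < j := by
          refine lt_of_le_of_ne ?_ hji'.symm
          have hv : ((i + 1 : Fin (n + 1)) : ℕ) = i + 1 := Fin.val_add_one_of_lt
            (lt_of_le_of_ne (Fin.le_last i) hi)
          rw [Fin.le_def, hv]
          exact hlt
        exact hdet _ _ _ _ _ _ (hxa _) (hxa _) (hxa j) (htm hi') (htm hlt')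
          (by linarith [ht1 j, ht0 i])
  · refine Subset.antisymm (fun f hf => ?_) (range_subset_iff.2 hxF)
    have : ang f ∈ S := Finset.mem_image_of_mem _ (hF.mem_toFinset.2 hf)
    have hr : ang f ∈ range t := by
      rw [ht, Finset.range_orderEmbOfFin]
      exact this
    obtain ⟨i, hi⟩ := hr
    exact ⟨i, hinj _ (hxe i) _ (hFD hf) ((hxt i).trans hi)⟩

section
variable {T D : Set Plane} {y w : ℝ → Plane}

/-- Support values are attained at extreme points, so a finite δ-net of extreme points loses at most
δ‖w‖ in each direction. With W bounding ‖w‖, the loss in length is at most δW, which the choice of δ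
makes smaller than ε. -/
theorem exists_polygon_length_gt (hT : IsBoundaryParam T y w) (hD : IsCompact D)
    (hc : Convex ℝ D) (hi : (interior D).Nonempty) {ε : ℝ} (hε : 0 < ε) :
    ∃ (n : ℕ) (x : Fin (n + 1) → Plane), IsInscribedPolygon D x ∧
      mixedPerimeter D w - ε < ∑ i, supportFn T (x (i + 1) - x i) := by
  obtain ⟨o, ho⟩ := hi
  have hDne : D.Nonempty := ⟨o, interior_subset ho⟩
  obtain ⟨W, hW⟩ := isCompact_Icc.exists_bound_of_continuousOn
    (s := Icc (0 : ℝ) 1) hT.continuous_deriv.continuousOn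
  have hW0 : 0 ≤ W := (norm_nonneg _).trans (hW 0 (by simp))
  set δ := ε / (W + 1) with hδ
  have hδ0 : 0 < δ := div_pos hε (by linarith)
  have hδW : δ * W < ε := by
    rw [hδ, div_mul_eq_mul_div, div_lt_iff₀ (by linarith)]
    nlinarith
  obtain ⟨F, hFD, hFf, hcov⟩ := Metric.finite_approx_of_totallyBounded
    (hD.totallyBounded.subset (extremePoints_subset (𝕜 := ℝ))) δ hδ0
  have hFne : F.Nonempty := by
    obtain ⟨e, he⟩ := hD.extremePoints_nonempty hDne
    obtain ⟨f, hf, -⟩ := mem_iUnion₂.1 (hcov he)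
    exact ⟨f, hf⟩
  obtain ⟨n, x, hx, hFx⟩ := exists_isInscribedPolygon hc ho hFf hFne hFD
  have happ : ∀ u : Plane, ∃ i, supportFn D u - δ * ‖u‖ ≤ inner ℝ u (x i) := fun u => by
    obtain ⟨e, he, heu⟩ := exists_extreme_supportFn_eq hD hDne u
    obtain ⟨f, hf, hef⟩ := mem_iUnion₂.1 (hcov he)
    rw [hFx] at hf
    obtain ⟨i, rfl⟩ := hf
    refine ⟨i, ?_⟩
    have h1 := real_inner_le_norm (e - x i) u
    rw [inner_sub_left, heu] at h1
    have h2 : ‖e - x i‖ ≤ δ := by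
      rw [← dist_eq_norm]
      exact (Metric.mem_ball.1 hef).le
    have h3 := mul_le_mul_of_nonneg_right h2 (norm_nonneg u)
    rw [real_inner_comm u (x i)] at h1
    linarith
  refine ⟨n, x, hx, ?_⟩
  have hw := hT.continuous_deriv
  have hwid : Continuous fun β => 2 * (supportFn D (w β) + supportFn D (-w β)) :=
    ((continuous_supportFn_comp hT hD).add ((continuous_supportFn hD).comp hw.neg)).const_mul 2
  have h1 : ∫ β in (0 : ℝ)..1, (2 * (supportFn D (w β) + supportFn D (-w β)) - 4 * (δ * W)) ≤
      ∫ β in (0 : ℝ)..1, ∑ i, |inner ℝ (w β) (x (i + 1)) - inner ℝ (w β) (x i)| := by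
    refine intervalIntegral.integral_mono_on zero_le_one ?_ ?_ fun β hβ => ?_
    · exact (hwid.sub continuous_const).intervalIntegrable _ _
    · refine Continuous.intervalIntegrable ?_ _ _
      fun_prop
    · obtain ⟨i, hi⟩ := happ (w β)
      obtain ⟨j, hj⟩ := happ (-w β)
      have h2 := two_mul_abs_sub_le_sum_cyclic (fun i => inner ℝ (w β) (x i)) i j
      refine le_trans ?_ h2
      have h3 := le_abs_self (inner ℝ (w β) (x i) - inner ℝ (w β) (x j))
      have h4 := mul_le_mul_of_nonneg_left (hW β hβ) hδ0.le
      rw [inner_neg_left, norm_neg] at hj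
      linarith
  rw [intervalIntegral.integral_sub (hwid.intervalIntegrable _ _)
    (continuous_const.intervalIntegrable _ _), intervalIntegral.integral_const_mul,
    integral_width hT hD, intervalIntegral.integral_const] at h1
  rw [sum_supportFn_eq hT]
  simp only [sub_zero, one_smul] at h1
  linarith

/-- The perimeter as a mixed area. -/
theorem perimeter_eq (hT : IsBoundaryParam T y w) (hD : IsCompact D)
    (hc : Convex ℝ D) (hi : (interior D).Nonempty) : perimeter T D = mixedPerimeter D w := by
  refine csSup_eq_of_forall_le_of_forall_lt_exists_gt ?_ ?_ ?_
  · obtain ⟨n, x, hx, -⟩ := exists_polygon_length_gt hT hD hc hi one_pos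
    exact ⟨_, n, x, hx, rfl⟩
  · rintro _ ⟨n, x, hx, rfl⟩
    exact hx.length_le hT hD
  · intro l hl
    obtain ⟨n, x, hx, h⟩ := exists_polygon_length_gt hT hD hc hi (sub_pos.2 hl)
    exact ⟨_, ⟨n, x, hx, rfl⟩, by linarith⟩

end

/-! ### The arc of the string that is not supported by the caustic -/

theorem not_interior_of_inner_const {C : Set Plane} {u : Plane} {r : ℝ} (hu : u ≠ 0)
    (h : ∀ c ∈ C, inner ℝ c u = r) : ¬ (interior C).Nonempty := by
  rintro ⟨o, ho⟩
  have hcont : ContinuousAt (fun t : ℝ => o + t • u) 0 := by fun_prop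
  have : ∀ᶠ t : ℝ in 𝓝[≠] 0, o + t • u ∈ interior C :=
    (hcont.eventually (by simpa using isOpen_interior.mem_nhds ho)).filter_mono nhdsWithin_le_nhds
  obtain ⟨t, ht, ht0⟩ := (this.and self_mem_nhdsWithin).exists
  have h1 := h _ (interior_subset ht)
  rw [inner_add_left, h _ (interior_subset ho), real_inner_smul_left, add_eq_left] at h1
  exact mul_ne_zero ht0 (inner_self_ne_zero.2 hu) h1

section
variable {T C : Set Plane} {y w : ℝ → Plane}

/-- If the lines through `z` with the directions `rot (w b)` and `rot (w b')` are the tangent lines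
from `z` to the body `C`, then `z` beats `C` exactly in the directions between `w b` and `w b'`. -/
theorem visible_arc (hT : IsBoundaryParam T y w) (hC : IsCompact C) (hi : (interior C).Nonempty)
    {z : Plane} {b b' s s' : ℝ} (h1 : b < b') (h2 : b' < b + 1) (hs : 0 < s) (hs' : 0 < s')
    (hz : z - s • rot (w b) ∈ C) (hz' : z + s' • rot (w b') ∈ C)
    (hb : ∀ c ∈ C, inner ℝ c (w b) ≤ inner ℝ z (w b))
    (hb' : ∀ c ∈ C, inner ℝ c (w b') ≤ inner ℝ z (w b')) :
    (∀ β, b ≤ β → β ≤ b' → supportFn C (w β) ≤ inner ℝ z (w β)) ∧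
      ∀ β, b' ≤ β → β ≤ b + 1 → inner ℝ z (w β) ≤ supportFn C (w β) := by
  have hm := hT.strictMono_tangentAngle
  have m1 := hm h1
  have m2 := hm h2
  rw [hT.tangentAngle_add_one] at m2
  have ab := (hT.tangentAngle_spec b).2.2
  have ab' := (hT.tangentAngle_spec b').2.2
  have hne : C.Nonempty := hi.mono interior_subset
  have hdet : 0 ≤ det2 (w b) (w b') := by
    have := hb' _ hz
    rw [inner_sub_left, real_inner_smul_left, inner_rot_left] at this
    by_contra! hlt
    nlinarith
  -- Antiparallel tangents would squeeze `C` into a line; beyond half a turn the determinant has the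
  -- wrong sign.
  have m3 : tangentAngle w b' < tangentAngle w b + 1 / 2 := by
    by_contra! hge
    rcases hge.eq_or_lt with heq | hlt
    · have := ab.neg
      rw [heq] at this
      obtain ⟨k, hk, e⟩ := this.same_ray ab'
      refine not_interior_of_inner_const (r := inner ℝ z (w b)) (hT.v_ne_zero b)
        (fun c hc => le_antisymm (hb c hc) ?_) hi
      have := hb' c hc
      rw [e, real_inner_smul_right, real_inner_smul_right, inner_neg_right, inner_neg_right] at this
      have := le_of_mul_le_mul_left this hk
      linarith
    · exact (ab.det2_neg ab' hlt (by linarith)).not_ge hdet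
  constructor
  · intro β hβ hβ'
    have n1 := hm.monotone hβ
    have n2 := hm.monotone hβ'
    have aβ := (hT.tangentAngle_spec β).2.2
    have d1 := ab.det2_nonneg aβ n1 (by linarith)
    have d2 := aβ.det2_nonneg ab' n2 (by linarith)
    have d3 := ab.det2_pos ab' m1 m3
    refine supportFn_le hne fun c hc => ?_
    -- `w β` is a non-negative combination of `w b` and `w b'`, the two directions in which `z` is
    -- known to beat `C`.
    have id : (inner ℝ z (w β) - inner ℝ c (w β)) * det2 (w b) (w b') =
        det2 (w β) (w b') * (inner ℝ z (w b) - inner ℝ c (w b)) +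
          det2 (w b) (w β) * (inner ℝ z (w b') - inner ℝ c (w b')) := by
      simp only [det2, inner_plane]; ring
    have e1 := mul_nonneg d2 (sub_nonneg.2 (hb c hc))
    have e2 := mul_nonneg d1 (sub_nonneg.2 (hb' c hc))
    have := nonneg_of_mul_nonneg_left (id ▸ add_nonneg e1 e2) d3
    linarith
  · intro β hβ hβ'
    have n1 := hm.monotone hβ
    have n2 := hm.monotone hβ'
    rw [hT.tangentAngle_add_one] at n2
    have aβ := (hT.tangentAngle_spec β).2.2
    -- On the complementary arc a contact point is at least as good as `z`: the one on the second
    -- tangent until half a turn after `w b`, the one on the first tangent from there on.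
    rcases le_total (tangentAngle w b + 1 / 2) (tangentAngle w β) with hle | hle
    · have d1 := ab.det2_nonpos aβ hle n2
      refine le_trans ?_ (inner_le_supportFn hC hz (w β))
      rw [inner_sub_left, real_inner_smul_left, inner_rot_left]
      nlinarith
    · have d1 := ab'.det2_nonneg aβ n1 (by linarith)
      refine le_trans ?_ (inner_le_supportFn hC hz' (w β))
      rw [inner_add_left, real_inner_smul_left, inner_rot_left]
      nlinarith

end

/-! ### Orbits that are positively tangent to a caustic -/

/-- `θ` and `β` are lifts of the positions and of the momenta of a trajectory all of whose links
are positively tangent to `C`. -/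
structure IsTangentOrbit (K T C : Set Plane) (x v y w : ℝ → Plane) (θ β : ℤ → ℝ) : Prop where
  trajectory : IsBilliardTrajectory K T (fun n => x (θ n)) (fun n => y (β n))
  tangent : ∀ n, IsPosTangent C (x (θ n)) (x (θ (n + 1)) - x (θ n))
  position_lt : ∀ n, θ n < θ (n + 1)
  position_lt' : ∀ n, θ (n + 1) < θ n + 1
  momentum_lt : ∀ n, β n < β (n + 1)
  momentum_lt' : ∀ n, β (n + 1) < β n + 1
  angle : ∀ n, tangentAngle v (θ n) < tangentAngle w (β n) + 1 / 4 ∧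
    tangentAngle w (β n) + 1 / 4 < tangentAngle v (θ n) + 1 / 2 ∧
    tangentAngle v (θ (n + 1)) - 1 / 2 < tangentAngle w (β n) + 1 / 4 ∧
    tangentAngle w (β n) + 1 / 4 < tangentAngle v (θ (n + 1))

section
variable {K T C : Set Plane} {x v y w : ℝ → Plane}

theorem exists_isTangentOrbit (hK : IsBoundaryParam K x v) (hT : IsBoundaryParam T y w)
    (hC : IsConvexCaustic K T C) (θ₀ : ℝ) :
    ∃ θ β, IsTangentOrbit K T C x v y w θ β ∧ θ 0 = θ₀ := by
  obtain ⟨s, hs1, hs2, hs⟩ := exists_tangent_chord hK hC.isCompact hC.convex hC.nonempty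
    hC.subset_interior θ₀ (σ := 1) (Or.inl rfl)
  obtain ⟨q, p, hqp, hq0, hq1⟩ := exists_trajectory_of_chord hK hT (hK.mem_frontier θ₀)
    (hK.mem_frontier s) (hK.x_ne hs1 hs2)
  have htan := hC.posTangent_all hK hT hqp (σ := 1) (Or.inl rfl) (by rwa [hq0, hq1])
  simp only [one_smul] at htan
  obtain ⟨θ, β, h0, hθ, hβ, ha⟩ := hqp.exists_lift hK hT hq0.symm
  have e1 : (fun n => x (θ n)) = q := funext fun n => (hθ n).1
  have e2 : (fun n => y (β n)) = p := funext fun n => (hβ n).1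
  refine ⟨θ, β, ⟨by rwa [e1, e2], fun n => ?_, fun n => (hθ n).2.1, fun n => (hθ n).2.2,
    fun n => (hβ n).2.1, fun n => (hβ n).2.2, ha⟩, h0⟩
  rw [(hθ n).1, (hθ (n + 1)).1]
  exact htan n

namespace IsTangentOrbit
variable {θ β : ℤ → ℝ}

theorem shift (h : IsTangentOrbit K T C x v y w θ β) (k : ℤ) :
    IsTangentOrbit K T C x v y w (fun n => θ (n + k)) (fun n => β (n + k)) := by
  have e : ∀ n : ℤ, n + 1 + k = n + k + 1 := fun n => by ring
  refine ⟨h.trajectory.shift k, fun n => ?_, fun n => ?_, fun n => ?_, fun n => ?_, fun n => ?_,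
    fun n => ?_⟩ <;> simp only [e]
  exacts [h.tangent _, h.position_lt _, h.position_lt' _, h.momentum_lt _, h.momentum_lt' _,
    h.angle _]

theorem add_one (hK : IsBoundaryParam K x v) (hT : IsBoundaryParam T y w)
    (h : IsTangentOrbit K T C x v y w θ β) :
    IsTangentOrbit K T C x v y w (fun n => θ n + 1) (fun n => β n + 1) := by
  refine ⟨?_, fun n => ?_, fun n => ?_, fun n => ?_, fun n => ?_, fun n => ?_, fun n => ?_⟩
  · simpa only [hK.x_add_one, hT.x_add_one] using h.trajectory
  · simpa only [hK.x_add_one] using h.tangent n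
  · linarith [h.position_lt n]
  · linarith [h.position_lt' n]
  · linarith [h.momentum_lt n]
  · linarith [h.momentum_lt' n]
  · have := h.angle n
    simp only [hK.tangentAngle_add_one, hT.tangentAngle_add_one]
    refine ⟨?_, ?_, ?_, ?_⟩ <;> linarith

/-- The links arriving at and leaving `x (θ (n + 1))` lie on the two tangents from this point to
`C`, with directions `rot (w (β n))` and `rot (w (β (n + 1)))`; this is the situation of
`visible_arc`. -/
theorem visible (hK : IsBoundaryParam K x v) (hT : IsBoundaryParam T y w)
    (hCK : C ⊆ interior K) (hC : IsCompact C) (hi : (interior C).Nonempty)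
    (h : IsTangentOrbit K T C x v y w θ β) (n : ℤ) :
    (∀ b, β n ≤ b → b ≤ β (n + 1) → supportFn C (w b) ≤ inner ℝ (x (θ (n + 1))) (w b)) ∧
      ∀ b, β (n + 1) ≤ b → b ≤ β n + 1 → inner ℝ (x (θ (n + 1))) (w b) ≤ supportFn C (w b) := by
  have key : ∀ m, ∃ c t : ℝ, 0 < c ∧ 0 < t ∧ t < 1 ∧
      x (θ (m + 1)) - x (θ m) = c • rot (w (β m)) ∧
      x (θ m) + t • c • rot (w (β m)) ∈ C ∧
      ∀ z ∈ C, inner ℝ z (w (β m)) ≤ inner ℝ (x (θ m)) (w (β m)) := fun m => by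
    obtain ⟨c, hc, e⟩ := h.trajectory.q_step hT m rfl
    have htan := h.tangent m
    obtain ⟨t, ht0, ht1, ht⟩ := tangent_chord_contact hK hCK (hK.mem_frontier _)
      (hK.mem_frontier _) (σ := 1) (by rwa [one_smul])
    rw [e] at ht htan
    refine ⟨c, t, hc, ht0, ht1, e, ht, fun z hz => ?_⟩
    have := htan.2 z hz
    rw [det2_smul_left, det2_rot_left, inner_sub_right, real_inner_comm,
      real_inner_comm (x _)] at this
    have := nonneg_of_mul_nonneg_right this hc
    linarith
  obtain ⟨c, t, hc, ht0, ht1, e, hz, hb⟩ := key n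
  obtain ⟨c', t', hc', ht0', ht1', e', hz', hb'⟩ := key (n + 1)
  refine visible_arc hT hC hi (s := (1 - t) * c) (s' := t' * c') (h.momentum_lt n)
    (h.momentum_lt' n) (mul_pos (by linarith) hc) (mul_pos ht0' hc') ?_ ?_ (fun z hz => ?_) hb'
  · convert hz using 1
    rw [← sub_add_cancel (x (θ (n + 1))) (x (θ n)), e]
    module
  · rwa [mul_smul]
  · refine (hb z hz).trans (le_of_eq ?_)
    rw [← sub_add_cancel (x (θ (n + 1))) (x (θ n)), e, inner_add_left, real_inner_smul_left,
      inner_rot_left, det2_self]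
    ring

theorem inner_deriv_eq_zero (hK : IsBoundaryParam K x v)
    (h : IsTangentOrbit K T C x v y w θ β) (n : ℤ) :
    inner ℝ (v (θ (n + 1))) (y (β (n + 1)) - y (β n)) = 0 := by
  obtain ⟨c, hc, e⟩ := h.trajectory.p_step hK n rfl
  rw [e, inner_neg_right, real_inner_smul_right, inner_rot_right, det2_self]
  ring

theorem supportFn_eq_right (hK : IsBoundaryParam K x v) (hT : IsBoundaryParam T y w)
    (hCK : C ⊆ interior K) (hC : IsCompact C) (hi : (interior C).Nonempty)
    (h : IsTangentOrbit K T C x v y w θ β) (n : ℤ) :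
    supportFn C (w (β (n + 1))) = inner ℝ (x (θ (n + 1))) (w (β (n + 1))) :=
  le_antisymm ((h.visible hK hT hCK hC hi n).1 _ (h.momentum_lt n).le le_rfl)
    ((h.visible hK hT hCK hC hi n).2 _ le_rfl (h.momentum_lt' n).le)

end IsTangentOrbit

end

/-! ### The string construction -/

theorem eq_of_forall_abs_sub_le {m : ℝ → ℝ}
    (h : ∀ θ, ∀ ε > 0, ∀ᶠ θ' in 𝓝 θ, |m θ' - m θ| ≤ ε * |θ' - θ|) (a b : ℝ) : m a = m b := by
  have hd : ∀ θ, HasDerivAt m 0 θ := fun θ => by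
    rw [hasDerivAt_iff_isLittleO, Asymptotics.isLittleO_iff]
    intro ε hε
    filter_upwards [h θ ε hε] with θ' h'
    simpa using h'
  exact is_const_of_deriv_eq_zero (fun θ => (hd θ).differentiableAt) (fun θ => (hd θ).deriv) a b

theorem abs_image_sub_le {g g' : ℝ → ℝ} (hg : ∀ s, HasDerivAt g (g' s) s) {θ θ' ε : ℝ}
    (h : ∀ s, |s - θ| ≤ |θ' - θ| → |g' s| ≤ ε) : |g θ' - g θ| ≤ ε * |θ' - θ| :=
  (convex_uIcc θ θ').norm_image_sub_le_of_norm_hasDerivWithin_le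
    (fun s _ => (hg s).hasDerivWithinAt)
    (fun s hs => h s (by simpa [abs_sub_comm] using abs_sub_left_of_mem_uIcc hs))
    left_mem_uIcc right_mem_uIcc

theorem Function.Periodic.uniformContinuous {E : Type*} [PseudoMetricSpace E] {f : ℝ → E}
    (hf : Function.Periodic f 1) (hc : Continuous f) : UniformContinuous f := by
  have h1 := (isCompact_Icc (a := (-1 : ℝ)) (b := 2)).uniformContinuousOn_of_continuous
    hc.continuousOn
  rw [Metric.uniformContinuousOn_iff] at h1
  rw [Metric.uniformContinuous_iff]
  intro ε hε
  obtain ⟨δ, hδ, h⟩ := h1 ε hε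
  refine ⟨min δ 1, lt_min hδ one_pos, fun {a b} hab => ?_⟩
  have a1 := Int.floor_le a
  have a2 := Int.lt_floor_add_one a
  have hper : ∀ s, f (s - ⌊a⌋) = f s := fun s => by
    simpa using hf.sub_int_mul_eq (x := s) ⌊a⌋
  rw [Real.dist_eq, lt_min_iff] at hab
  have hab' := abs_lt.1 hab.2
  rw [← hper a, ← hper b]
  refine h _ ⟨by linarith, by linarith⟩ _ ⟨by linarith, by linarith⟩ ?_
  rw [dist_sub_right]
  exact hab.1

theorem IsBoundaryParam.uniformContinuous_deriv {K : Set Plane} {x v : ℝ → Plane}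
    (h : IsBoundaryParam K x v) : UniformContinuous v :=
  Function.Periodic.uniformContinuous h.v_add_one h.continuous_deriv

theorem IsBoundaryParam.exists_norm_le {K : Set Plane} {x v : ℝ → Plane}
    (h : IsBoundaryParam K x v) : ∃ R > 0, ∀ θ, ‖x θ‖ ≤ R := by
  obtain ⟨R, hR⟩ := h.isCompact.isBounded.exists_norm_le
  exact ⟨max R 1, by positivity, fun θ => (hR _ (h.mem θ)).trans (le_max_left _ _)⟩

/-- The amount by which the mixed perimeter of `C` grows if the point `z` is added to `C`. -/
noncomputable def excess (C : Set Plane) (w : ℝ → Plane) (z : Plane) : ℝ :=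
  ∫ β in (0 : ℝ)..1, max (inner ℝ z (w β) - supportFn C (w β)) 0

theorem isCompact_convexHull_insert {C : Set Plane} (hC : IsCompact C) (hc : Convex ℝ C)
    (hne : C.Nonempty) (z : Plane) : IsCompact (convexHull ℝ (insert z C)) := by
  rw [convexHull_insert hne, hc.convexHull_eq, convexJoin_singleton_left]
  have : ⋃ c ∈ C, segment ℝ z c =
      (fun r : ℝ × Plane => z + r.1 • (r.2 - z)) '' (Icc 0 1 ×ˢ C) := by
    ext u
    simp only [mem_iUnion, segment_eq_image', mem_image, mem_prod, Prod.exists, exists_prop]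
    constructor
    · rintro ⟨c, hc, t, ht, rfl⟩
      exact ⟨t, c, ⟨ht, hc⟩, rfl⟩
    · rintro ⟨t, c, ⟨ht, hc⟩, rfl⟩
      exact ⟨c, hc, t, ht, rfl⟩
  rw [this]
  exact (isCompact_Icc.prod hC).image (by fun_prop)

theorem supportFn_convexHull_insert {C : Set Plane} (hC : IsCompact C) (hc : Convex ℝ C)
    (hne : C.Nonempty) (z u : Plane) :
    supportFn (convexHull ℝ (insert z C)) u = max (inner ℝ z u) (supportFn C u) := by
  have hH := isCompact_convexHull_insert hC hc hne z
  have hsub := subset_convexHull ℝ (insert z C)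
  refine le_antisymm (supportFn_le ⟨z, hsub (mem_insert _ _)⟩ fun s hs => ?_) (max_le ?_ ?_)
  · have hconv : Convex ℝ {s : Plane | inner ℝ s u ≤ max (inner ℝ z u) (supportFn C u)} := by
      refine convex_halfSpace_le ⟨fun a b => inner_add_left _ _ _, fun c a => ?_⟩ _
      exact real_inner_smul_left _ _ _
    refine convexHull_min ?_ hconv hs
    rintro s (rfl | hs)
    · exact le_max_left (inner ℝ s u) (supportFn C u)
    · exact (inner_le_supportFn hC hs u).trans (le_max_right _ _)
  · exact inner_le_supportFn hH (hsub (mem_insert _ _)) u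
  · exact supportFn_mono hH hne ((subset_insert _ _).trans hsub) u

section
variable {K T C : Set Plane} {x v y w : ℝ → Plane}

theorem continuous_excess_integrand (hT : IsBoundaryParam T y w) (hC : IsCompact C) :
    Continuous fun r : Plane × ℝ => max (inner ℝ r.1 (w r.2) - supportFn C (w r.2)) 0 := by
  have h1 := hT.continuous_deriv
  have h2 := continuous_supportFn hC
  fun_prop

theorem continuous_excess_integrand' (hT : IsBoundaryParam T y w) (hC : IsCompact C) (z : Plane) :
    Continuous fun β => max (inner ℝ z (w β) - supportFn C (w β)) 0 :=
  (continuous_excess_integrand hT hC).comp (f := fun β => (z, β)) (by fun_prop)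

/-- The perimeter is linear in the support function, and the support function of the hull is the
maximum of ⟨z, ·⟩ and h_C. -/
theorem perimeter_convexHull_insert (hT : IsBoundaryParam T y w) (hC : IsCompact C)
    (hc : Convex ℝ C) (hi : (interior C).Nonempty) (z : Plane) :
    perimeter T (convexHull ℝ (insert z C)) = perimeter T C + excess C w z := by
  have hne : C.Nonempty := hi.mono interior_subset
  have hH := isCompact_convexHull_insert hC hc hne z
  rw [perimeter_eq hT hH (convex_convexHull _ _)
    (hi.mono (interior_mono ((subset_insert _ _).trans (subset_convexHull ℝ _)))),
    perimeter_eq hT hC hc hi, mixedPerimeter, mixedPerimeter, excess,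
    ← intervalIntegral.integral_add ((continuous_supportFn_comp hT hC).intervalIntegrable _ _)
      ((continuous_excess_integrand' hT hC z).intervalIntegrable _ _)]
  refine intervalIntegral.integral_congr fun β _ => ?_
  simp only [supportFn_convexHull_insert hC hc hne]
  rw [← max_add_add_left]
  simp

theorem continuous_excess (hT : IsBoundaryParam T y w) (hC : IsCompact C) :
    Continuous (excess C w) :=
  intervalIntegral.continuous_parametric_intervalIntegral_of_continuous'
    (continuous_excess_integrand hT hC) 0 1

theorem convexOn_excess (hT : IsBoundaryParam T y w) (hC : IsCompact C) :
    ConvexOn ℝ univ (excess C w) := by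
  refine ⟨convex_univ, fun a _ b _ s t hs ht hst => ?_⟩
  have h := continuous_excess_integrand' hT hC
  rw [smul_eq_mul, smul_eq_mul, excess, excess, excess, ← intervalIntegral.integral_const_mul,
    ← intervalIntegral.integral_const_mul, ← intervalIntegral.integral_add
      (((h a).const_mul s).intervalIntegrable _ _) (((h b).const_mul t).intervalIntegrable _ _)]
  refine intervalIntegral.integral_mono_on zero_le_one ((h _).intervalIntegrable _ _)
    ((((h a).const_mul s).add ((h b).const_mul t)).intervalIntegrable _ _) fun β _ => ?_
  rw [inner_add_left, real_inner_smul_left, real_inner_smul_left]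
  have e : supportFn C (w β) = s * supportFn C (w β) + t * supportFn C (w β) := by
    rw [← add_mul, hst, one_mul]
  have h1 := mul_le_mul_of_nonneg_left
    (le_max_left (inner ℝ a (w β) - supportFn C (w β)) 0) hs
  have h2 := mul_le_mul_of_nonneg_left
    (le_max_left (inner ℝ b (w β) - supportFn C (w β)) 0) ht
  have h3 := mul_nonneg hs (le_max_right (inner ℝ a (w β) - supportFn C (w β)) 0)
  have h4 := mul_nonneg ht (le_max_right (inner ℝ b (w β) - supportFn C (w β)) 0)
  exact max_le (by linarith) (by linarith)

theorem excess_eq_zero (hC : IsCompact C) {z : Plane} (hz : z ∈ C) : excess C w z = 0 := by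
  have : ∀ β, max (inner ℝ z (w β) - supportFn C (w β)) 0 = 0 := fun β =>
    max_eq_right (sub_nonpos.2 (inner_le_supportFn hC hz _))
  simp [excess, this]

theorem excess_eq_integral (hT : IsBoundaryParam T y w) (z : Plane) (b : ℝ) :
    excess C w z = ∫ β in b..b + 1, max (inner ℝ z (w β) - supportFn C (w β)) 0 :=
  integral_periodic hT (fun u => max (inner ℝ z u - supportFn C u) 0) b

theorem continuous_inner_sub_supportFn (hT : IsBoundaryParam T y w) (hC : IsCompact C)
    (z : Plane) : Continuous fun β => inner ℝ z (w β) - supportFn C (w β) :=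
  (continuous_const.inner hT.continuous_deriv).sub (continuous_supportFn_comp hT hC)

theorem integral_le_excess (hT : IsBoundaryParam T y w) (hC : IsCompact C) (z : Plane) {b b' : ℝ}
    (h1 : b ≤ b') (h2 : b' ≤ b + 1) :
    ∫ β in b..b', (inner ℝ z (w β) - supportFn C (w β)) ≤ excess C w z := by
  have h := continuous_excess_integrand' hT hC z
  rw [excess_eq_integral hT z b, ← intervalIntegral.integral_add_adjacent_intervals
    (h.intervalIntegrable b b') (h.intervalIntegrable b' (b + 1))]
  have e1 : ∫ β in b..b', (inner ℝ z (w β) - supportFn C (w β)) ≤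
      ∫ β in b..b', max (inner ℝ z (w β) - supportFn C (w β)) 0 :=
    intervalIntegral.integral_mono_on h1
      ((continuous_inner_sub_supportFn hT hC z).intervalIntegrable _ _)
      (h.intervalIntegrable _ _) fun β _ => le_max_left _ _
  have e2 : 0 ≤ ∫ β in b'..b + 1, max (inner ℝ z (w β) - supportFn C (w β)) 0 :=
    intervalIntegral.integral_nonneg h2 fun β _ => le_max_right _ _
  linarith

/-- The point `x θ` of the boundary of the table beats the caustic in the direction of the outer
normal of the table. -/
theorem supportFn_lt_of_normal (hK : IsBoundaryParam K x v) (hT : IsBoundaryParam T y w)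
    (hCK : C ⊆ interior K) (hC : IsCompact C) (hne : C.Nonempty) {θ r : ℝ}
    (hr : tangentAngle w r + 1 / 4 = tangentAngle v θ) :
    supportFn C (w r) < inner ℝ (x θ) (w r) := by
  obtain ⟨c, hc, e⟩ := (hr ▸ (hT.tangentAngle_spec r).2.2.rot).same_ray (hK.tangentAngle_spec θ).2.2
  obtain ⟨z, hz, hz'⟩ := exists_supportFn_eq hC hne (w r)
  have := hK.left θ z (interior_subset (hCK hz)) (by
    rintro rfl
    exact (hK.mem_frontier θ).2 (hCK hz))
  rw [e, det2_smul_left, det2_rot_left, inner_sub_right, real_inner_comm, hz',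
    real_inner_comm] at this
  have := pos_of_mul_pos_right this hc.le
  linarith

theorem excess_pos (hK : IsBoundaryParam K x v) (hT : IsBoundaryParam T y w)
    (hCK : C ⊆ interior K) (hC : IsCompact C) (hne : C.Nonempty) (θ : ℝ) :
    0 < excess C w (x θ) := by
  obtain ⟨r, hr⟩ := hT.exists_tangentAngle_eq (tangentAngle v θ - 1 / 4)
  have := supportFn_lt_of_normal hK hT hCK hC hne (θ := θ) (r := r) (by linarith)
  rw [excess_eq_integral hT _ r]
  refine intervalIntegral.integral_pos (by linarith)
    (continuous_excess_integrand' hT hC _).continuousOn (fun β _ => le_max_right _ _)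
    ⟨r, ⟨le_rfl, by linarith⟩, lt_max_of_lt_left (by linarith)⟩

/-- The visible arc is exactly where the positive part can be dropped; on the rest of the period it
vanishes. -/
theorem IsTangentOrbit.excess_eq {θ β : ℤ → ℝ} (hK : IsBoundaryParam K x v)
    (hT : IsBoundaryParam T y w) (hCK : C ⊆ interior K) (hC : IsCompact C)
    (hi : (interior C).Nonempty) (h : IsTangentOrbit K T C x v y w θ β) (n : ℤ) :
    excess C w (x (θ (n + 1))) =
      ∫ b in β n..β (n + 1), (inner ℝ (x (θ (n + 1))) (w b) - supportFn C (w b)) := by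
  have hc := continuous_excess_integrand' hT hC (x (θ (n + 1)))
  obtain ⟨h1, h2⟩ := h.visible hK hT hCK hC hi n
  rw [excess_eq_integral hT _ (β n), ← intervalIntegral.integral_add_adjacent_intervals
    (hc.intervalIntegrable (β n) (β (n + 1))) (hc.intervalIntegrable (β (n + 1)) (β n + 1))]
  have e2 : ∫ b in β (n + 1)..β n + 1,
      max (inner ℝ (x (θ (n + 1))) (w b) - supportFn C (w b)) 0 = 0 := by
    rw [intervalIntegral.integral_congr (g := fun _ => 0), intervalIntegral.integral_zero]
    intro b hb
    rw [uIcc_of_le (h.momentum_lt' n).le] at hb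
    exact max_eq_right (sub_nonpos.2 (h2 b hb.1 hb.2))
  rw [e2, add_zero]
  refine intervalIntegral.integral_congr fun b hb => ?_
  rw [uIcc_of_le (h.momentum_lt n).le] at hb
  exact max_eq_left (sub_nonneg.2 (h1 b hb.1 hb.2))

theorem integral_inner_sub_supportFn (hT : IsBoundaryParam T y w) (hC : IsCompact C) (z : Plane)
    (b b' : ℝ) : ∫ β in b..b', (inner ℝ z (w β) - supportFn C (w β)) =
      inner ℝ z (y b' - y b) - ∫ β in b..b', supportFn C (w β) := by
  rw [intervalIntegral.integral_sub
    ((continuous_const.inner hT.continuous_deriv).intervalIntegrable _ _)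
    ((continuous_supportFn_comp hT hC).intervalIntegrable _ _), integral_inner_deriv hT,
    inner_sub_right]

/-- The boundary of the table is a level set of the length of the string. -/
theorem excess_const (hK : IsBoundaryParam K x v) (hT : IsBoundaryParam T y w)
    (hC : IsConvexCaustic K T C) (hi : (interior C).Nonempty) (a b : ℝ) :
    excess C w (x a) = excess C w (x b) := by
  obtain ⟨R, hR, hyR⟩ := hT.exists_norm_le
  have huc := Metric.uniformContinuous_iff.1 hK.uniformContinuous_deriv
  refine eq_of_forall_abs_sub_le (m := fun θ => excess C w (x θ)) (fun θ ε hε => ?_) a b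
  obtain ⟨δ, hδ, hv⟩ := huc (ε / (2 * R)) (by positivity)
  -- Envelope argument: integrating over the arc of the orbit through θ gives the exact excess at θ
  -- and a lower bound at θ'. Their difference is ⟨x θ' - x θ, P⟩, whose derivative vanishes at θ by
  -- the reflection law. As δ does not depend on θ, the two points may be exchanged for the opposite
  -- bound.
  have key : ∀ θ θ', |θ' - θ| < δ →
      -(ε * |θ' - θ|) ≤ excess C w (x θ') - excess C w (x θ) := fun θ θ' hlt => by
    obtain ⟨t, β, h, ht⟩ := exists_isTangentOrbit hK hT hC θ
    have e1 := (h.shift (-1)).excess_eq hK hT hC.subset_interior hC.isCompact hi 0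
    have e2 := (h.shift (-1)).inner_deriv_eq_zero hK 0
    have e3 := integral_le_excess hT hC.isCompact (x θ') (h.momentum_lt (-1)).le
      (h.momentum_lt' (-1)).le
    simp only [zero_add, add_neg_cancel, neg_add_cancel, ht] at e1 e2 e3
    rw [integral_inner_sub_supportFn hT hC.isCompact] at e1 e3
    set P := y (β 0) - y (β (-1)) with hP
    have hPR : ‖P‖ ≤ 2 * R := (norm_sub_le _ _).trans (by linarith [hyR (β 0), hyR (β (-1))])
    have := abs_image_sub_le (fun s => hasDerivAt_inner_const_left (hK.hasDerivAt s) P)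
      (θ := θ) (θ' := θ') (ε := ε) fun s hs => by
        have d1 := hv (a := s) (b := θ) (by rw [Real.dist_eq]; exact hs.trans_lt hlt)
        rw [dist_eq_norm] at d1
        have d2 : inner ℝ P (v s) = inner ℝ P (v s - v θ) := by
          rw [inner_sub_right, real_inner_comm (v θ) P, e2, sub_zero]
        rw [d2]
        refine (abs_real_inner_le_norm _ _).trans ?_
        calc ‖P‖ * ‖v s - v θ‖ ≤ 2 * R * (ε / (2 * R)) := by gcongr
          _ = ε := by field_simp
    have := (abs_le.1 this).1
    rw [real_inner_comm, real_inner_comm (x θ) P] at this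
    linarith
  filter_upwards [Metric.ball_mem_nhds θ hδ] with θ' hθ'
  rw [Metric.mem_ball, Real.dist_eq] at hθ'
  have k1 := key θ θ' hθ'
  have k2 := key θ' θ (by rwa [abs_sub_comm])
  rw [abs_sub_comm θ θ'] at k2
  rw [abs_le]
  constructor <;> linarith

/-- The excess is convex, zero on `C` and equal to a positive constant on the boundary of `K`, so
`K` is the corresponding sublevel set and no other level gives `K`. -/
theorem isLazutkinParameter_iff (hK : IsBoundaryParam K x v) (hT : IsBoundaryParam T y w)
    (hC : IsConvexCaustic K T C) (hi : (interior C).Nonempty) (θ t : ℝ) :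
    IsLazutkinParameter K T C t ↔ t = excess C w (x θ) := by
  set l := excess C w (x θ) with hl
  have hlpos : 0 < l := excess_pos hK hT hC.subset_interior hC.isCompact hC.nonempty θ
  have hfr : ∀ z ∈ frontier K, excess C w z = l := fun z hz => by
    obtain ⟨s, rfl⟩ := hK.exists_param hz
    exact excess_const hK hT hC hi s θ
  have hcont := continuous_excess hT hC.isCompact
  have hconv := convexOn_excess hT hC.isCompact
  have hper := perimeter_convexHull_insert hT hC.isCompact hC.convex hi
  have hiff : ∀ z, z ∈ K ↔ excess C w z ≤ l := fun z => by
    constructor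
    · intro hz
      have hsub : K ⊆ {z | excess C w z ≤ l} := by
        rw [← closure_convexHull_extremePoints hK.isCompact hK.convex]
        refine closure_minimal (convexHull_min (fun e he => ?_) ?_)
          (isClosed_le hcont continuous_const)
        · refine (hfr e ⟨subset_closure he.1, fun hint => ?_⟩).le
          exact disjoint_left.1 (disjoint_interior_extremePoints K) hint he
        · simpa using hconv.convex_le l
      exact hsub hz
    · intro hz
      by_contra hzK
      obtain ⟨c, hc⟩ := hC.nonempty
      -- A segment from `C` to a point outside `K` meets the boundary, where the excess is already l
      -- > 0. By convexity, and since it starts from 0, it exceeds l at the outer end.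
      obtain ⟨f, hf, hfK⟩ : ∃ f ∈ segment ℝ c z, f ∈ frontier K := by
        by_contra! hno
        obtain ⟨f, -, hf1, hf2⟩ := (convex_segment c z).isPreconnected (interior K) Kᶜ
          isOpen_interior hK.isCompact.isClosed.isOpen_compl
          (fun f hf => by
            by_contra hf'
            rw [mem_union, not_or, mem_compl_iff, not_not] at hf'
            exact hno f hf ⟨subset_closure hf'.2, hf'.1⟩)
          ⟨c, left_mem_segment ℝ c z, hC.subset_interior hc⟩ ⟨z, right_mem_segment ℝ c z, hzK⟩
        exact hf2 (interior_subset hf1)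
      obtain ⟨s, t, hs, ht, hst, rfl⟩ := hf
      have h1 := hconv.2 (mem_univ c) (mem_univ z) hs ht hst
      rw [hfr _ hfK, excess_eq_zero hC.isCompact hc, smul_zero, zero_add, smul_eq_mul] at h1
      rcases hs.eq_or_lt with rfl | hs'
      · rw [zero_add] at hst
        subst hst
        rw [zero_smul, zero_add, one_smul] at hfK
        exact hzK (hK.isCompact.isClosed.frontier_subset hfK)
      · nlinarith
  constructor
  · rintro ⟨L, hL, hKL, rfl⟩
    have hz := hK.mem_frontier θ
    have hKL' : ∀ z, z ∈ K ↔ excess C w z ≤ L - perimeter T C := fun z => by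
      conv_lhs => rw [hKL]
      rw [stringBody, mem_ofPred_eq, hper]
      constructor <;> intro h <;> linarith
    refine le_antisymm ?_ ((hKL' _).1 (hK.mem θ))
    -- `x θ` is a limit of points outside `K`, whose excess is above the level of the string; hence
    -- its own excess is not below that level.
    have hcl : x θ ∈ closure Kᶜ := by
      rw [closure_compl]
      exact hz.2
    refine closure_minimal (t := {z | L - perimeter T C ≤ excess C w z}) (fun z hz => ?_)
      (isClosed_le continuous_const hcont) hcl
    by_contra hlt
    rw [mem_ofPred_eq, not_le] at hlt
    exact hz ((hKL' z).2 hlt.le)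
  · rintro rfl
    refine ⟨perimeter T C + l, by linarith, ?_, by ring⟩
    ext z
    rw [hiff, stringBody, mem_ofPred_eq, hper]
    constructor <;> intro h <;> linarith

end

/-! ### Tangent orbits of dual caustics -/

section
variable {K T C C' : Set Plane} {x v y w : ℝ → Plane}

/-- If there is a dual caustic with non-empty interior, then no tangent trajectory contains a
diameter. -/
theorem AreDualCaustics.ne_neg (hK : IsBoundaryParam K x v) (hT : IsBoundaryParam T y w)
    (hC : IsConvexCaustic K T C) (hC' : IsConvexCaustic T K C') (hi' : (interior C').Nonempty)
    (hdual : AreDualCaustics K T C C') {q p : ℤ → Plane} (h : IsBilliardTrajectory K T q p)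
    (h0 : IsPosTangent C (q 0) (q 1 - q 0)) : q 1 ≠ -q 0 := by
  intro hq
  have htan := hC.posTangent_all hK hT h (σ := 1) (Or.inl rfl) (by rwa [one_smul])
  simp only [one_smul] at htan
  -- The diameter makes the trajectory symmetric: q n = -q (1 - n) and p n = p (-n). The dual
  -- trajectory then retraces the link from `p (-1)` to `p 0`, which would be tangent to `C'` with
  -- both orientations, so that `C'` would lie on a line.
  have hrev := ((h.reverse hT.symm).neg hK.symm hT.symm).shift (-1)
  have hsym := h.ext_of_link hK hT hrev (by simp [hq]) (by simp [hq])
  have hp : p 1 = p (-1) := by simpa using (hsym 1).2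
  have hpq := h.dual hK.symm
  obtain ⟨σ, hσ, h1⟩ : ∃ σ : ℝ, (σ = 1 ∨ σ = -1) ∧
      IsPosTangent C' (p (-1)) (σ • (p 0 - p (-1))) := by
    rcases (hdual q p h).1 (fun n => Or.inl (htan n)) (-1) with h1 | h1
    · exact ⟨1, Or.inl rfl, by simpa using h1⟩
    · exact ⟨-1, Or.inr rfl, by simpa using h1⟩
  have hσ0 : σ ≠ 0 := by rcases hσ with rfl | rfl <;> norm_num
  have h2 := hC'.posTangent_next hT hK (hpq.shift (-1)) hσ (by simpa using h1)
  have h2' : IsPosTangent C' (p 0) (σ • (p (-1) - p 0)) := by simpa [hp] using h2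
  have h3 := h1.flip hσ0
  have hne : p (-1) - p 0 ≠ 0 := sub_ne_zero.2 (h.p_ne (-1)).symm
  refine not_interior_of_inner_const (C := C') (u := rot (p (-1) - p 0))
    (r := inner ℝ (p 0) (rot (p (-1) - p 0))) (rot_ne_zero hne) (fun c hc => ?_) hi'
  have a1 := h2'.2 c hc
  have a2 := h3.2 c hc
  rw [det2_smul_left] at a1 a2
  have a3 : det2 (p (-1) - p 0) (c - p 0) = 0 := by
    have : σ * det2 (p (-1) - p 0) (c - p 0) = 0 := by linarith
    exact (mul_eq_zero.1 this).resolve_left hσ0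
  rw [inner_rot_right, inner_rot_right, det2_swap, det2_swap (p 0)]
  rw [det2_sub_right] at a3
  linarith

/-- Otherwise the tangent from the centre to `C` would be a diameter occurring in a tangent
trajectory. -/
theorem AreDualCaustics.zero_mem (hK : IsBoundaryParam K x v) (hT : IsBoundaryParam T y w)
    (hC : IsConvexCaustic K T C) (hC' : IsConvexCaustic T K C') (hi' : (interior C').Nonempty)
    (hdual : AreDualCaustics K T C C') : (0 : Plane) ∈ C := by
  by_contra h0
  obtain ⟨q, p, hqp, hq, h⟩ := exists_diameter_of_zero_notMem hK hT hC h0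
  exact hdual.ne_neg hK hT hC hC' hi' hqp h hq

namespace IsTangentOrbit
variable {θ β : ℤ → ℝ}

/-- If the caustic contains the centre, a tangent trajectory turns by less than half a turn. -/
theorem position_lt_half (hK : IsBoundaryParam K x v) (h0 : (0 : Plane) ∈ C)
    (h : IsTangentOrbit K T C x v y w θ β) (n : ℤ) (hne : x (θ (n + 1)) ≠ -x (θ n)) :
    θ (n + 1) < θ n + 1 / 2 := by
  by_contra! hge
  rcases hge.eq_or_lt with heq | hlt
  · rw [← heq, hK.x_add_half] at hne
    exact hne rfl
  · have h1 := (h.tangent n).2 _ h0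
    have h2 := (hK.atAngle (θ n)).det2_neg (hK.atAngle (θ (n + 1))) hlt (h.position_lt' n)
    rw [zero_sub, det2_neg_right, det2_sub_left, det2_self, sub_zero, det2_swap, neg_neg] at h1
    linarith

/-- The second component of the dual trajectory is `-q (n + 1)`; of its lifts, the one half a turn
behind `θ (n + 1)` satisfies the interlacing inequalities with `β n`. The point to prove is that
tangency to `C'` is positive. -/
theorem dual (hK : IsBoundaryParam K x v) (hT : IsBoundaryParam T y w)
    (hC : IsConvexCaustic K T C) (hC' : IsConvexCaustic T K C') (hi' : (interior C').Nonempty)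
    (hdual : AreDualCaustics K T C C') (h : IsTangentOrbit K T C x v y w θ β) :
    IsTangentOrbit T K C' y w x v β (fun n => θ (n + 1) - 1 / 2) := by
  have hneg : ∀ t, x (t - 1 / 2) = -x t := fun t => by
    rw [← neg_neg (x (t - 1 / 2)), ← hK.x_add_half, sub_add_cancel]
  have htr := h.trajectory.dual hK.symm
  refine ⟨by simpa only [hneg] using htr, ?_, h.momentum_lt, h.momentum_lt',
    fun n => by linarith [h.position_lt (n + 1)], fun n => by linarith [h.position_lt' (n + 1)],
    fun n => ?_⟩
  · have hall : ∀ {σ : ℝ}, (σ = 1 ∨ σ = -1) →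
        IsPosTangent C' (y (β 0)) (σ • (y (β 1) - y (β 0))) → ∀ n,
        IsPosTangent C' (y (β n)) (σ • (y (β (n + 1)) - y (β n))) := fun hσ h0 n =>
      hC'.posTangent_all hT hK htr hσ h0 n
    rcases (hdual _ _ h.trajectory).1 (fun n => Or.inl (h.tangent n)) 0 with h0 | h0
    · simpa only [one_smul] using hall (σ := 1) (Or.inl rfl) (by simpa using h0)
    -- As `C` contains the centre and no link is a diameter, the tangent direction turns by less
    -- than half a turn from θ 1 to θ 2, so the momentum polygon turns left at `y (β 1)`. Then the
    -- contact point on its next link lies strictly to the left of the preceding link, against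
    -- negative tangency.
    · exfalso
      have hm := hall (σ := -1) (Or.inr rfl) (by simpa using h0)
      have hlt := h.position_lt_half hK (hdual.zero_mem hK hT hC hC' hi') 1 (by
        have := hdual.ne_neg hK hT hC hC' hi' (h.trajectory.shift 1) (by
          simpa using h.tangent 1)
        simpa [add_comm] using this)
      have m1 := hK.strictMono_tangentAngle (h.position_lt 1)
      have m2 := hK.strictMono_tangentAngle hlt
      rw [hK.tangentAngle_add_half] at m2
      have hpos := (hK.tangentAngle_spec (θ 1)).2.2.det2_pos
        (hK.tangentAngle_spec (θ (1 + 1))).2.2 m1 m2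
      obtain ⟨c, hc, e⟩ := h.trajectory.p_step hK 0 rfl
      obtain ⟨c', hc', e'⟩ := h.trajectory.p_step hK 1 rfl
      simp only [zero_add] at e
      obtain ⟨t, ht0, ht1, ht⟩ := tangent_chord_contact hT hC'.subset_interior
        (hT.mem_frontier _) (hT.mem_frontier _) (hm 1)
      have h2 := ((hm 0).flip (by norm_num)).2 _ ht
      rw [zero_add, ← neg_sub (y (β 1)), e, e', neg_neg, one_smul, neg_neg, add_sub_cancel_left,
        smul_neg, det2_neg_right, det2_smul_right, det2_smul_right, det2_smul_left, det2_rot_left,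
        inner_rot_right] at h2
      have := mul_pos (mul_pos ht0 hc') (mul_pos hc hpos)
      nlinarith
  · have := h.angle n
    have e := hK.tangentAngle_add_half (θ (n + 1) - 1 / 2)
    have e' := hK.tangentAngle_add_half (θ (n + 1 + 1) - 1 / 2)
    rw [sub_add_cancel] at e e'
    have hn := h.angle (n + 1)
    refine ⟨?_, ?_, ?_, ?_⟩ <;> linarith

end IsTangentOrbit

end

/-! ### The generating function of a pair of dual caustics -/

/-- The generating function of the dual pair of caustics `C`, `C'`: the value of the coupling
`⟨x, y⟩` with the support functions of the caustics integrated along the boundaries of the tables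
subtracted. -/
noncomputable def couplingDefect (C C' : Set Plane) (x v y w : ℝ → Plane) (θ b : ℝ) : ℝ :=
  inner ℝ (x θ) (y b) - (∫ s in (0 : ℝ)..b, supportFn C (w s)) +
    ∫ s in (0 : ℝ)..θ, supportFn C' (-v s)

section
variable {K T C C' : Set Plane} {x v y w : ℝ → Plane}

theorem couplingDefect_sub (hT : IsBoundaryParam T y w) (hC : IsCompact C) (θ b b' : ℝ) :
    couplingDefect C C' x v y w θ b' - couplingDefect C C' x v y w θ b =
      ∫ s in b..b', (inner ℝ (x θ) (w s) - supportFn C (w s)) := by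
  have h := continuous_supportFn_comp hT hC
  rw [integral_inner_sub_supportFn hT hC, inner_sub_right,
    ← intervalIntegral.integral_interval_sub_left (h.intervalIntegrable 0 b')
      (h.intervalIntegrable 0 b), couplingDefect, couplingDefect]
  ring

theorem continuous_supportFn_neg (hK : IsBoundaryParam K x v) (hC' : IsCompact C') :
    Continuous fun s => supportFn C' (-v s) :=
  (continuous_supportFn hC').comp hK.continuous_deriv.neg

theorem couplingDefect_sub_position (hK : IsBoundaryParam K x v) (hC' : IsCompact C')
    (θ θ' b : ℝ) :
    couplingDefect C C' x v y w θ' b - couplingDefect C C' x v y w θ b =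
      inner ℝ (x θ' - x θ) (y b) + ∫ s in θ..θ', supportFn C' (-v s) := by
  have h := continuous_supportFn_neg hK hC'
  rw [← intervalIntegral.integral_interval_sub_left (h.intervalIntegrable 0 θ')
      (h.intervalIntegrable 0 θ), inner_sub_left, couplingDefect, couplingDefect]
  ring

theorem hasDerivAt_couplingDefect (hK : IsBoundaryParam K x v) (hC' : IsCompact C') (b θ : ℝ) :
    HasDerivAt (fun θ => couplingDefect C C' x v y w θ b)
      (inner ℝ (y b) (v θ) + supportFn C' (-v θ)) θ := by
  have h1 := (hasDerivAt_inner_const_left (hK.hasDerivAt θ) (y b)).sub_const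
    (∫ s in (0 : ℝ)..b, supportFn C (w s))
  have h2 := ((continuous_supportFn_neg hK hC').integral_hasStrictDerivAt 0 θ).hasDerivAt
  refine (h1.add h2).congr_of_eventuallyEq (Eventually.of_forall fun s => ?_)
  simp only [Pi.add_apply, couplingDefect, real_inner_comm (y b)]

theorem couplingDefect_add_one (hT : IsBoundaryParam T y w) (hC : IsCompact C) (θ b : ℝ) :
    couplingDefect C C' x v y w θ (b + 1) =
      couplingDefect C C' x v y w θ b - mixedPerimeter C w := by
  have := couplingDefect_sub (C' := C') (x := x) (v := v) hT hC θ b (b + 1)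
  rw [integral_inner_sub_supportFn hT hC, hT.x_add_one, sub_self, inner_zero_right,
    ← integral_periodic hT (supportFn C)] at this
  rw [mixedPerimeter]
  linarith

theorem couplingDefect_add_one_position (hK : IsBoundaryParam K x v) (hC' : IsCompact C')
    (θ b : ℝ) : couplingDefect C C' x v y w (θ + 1) b =
      couplingDefect C C' x v y w θ b + mixedPerimeter C' v := by
  have := couplingDefect_sub_position (C := C) (y := y) (w := w) hK hC' θ (θ + 1) b
  rw [hK.x_add_one, sub_self, inner_zero_left,
    ← integral_periodic hK (fun u => supportFn C' (-u)), integral_comp_neg hK] at this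
  rw [mixedPerimeter]
  linarith

namespace IsTangentOrbit
variable {θ β θ' β' : ℤ → ℝ}

/-- Modulo whole turns, a direction in which the position beats `C` belongs to the visible arc; the
bounds on its angle select the right turn. -/
theorem mem_arc (hK : IsBoundaryParam K x v) (hT : IsBoundaryParam T y w)
    (hCK : C ⊆ interior K) (hC : IsCompact C) (hi : (interior C).Nonempty)
    (h : IsTangentOrbit K T C x v y w θ β) (n : ℤ) {r : ℝ}
    (hr : supportFn C (w r) < inner ℝ (x (θ (n + 1))) (w r))
    (h1 : tangentAngle v (θ (n + 1)) - 1 / 2 < tangentAngle w r + 1 / 4)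
    (h2 : tangentAngle w r + 1 / 4 < tangentAngle v (θ (n + 1)) + 1 / 2) :
    β n ≤ r ∧ r ≤ β (n + 1) := by
  have hv := (h.visible hK hT hCK hC hi n).2
  have a0 := h.angle n
  have a1 := h.angle (n + 1)
  have r1 : r < β n + 1 := by
    rw [← hT.strictMono_tangentAngle.lt_iff_lt, hT.tangentAngle_add_one]
    linarith
  have r2 : β (n + 1) < r + 1 := by
    rw [← hT.strictMono_tangentAngle.lt_iff_lt, hT.tangentAngle_add_one]
    linarith
  constructor
  · by_contra! hlt
    have := hv (r + 1) r2.le (by linarith)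
    rw [hT.v_add_one] at this
    linarith
  · by_contra! hlt
    linarith [hv r hlt.le r1.le]

/-- The b-derivative ⟨x, w⟩ - h_C(w) is non-negative on the visible arc and non-positive on the
complementary arc before it, so `β n` is a minimum point. Values of b lying even lower are raised by
one turn; this does not increase the defect, since h_C ≥ 0 when the centre is in `C`. -/
theorem couplingDefect_le (hK : IsBoundaryParam K x v) (hT : IsBoundaryParam T y w)
    (hCK : C ⊆ interior K) (hC : IsCompact C) (hi : (interior C).Nonempty) (h0 : (0 : Plane) ∈ C)
    (h : IsTangentOrbit K T C x v y w θ β) (n : ℤ) {r b : ℝ} (hr : β n ≤ r)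
    (hr' : r ≤ β (n + 1)) (hb : r - 1 ≤ b) (hb' : b ≤ r) :
    couplingDefect C C' x v y w (θ (n + 1)) (β n) ≤
      couplingDefect C C' x v y w (θ (n + 1)) b := by
  obtain ⟨v1, v2⟩ := h.visible hK hT hCK hC hi n
  have hsub := couplingDefect_sub (C' := C') (x := x) (v := v) hT hC (θ (n + 1))
  have up : ∀ c, β n ≤ c → c ≤ β (n + 1) → couplingDefect C C' x v y w (θ (n + 1)) (β n) ≤
      couplingDefect C C' x v y w (θ (n + 1)) c := fun c hc hc' => by
    have : 0 ≤ ∫ s in β n..c, (inner ℝ (x (θ (n + 1))) (w s) - supportFn C (w s)) :=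
      intervalIntegral.integral_nonneg hc fun s hs =>
        sub_nonneg.2 (v1 s hs.1 (hs.2.trans hc'))
    rw [← hsub] at this
    linarith
  rcases le_total (β n) b with hle | hle
  · exact up b hle (hb'.trans hr')
  rcases le_total (β (n + 1)) (b + 1) with hle' | hle'
  · have : ∫ s in b..β n, (inner ℝ (x (θ (n + 1))) (w s) - supportFn C (w s)) ≤ 0 := by
      rw [← neg_nonneg, ← intervalIntegral.integral_neg]
      refine intervalIntegral.integral_nonneg hle fun s hs => ?_
      have := v2 (s + 1) (by linarith [hs.1]) (by linarith [hs.2])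
      rw [hT.v_add_one] at this
      linarith
    rw [← hsub] at this
    linarith
  · have h1 := up (b + 1) (by linarith) hle'
    have h2 : 0 ≤ mixedPerimeter C w := intervalIntegral.integral_nonneg zero_le_one fun s _ => by
      simpa using inner_le_supportFn hC h0 (w s)
    rw [couplingDefect_add_one hT hC] at h1
    linarith

end IsTangentOrbit

/-- At a stationary position the increment is o(Δθ), with a modulus that depends neither on θ nor on
b: `y` is bounded, and `v` and h_{C'}(-v) are uniformly continuous. -/
theorem exists_deriv_couplingDefect_le (hK : IsBoundaryParam K x v) (hT : IsBoundaryParam T y w)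
    (hC' : IsCompact C') {ε : ℝ} (hε : 0 < ε) : ∃ δ > 0, ∀ b θ θ',
      inner ℝ (y b) (v θ) + supportFn C' (-v θ) = 0 → |θ' - θ| < δ →
      |couplingDefect C C' x v y w θ' b - couplingDefect C C' x v y w θ b| ≤ ε * |θ' - θ| := by
  obtain ⟨R, hR, hyR⟩ := hT.exists_norm_le
  have hper : Function.Periodic (fun s => supportFn C' (-v s)) 1 := fun s => by
    simp only [hK.v_add_one]
  obtain ⟨δ₁, hδ₁, h1⟩ := Metric.uniformContinuous_iff.1 hK.uniformContinuous_deriv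
    (ε / 2 / R) (by positivity)
  obtain ⟨δ₂, hδ₂, h2⟩ := Metric.uniformContinuous_iff.1
    (hper.uniformContinuous (continuous_supportFn_neg hK hC')) (ε / 2) (by positivity)
  refine ⟨min δ₁ δ₂, lt_min hδ₁ hδ₂, fun b θ θ' h0 hlt => ?_⟩
  refine abs_image_sub_le (hasDerivAt_couplingDefect hK hC' b) fun s hs => ?_
  have hs' := lt_min_iff.1 (hs.trans_lt hlt)
  have d1 := h1 (a := s) (b := θ) hs'.1
  have d2 := h2 (a := s) (b := θ) hs'.2
  rw [dist_eq_norm] at d1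
  rw [Real.dist_eq] at d2
  have d3 : |inner ℝ (y b) (v s - v θ)| ≤ ε / 2 := by
    refine (abs_real_inner_le_norm _ _).trans ?_
    calc ‖y b‖ * ‖v s - v θ‖ ≤ R * (ε / 2 / R) := by gcongr; exact hyR b
      _ = ε / 2 := by field_simp
  rw [inner_sub_right] at d3
  have d4 := abs_lt.1 d2
  rw [abs_le] at *
  constructor <;> linarith

/-- The value of the generating function is the same for all links of all tangent orbits. -/
theorem couplingDefect_const (hK : IsBoundaryParam K x v) (hT : IsBoundaryParam T y w)
    (hC : IsConvexCaustic K T C) (hC' : IsConvexCaustic T K C') (hi : (interior C).Nonempty)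
    (hi' : (interior C').Nonempty) (hdual : AreDualCaustics K T C C') {θ β θ' β' : ℤ → ℝ}
    (h : IsTangentOrbit K T C x v y w θ β) (h' : IsTangentOrbit K T C x v y w θ' β') (n n' : ℤ) :
    couplingDefect C C' x v y w (θ (n + 1)) (β n) =
      couplingDefect C C' x v y w (θ' (n' + 1)) (β' n') := by
  have h0 := hdual.zero_mem hK hT hC hC' hi'
  have hCK := hC.subset_interior
  have hex : ∀ s, ∃ r, tangentAngle w r + 1 / 4 = tangentAngle v s := fun s => by
    obtain ⟨r, hr⟩ := hT.exists_tangentAngle_eq (tangentAngle v s - 1 / 4)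
    exact ⟨r, by linarith⟩
  -- If the visible arcs of two orbits share a parameter r, the momentum of each lies in the window
  -- in which the momentum of the other is minimal.
  have le : ∀ {θ β θ' β' : ℤ → ℝ}, IsTangentOrbit K T C x v y w θ β →
      IsTangentOrbit K T C x v y w θ' β' → ∀ (n n' : ℤ) (r : ℝ),
      tangentAngle w r + 1 / 4 = tangentAngle v (θ (n + 1)) →
      |tangentAngle v (θ' (n' + 1)) - tangentAngle v (θ (n + 1))| < 1 / 2 →
      supportFn C (w r) < inner ℝ (x (θ' (n' + 1))) (w r) →
      couplingDefect C C' x v y w (θ (n + 1)) (β n) ≤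
        couplingDefect C C' x v y w (θ (n + 1)) (β' n') ∧
      couplingDefect C C' x v y w (θ' (n' + 1)) (β' n') ≤
        couplingDefect C C' x v y w (θ' (n' + 1)) (β n) := by
    intro θ β θ' β' h h' n n' r hr habs hlt
    have ha := abs_lt.1 habs
    have hlt0 := supportFn_lt_of_normal hK hT hCK hC.isCompact hC.nonempty hr
    have m1 := h.mem_arc hK hT hCK hC.isCompact hi n hlt0 (by linarith) (by linarith)
    have m2 := h'.mem_arc hK hT hCK hC.isCompact hi n' hlt (by linarith) (by linarith)
    exact ⟨h.couplingDefect_le hK hT hCK hC.isCompact hi h0 n m1.1 m1.2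
        (by linarith [h'.momentum_lt' n']) m2.1,
      h'.couplingDefect_le hK hT hCK hC.isCompact hi h0 n' m2.1 m2.2
        (by linarith [h.momentum_lt' n]) m1.1⟩
  -- Stationarity in the position is tangency of the dual orbit to `C'` at `y (β n)`.
  have crit : ∀ {θ β : ℤ → ℝ}, IsTangentOrbit K T C x v y w θ β → ∀ n : ℤ,
      inner ℝ (y (β n)) (v (θ (n + 1))) + supportFn C' (-v (θ (n + 1))) = 0 := by
    intro θ β h n
    have := (h.dual hK hT hC hC' hi' hdual).supportFn_eq_right hT hK hC'.subset_interior
      hC'.isCompact hi' (n - 1)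
    have e : v (θ (n + 1) - 1 / 2) = -v (θ (n + 1)) := by
      rw [← neg_neg (v (θ (n + 1) - 1 / 2)), ← hK.v_add_half, sub_add_cancel]
    rw [sub_add_cancel, e, inner_neg_right] at this
    linarith
  choose t b ht ht0 using exists_isTangentOrbit (C := C) hK hT hC
  have ht0' : ∀ s, t s (-1 + 1) = s := fun s => ht0 s
  -- The value depends on the position only, since two momenta for the same position are minimal
  -- against each other. So it defines a function of the position.
  have uniq : ∀ {θ β : ℤ → ℝ}, IsTangentOrbit K T C x v y w θ β → ∀ n : ℤ,
      couplingDefect C C' x v y w (θ (n + 1)) (β n) =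
        couplingDefect C C' x v y w (θ (n + 1)) (b (θ (n + 1)) (-1)) := by
    intro θ β h n
    obtain ⟨r, hr⟩ := hex (θ (n + 1))
    have hlt0 := supportFn_lt_of_normal hK hT hCK hC.isCompact hC.nonempty hr
    have := le h (ht (θ (n + 1))) n (-1) r hr (by rw [ht0', sub_self]; norm_num) (by rwa [ht0'])
    rw [ht0'] at this
    exact le_antisymm this.1 this.2
  rw [uniq h, uniq h']
  -- With F the defect and b(s) the momentum arriving at position s: F(s', b(s')) ≤ F(s', b(s)) by
  -- minimality, and this is at most F(s, b(s)) + ε|s' - s| by stationarity at s. Exchanging s and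
  -- s' gives the other bound.
  refine eq_of_forall_abs_sub_le
    (m := fun s => couplingDefect C C' x v y w s (b s (-1))) (fun s ε hε => ?_) _ _
  obtain ⟨δ, hδ, hM⟩ := exists_deriv_couplingDefect_le (C := C) hK hT hC'.isCompact hε
  obtain ⟨r, hr⟩ := hex s
  have hlt0 := supportFn_lt_of_normal hK hT hCK hC.isCompact hC.nonempty hr
  have hτ : Continuous (tangentAngle v) :=
    hK.strictMono_tangentAngle.monotone.continuous_of_surjective hK.exists_tangentAngle_eq
  have hx := hK.continuous
  have ev1 : ∀ᶠ s' in 𝓝 s, |tangentAngle v s' - tangentAngle v s| < 1 / 2 := by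
    have : Continuous fun s' => |tangentAngle v s' - tangentAngle v s| := by fun_prop
    exact this.continuousAt.eventually_lt continuousAt_const (by norm_num)
  have ev2 : ∀ᶠ s' in 𝓝 s, supportFn C (w r) < inner ℝ (x s') (w r) := by
    have : Continuous fun s' => inner ℝ (x s') (w r) := by fun_prop
    exact continuousAt_const.eventually_lt this.continuousAt hlt0
  filter_upwards [ev1, ev2, Metric.ball_mem_nhds s hδ] with s' h1 h2 h3
  rw [Metric.mem_ball, Real.dist_eq] at h3
  have hle := le (ht s) (ht s') (-1) (-1) r (by rwa [ht0']) (by rwa [ht0', ht0'])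
    (by rwa [ht0'])
  have c1 := crit (ht s) (-1)
  have c2 := crit (ht s') (-1)
  rw [ht0'] at c1 c2
  rw [ht0', ht0'] at hle
  have e1 := hM _ _ s' c1 h3
  have e2 := hM _ _ s c2 (by rwa [abs_sub_comm])
  rw [abs_sub_comm s s'] at e2
  rw [abs_le] at *
  constructor <;> linarith [hle.1, hle.2]

end

/-- Raising an orbit by a full turn gives another orbit, with the same defect; yet the turn in b
subtracts the perimeter of `C` and the turn in θ adds that of `C'`. -/
theorem mixedPerimeter_eq_of_dual {K T C C' : Set Plane} {x v y w : ℝ → Plane}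
    (hK : IsBoundaryParam K x v) (hT : IsBoundaryParam T y w)
    (hC : IsConvexCaustic K T C) (hC' : IsConvexCaustic T K C') (hi : (interior C).Nonempty)
    (hi' : (interior C').Nonempty) (hdual : AreDualCaustics K T C C') :
    mixedPerimeter C w = mixedPerimeter C' v := by
  obtain ⟨θ, β, h, -⟩ := exists_isTangentOrbit hK hT hC 0
  have := couplingDefect_const hK hT hC hC' hi hi' hdual (h.add_one hK hT) h 0 0
  rw [couplingDefect_add_one hT hC.isCompact, couplingDefect_add_one_position hK hC'.isCompact]
    at this
  linarith

/-- Both excesses are differences of the defect: at (θ 1, β 1) minus at (θ 1, β 0) for `C`, and at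
(θ 1, β 1) minus at (θ 2, β 1) for `C'`. The subtracted values belong to consecutive links of one
orbit. -/
theorem excess_eq_of_dual {K T C C' : Set Plane} {x v y w : ℝ → Plane}
    (hK : IsBoundaryParam K x v) (hT : IsBoundaryParam T y w)
    (hC : IsConvexCaustic K T C) (hC' : IsConvexCaustic T K C') (hi : (interior C).Nonempty)
    (hi' : (interior C').Nonempty) (hdual : AreDualCaustics K T C C') (a b : ℝ) :
    excess C w (x a) = excess C' v (y b) := by
  obtain ⟨θ, β, h, -⟩ := exists_isTangentOrbit hK hT hC 0
  have hd := h.dual hK hT hC hC' hi' hdual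
  have hneg : ∀ t, x (t - 1 / 2) = -x t ∧ v (t - 1 / 2) = -v t := fun t => by
    rw [← neg_neg (x (t - 1 / 2)), ← hK.x_add_half, ← neg_neg (v (t - 1 / 2)), ← hK.v_add_half,
      sub_add_cancel]
    exact ⟨rfl, rfl⟩
  rw [excess_const hK hT hC hi a (θ (0 + 1)), excess_const hT hK hC' hi' b (β (0 + 1)),
    h.excess_eq hK hT hC.subset_interior hC.isCompact hi,
    hd.excess_eq hT hK hC'.subset_interior hC'.isCompact hi',
    integral_inner_sub_supportFn hK hC'.isCompact, (hneg _).1, (hneg _).1,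
    ← couplingDefect_sub (C' := C') (v := v) hT hC.isCompact,
    ← intervalIntegral.integral_comp_sub_right (fun s => supportFn C' (v s))]
  simp only [(hneg _).2]
  have e1 := couplingDefect_sub_position (C := C) (y := y) (w := w) hK hC'.isCompact
    (θ (0 + 1)) (θ (0 + 1 + 1)) (β (0 + 1))
  have e2 := couplingDefect_const hK hT hC hC' hi hi' hdual h h (0 + 1) 0
  rw [real_inner_comm, inner_sub_right] at e1
  rw [inner_sub_right, inner_neg_right, inner_neg_right]
  linarith

/-! ### The proposition. -/

theorem proposition2p17 (K T C C' : Set Plane) (hKT : IsSymmetricConfiguration K T)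
    (hC : IsConvexCaustic K T C) (hC' : IsConvexCaustic T K C')
    (hdual : AreDualCaustics K T C C') :
    (∃ ω : ℝ, (∀ x : ℝ, IsRotationNumber K T C x ↔ x = ω) ∧
      (∀ x : ℝ, IsRotationNumber T K C' x ↔ x = ω)) ∧
    (IsSmoothStrictlyConvexBody C → IsSmoothStrictlyConvexBody C' →
      perimeter T C = perimeter K C' ∧
      ∃ l : ℝ, (∀ x : ℝ, IsLazutkinParameter K T C x ↔ x = l) ∧
        (∀ x : ℝ, IsLazutkinParameter T K C' x ↔ x = l)) := by
  obtain ⟨x, v, hK⟩ := exists_isBoundaryParam hKT.body_left hKT.symm_left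
  obtain ⟨y, w, hT⟩ := exists_isBoundaryParam hKT.body_right hKT.symm_right
  obtain ⟨f, hf⟩ := exists_chord_map hK hC.isCompact hC.convex hC.nonempty hC.subset_interior
  obtain ⟨g, hg⟩ := exists_chord_map hT hC'.isCompact hC'.convex hC'.nonempty hC'.subset_interior
  refine ⟨⟨f.translationNumber, isRotationNumber_iff hK hT hC.subset_interior hf, ?_⟩,
    fun hbC hbC' => ?_⟩
  · rw [rotationNumber_eq hK hT hC hC' hdual hf hg]
    exact isRotationNumber_iff hT hK hC'.subset_interior hg
  · have hi := hbC.interior_nonempty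
    have hi' := hbC'.interior_nonempty
    refine ⟨?_, excess C w (x 0), isLazutkinParameter_iff hK hT hC hi 0, ?_⟩
    · rw [perimeter_eq hT hC.isCompact hC.convex hi, perimeter_eq hK hC'.isCompact hC'.convex hi',
        mixedPerimeter_eq_of_dual hK hT hC hC' hi hi' hdual]
    · rw [excess_eq_of_dual hK hT hC hC' hi hi' hdual 0 0]
      exact isLazutkinParameter_iff hT hK hC' hi' 0
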